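/- Let $G\subset GL_N(\mathbb C)$ be a Zariski closed subgroup whose Lie algebra $\mathfrak g$ is simple, and let $B$ be a nondegenerate invariant symmetric bilinear form on $\mathfrak g$ (for example the Killing form). Let $0\neq\mu\in\mathfrak g$ be a minuscule coweight: $\mathfrak g=\mathfrak n^-\oplus\mathfrak l\oplus\mathfrak n^+$ is the sum of the eigenspaces of $\mathrm{ad}\,\mu$ for the eigenvalues $-1,0,1$. Let $d\ge 1$ be such that $\mu$ acts on $\mathbb C^N$ diagonalizably with eigenvalues in $\frac1d\mathbb Z$, put $z=t^d$, and let $z^\mu$ be the matrix that acts as $t^{k}$ on the $\frac kd$-eigenspace of $\mu$. (If $z^\mu$ is a cocharacter of $G$, for instance if $G$ is of adjoint type in its adjoint representation, take $d=1$; for the simply connected form the charge is fractional.) For a $\mathbb C$-algebra $R$, $G(R)$ denotes the $R$-points of $G$; $G[[z]]=G(\mathbb C[[z]])$, and $G_0[z^{-1}]$, $G_0[[z^{-1}]]$ are the elements of $G(\mathbb C[z^{-1}])$, $G(\mathbb C[[z^{-1}]])$ with value $1$ at $z=\infty$. **(1) Phase space.** Place charge $\mu$ at $0$ and $-\mu$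 at $\infty$. The map $(X^+,X^-)\mapsto L(z)=e^{X^+}z^\mu e^{X^-}$ is a bijection from $\mathfrak n^+\oplus\mathfrak n^-$ to the set of all matrices $L$ over $\mathbb C((t))$ that lie in $G[[z]]\,z^\mu\,G[[z]]$ and in $G_0[z^{-1}]\,z^{\mu}\,G_0[z^{-1}]$. It is also a bijection to the set of all matrices $L$ over $\mathbb C[t,t^{-1}]$ whose expansion at $0$ lies in $G[[z]]\,z^\mu\,G[[z]]$ and whose expansion at $\infty$ lies in $G_0[[z^{-1}]]\,z^{\mu}\,G_0[[z^{-1}]]$. **(2) Symplectic structure.** The form $\omega((x,y),(x',y'))=B(x,y')-B(x',y)$ on $\mathfrak n^+\oplus\mathfrak n^-$ is alternating and nondegenerate. **(3) Poisson bracket.** Let $X^1,\dots,X^r$ and $Y_1,\dots,Y_r$ be bases of $\mathfrak n^+$ and $\mathfrak n^-$ with $B(X^m,Y_n)=\delta^m_n$, let $b_m$, $c^n$ be the corresponding linear coordinates on $\mathfrak n^+\oplus\mathfrak n^-$, and let $A=\mathbb C[b_1,\dots,b_r,c^1,\dots,c^r]$. There is exactly one Poisson bracket on $A$ with $$\{b_n,c^m\}=\delta_n^m,\qquad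 \{b_n,b_m\}=0,\qquad \{c^n,c^m\}=0 .$$ A Poisson bracket on $A$ is this one if and only if the matrix $L(z)=e^{b_mX^m}z^\mu e^{c^nY_n}$, taken in the adjoint representation of $\mathfrak g$, satisfies the classical RLL relation $$\{L(z)\otimes 1,\,1\otimes L(z')\}=\frac{1}{z-z'}\,\bigl[L(z)\otimes L(z'),\,c\bigr]\qquad(z\ne z'\in\mathbb C^\times),$$ where $c$ is the quadratic Casimir of $B$. Equivalently, $\{L^i_j(z),L^k_l(z')\}=\frac1{z-z'}\sum_{r,s}\bigl(c^{ik}_{rs}L^r_j(z)L^s_l(z')-L^i_r(z)L^k_s(z')c^{rs}_{jl}\bigr)$, where $i$ is the initial (column) index and $j$ the final (row) index of $L^i_j$. The same equivalence holds in every nonzero finite dimensional representation $\rho$ of $\mathfrak g$, with $z=t^e$ for any $e\ge1$ such that $\rho(\mu)$ is diagonalizable with eigenvalues in $\frac1e\mathbb Z$. **(4) Type A.** For $G=SL_n$, $d=n=m+1$, $z=t^n$ and $\mu=\mathrm{Diag}(1,0,\dots,0)-\frac1n$, let $$M(z)=\begin{pmatrix} z+\sum_i b_ic_i & b_1&\cdots&b_{m}\\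 c_1&1&\cdots&0\\ \vdots&\vdots&\ddots&\vdots\\ c_{m}&0&\cdots&1\end{pmatrix}.$$ Then $(b,c)\mapsto t^{-1}M(z)=z^{-1/n}M(z)$ is a bijection from $\mathbb C^{m}\times\mathbb C^{m}$ to the phase space defined by $G[[z]]z^\mu G[[z]]$ and $G_0[z^{-1}]z^\mu G_0[z^{-1}]$. The universal $L$-operator with $X^i=E_{1,i+1}$ and $Y_i=E_{i+1,1}$ is $z^{-1/n}M(z)$. A Poisson bracket on $\mathbb C[b_i,c_j]$ makes $M(z)$ satisfy the RLL relation above with $c$ the permutation matrix (the Casimir of $\mathfrak{gl}_n$) if and only if $\{b_i,c_j\}=\delta_{ij}$, $\{b_i,b_j\}=\{c_i,c_j\}=0$. -/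

import Mathlib

open scoped Kronecker Polynomial LaurentPolynomial

attribute [local instance 100] LieRing.ofAssociativeRing

noncomputable section

namespace HooftLine

/-! ### Algebraic groups, their points and their Lie algebras -/

/-- The polynomials in the matrix entries that vanish on the matrix group `G`. -/
def VanishesOn {N : ℕ} (G : Subgroup (GL (Fin N) ℂ)) (f : MvPolynomial (Fin N × Fin N) ℂ) : Prop :=
  ∀ g ∈ G, MvPolynomial.aeval (fun p => (g : Matrix (Fin N) (Fin N) ℂ) p.1 p.2) f = 0

/-- For a `ℂ`-algebra `R`, the set `G(R)` of `R`-points of (the Zariski closure in `GL_N` of) `G`. -/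
def Points {N : ℕ} (G : Subgroup (GL (Fin N) ℂ)) (R : Type*) [CommRing R] [Algebra ℂ R] :
    Set (GL (Fin N) R) :=
  {g | ∀ f, VanishesOn G f →
    MvPolynomial.aeval (fun p => (g : Matrix (Fin N) (Fin N) R) p.1 p.2) f = 0}

/-- `G` is a linear algebraic group: it is Zariski closed in `GL_N(ℂ)`. -/
def IsAlgebraicGroup {N : ℕ} (G : Subgroup (GL (Fin N) ℂ)) : Prop :=
  ∀ g ∈ Points G ℂ, g ∈ G

/-- `𝔤` is the Lie algebra of `G`: the matrices `X` with `exp (s X) ∈ G` for all `s`. -/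
def IsLieAlgebraOf {N : ℕ} (𝔤 : LieSubalgebra ℂ (Matrix (Fin N) (Fin N) ℂ))
    (G : Subgroup (GL (Fin N) ℂ)) : Prop :=
  ∀ X : Matrix (Fin N) (Fin N) ℂ,
    X ∈ 𝔤 ↔ ∀ s : ℂ, ∃ g ∈ G, (g : Matrix (Fin N) (Fin N) ℂ) = NormedSpace.exp (s • X)

/-! ### Minuscule coweights -/

section Lie

variable {𝔤 : Type*} [LieRing 𝔤] [LieAlgebra ℂ 𝔤]

/-- The eigenspace of `ad μ` for the eigenvalue `c`. -/
def adEigenspace (μ : 𝔤) (c : ℂ) : Submodule ℂ 𝔤 :=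
  Module.End.eigenspace (LieAlgebra.ad ℂ 𝔤 μ) c

/-- `𝔫⁺`, the charge `1` part of `𝔤`. -/
abbrev nPlus (μ : 𝔤) : Submodule ℂ 𝔤 := adEigenspace μ 1

/-- `𝔫⁻`, the charge `-1` part of `𝔤`. -/
abbrev nMinus (μ : 𝔤) : Submodule ℂ 𝔤 := adEigenspace μ (-1)

/-- A (nonzero) coweight is minuscule if `𝔤` is the sum of the eigenspaces of `ad μ` for the
eigenvalues `-1`, `0`, `1`. -/
def IsMinuscule (μ : 𝔤) : Prop :=
  μ ≠ 0 ∧ nMinus μ ⊔ adEigenspace μ 0 ⊔ nPlus μ = ⊤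

/-- The form `ω((x, y), (x', y')) = B(x, y') - B(x', y)` on `𝔫⁺ ⊕ 𝔫⁻`. -/
def symplecticForm (B : LinearMap.BilinForm ℂ 𝔤) (μ : 𝔤) :
    LinearMap.BilinForm ℂ (nPlus μ × nMinus μ) :=
  LinearMap.mk₂ ℂ
    (fun p q => B (p.1 : 𝔤) (q.2 : 𝔤) - B (q.1 : 𝔤) (p.2 : 𝔤))
    (by intro p p' q; simp; ring)
    (by intro c p q; simp; ring)
    (by intro p q q'; simp; ring)
    (by intro c p q; simp; ring)

end Lie

/-! ### The (possibly fractional) cocharacter `z ^ μ`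

Fractional powers are handled by a variable `t` with `t ^ d = z`. -/

/-- `T` is diagonalizable with all its eigenvalues in `(1/d) ℤ`, so that `d T` is the derivative of
the one-parameter group `t ↦ t ^ (d T)`. -/
def IsFractional {n : Type*} [Fintype n] [DecidableEq n] (d : ℕ) (T : Matrix n n ℂ) : Prop :=
  ⨆ k : ℤ, Module.End.eigenspace (Matrix.toLin' T) ((k : ℂ) / d) = ⊤

/-- The set of eigenvalues of `T`. -/
def eigenvalues {n : Type*} [Fintype n] [DecidableEq n] (T : Matrix n n ℂ) : Finset ℂ :=
  T.charpoly.roots.toFinset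

/-- For diagonalizable `T` and an eigenvalue `c`, the projection onto the `c`-eigenspace along the
other eigenspaces, as a Lagrange interpolation polynomial in `T`. -/
def eigenProj {n : Type*} [Fintype n] [DecidableEq n] (T : Matrix n n ℂ) (c : ℂ) : Matrix n n ℂ :=
  Polynomial.aeval T (Lagrange.basis (eigenvalues T) id c)

/-- `z ^ T = t ^ (d T)` where `z = t ^ d`, for a unit `t` of a `ℂ`-algebra `R` and a matrix `T` with
`IsFractional d T`: it acts on the `c`-eigenspace of `T` as `t ^ (d c)`, and `d c` is an integer. -/
def zPow {n : Type*} [Fintype n] [DecidableEq n] (d : ℕ) (T : Matrix n n ℂ)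
    {R : Type*} [CommRing R] [Algebra ℂ R] (t : Rˣ) : Matrix n n R :=
  ∑ c ∈ eigenvalues T,
    ((t ^ (round ((d : ℂ) * c).re : ℤ) : Rˣ) : R) • (eigenProj T c).map (algebraMap ℂ R)

/-! ### Double cosets at `0` and at `∞` -/

/-- The variable `t` of `ℂ((t))`, as a unit. -/
def tUnit : (LaurentSeries ℂ)ˣ where
  val := HahnSeries.single (1 : ℤ) 1
  inv := HahnSeries.single (-1 : ℤ) 1
  val_inv := by simp [HahnSeries.single_mul_single]
  inv_val := by simp [HahnSeries.single_mul_single]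

/-- The variable `t` of `ℂ[t, t⁻¹]`, as a unit. -/
def TUnit : (ℂ[T;T⁻¹])ˣ where
  val := LaurentPolynomial.T 1
  inv := LaurentPolynomial.T (-1)
  val_inv := by rw [← LaurentPolynomial.T_add]; simp
  inv_val := by rw [← LaurentPolynomial.T_add]; simp

/-- The embedding `ℂ[[z]] → ℂ((t))`, `z ↦ t ^ d`. -/
def ofPower (d : ℕ) [NeZero d] : PowerSeries ℂ →+* LaurentSeries ℂ :=
  (HahnSeries.ofPowerSeries ℤ ℂ).comp (PowerSeries.expand d (NeZero.ne d)).toRingHom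

/-- The embedding `ℂ[w] → ℂ((t))`, `w ↦ t ^ (-d)`, where `w` stands for `z⁻¹`. -/
def ofPolyInv (d : ℕ) : ℂ[X] →+* LaurentSeries ℂ :=
  (Polynomial.aeval (((tUnit ^ (-(d : ℤ)) : (LaurentSeries ℂ)ˣ)) : LaurentSeries ℂ)).toRingHom

/-- Laurent expansion at `t = 0`, `ℂ[t, t⁻¹] → ℂ((t))`. -/
def expandZero : ℂ[T;T⁻¹] →+* LaurentSeries ℂ :=
  LaurentPolynomial.eval₂ (algebraMap ℂ (LaurentSeries ℂ)) tUnit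

/-- Laurent expansion at `t = ∞`, `ℂ[t, t⁻¹] → ℂ((u))`, `t ↦ u⁻¹`. -/
def expandInfty : ℂ[T;T⁻¹] →+* LaurentSeries ℂ :=
  LaurentPolynomial.eval₂ (algebraMap ℂ (LaurentSeries ℂ)) tUnit⁻¹

section Cosets

variable {N : ℕ} (G : Subgroup (GL (Fin N) ℂ)) (d : ℕ) [NeZero d] (μ : Matrix (Fin N) (Fin N) ℂ)

/-- `G[[z]] z ^ μ G[[z]]`, inside matrices over `ℂ((t))`, `t ^ d = z`: charge `μ` at `0`. -/
def cosetZero : Set (Matrix (Fin N) (Fin N) (LaurentSeries ℂ)) :=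
  {L | ∃ A ∈ Points G (PowerSeries ℂ), ∃ B ∈ Points G (PowerSeries ℂ),
    L = (A : Matrix (Fin N) (Fin N) (PowerSeries ℂ)).map (ofPower d) * zPow d μ tUnit *
      (B : Matrix (Fin N) (Fin N) (PowerSeries ℂ)).map (ofPower d)}

/-- `G₀[z⁻¹] z ^ (-η) G₀[z⁻¹]`, inside matrices over `ℂ((t))`, `t ^ d = z`: charge `η` at `∞`.
Here `G₀[z⁻¹]` consists of the elements of `G(ℂ[z⁻¹])` with value `1` at `z = ∞`. -/
def cosetInfty (η : Matrix (Fin N) (Fin N) ℂ) : Set (Matrix (Fin N) (Fin N) (LaurentSeries ℂ)) :=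
  {L | ∃ A ∈ Points G ℂ[X], ∃ B ∈ Points G ℂ[X],
    (A : Matrix (Fin N) (Fin N) ℂ[X]).map (Polynomial.eval 0) = 1 ∧
    (B : Matrix (Fin N) (Fin N) ℂ[X]).map (Polynomial.eval 0) = 1 ∧
    L = (A : Matrix (Fin N) (Fin N) ℂ[X]).map (ofPolyInv d) * zPow d (-η) tUnit *
      (B : Matrix (Fin N) (Fin N) ℂ[X]).map (ofPolyInv d)}

/-- `G₀[[z⁻¹]] z ^ (-η) G₀[[z⁻¹]]`, inside matrices over `ℂ((u))`, `u ^ d = z⁻¹`: the same condition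
at `∞`, with `G₀[[z⁻¹]]` the elements of `G(ℂ[[z⁻¹]])` with value `1` at `z = ∞`. -/
def cosetInftyFormal (η : Matrix (Fin N) (Fin N) ℂ) :
    Set (Matrix (Fin N) (Fin N) (LaurentSeries ℂ)) :=
  {L | ∃ A ∈ Points G (PowerSeries ℂ), ∃ B ∈ Points G (PowerSeries ℂ),
    (A : Matrix (Fin N) (Fin N) (PowerSeries ℂ)).map (PowerSeries.constantCoeff (R := ℂ)) = 1 ∧
    (B : Matrix (Fin N) (Fin N) (PowerSeries ℂ)).map (PowerSeries.constantCoeff (R := ℂ)) = 1 ∧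
    L = (A : Matrix (Fin N) (Fin N) (PowerSeries ℂ)).map (ofPower d) * zPow d (-η) tUnit⁻¹ *
      (B : Matrix (Fin N) (Fin N) (PowerSeries ℂ)).map (ofPower d)}

/-- The phase space with charge `μ` at `0` and `η` at `∞`, as a subset of the loop group. -/
def phaseSpace (η : Matrix (Fin N) (Fin N) ℂ) : Set (Matrix (Fin N) (Fin N) (LaurentSeries ℂ)) :=
  cosetZero G d μ ∩ cosetInfty G d η

/-- The phase space with charge `μ` at `0` and `η` at `∞`, as a set of regular functions on the
punctured line whose Laurent expansions at `0` and at `∞` lie in the double cosets. -/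
def phaseSpaceFormal (η : Matrix (Fin N) (Fin N) ℂ) : Set (Matrix (Fin N) (Fin N) ℂ[T;T⁻¹]) :=
  {L | L.map expandZero ∈ cosetZero G d μ ∧ L.map expandInfty ∈ cosetInftyFormal G d η}

end Cosets

/-- `e ^ {X⁺} z ^ μ e ^ {X⁻}` over a `ℂ`-algebra `R` with a unit `t`, `t ^ d = z`, for constant
nilpotent matrices `X⁺` and `X⁻`. -/
def expForm {n : Type*} [Fintype n] [DecidableEq n] (d : ℕ) (μ : Matrix n n ℂ)
    {R : Type*} [CommRing R] [Algebra ℂ R] (t : Rˣ) (Xp Xm : Matrix n n ℂ) : Matrix n n R :=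
  (IsNilpotent.exp Xp).map (algebraMap ℂ R) * zPow d μ t *
    (IsNilpotent.exp Xm).map (algebraMap ℂ R)

/-! ### Poisson brackets and the classical RLL relation -/

/-- A Poisson bracket on a commutative `ℂ`-algebra. -/
structure PoissonBracket (A : Type*) [CommRing A] [Algebra ℂ A] where
  /-- the bracket -/
  br : A →ₗ[ℂ] A →ₗ[ℂ] A
  br_self : ∀ a, br a a = 0
  leibniz : ∀ a b c, br a (b * c) = br a b * c + b * br a c
  jacobi : ∀ a b c, br a (br b c) + br b (br c a) + br c (br a b) = 0

/-- The coordinate ring `ℂ[b₁, …, b_r, c¹, …, c^r]` of `𝔫⁺ ⊕ 𝔫⁻`. -/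
abbrev Coord (r : ℕ) : Type := MvPolynomial (Fin r ⊕ Fin r) ℂ

/-- The coordinate `b_m` on `𝔫⁺`. -/
def bVar {r : ℕ} (m : Fin r) : Coord r := MvPolynomial.X (Sum.inl m)

/-- The coordinate `c^m` on `𝔫⁻`. -/
def cVar {r : ℕ} (m : Fin r) : Coord r := MvPolynomial.X (Sum.inr m)

/-- `{b_n, c^m} = δ_n^m`, `{b_n, b_m} = 0`, `{c^n, c^m} = 0`. -/
def IsCanonical {r : ℕ} (P : PoissonBracket (Coord r)) : Prop :=
  (∀ n m, P.br (bVar n) (cVar m) = if n = m then 1 else 0) ∧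
  (∀ n m, P.br (bVar n) (bVar m) = 0) ∧
  (∀ n m, P.br (cVar n) (cVar m) = 0)

/-- The `L`-operator `L(z) = e ^ {b_m X^m} z ^ μ e ^ {c^n Y_n}`, with entries functions on the phase
space, at the point `z = t ^ d`; the matrices `μ`, `X^m`, `Y_n` are those of a representation. -/
def LOp {n : Type*} [Fintype n] [DecidableEq n] {r : ℕ} (d : ℕ) (μ : Matrix n n ℂ)
    (X Y : Fin r → Matrix n n ℂ) (t : ℂˣ) : Matrix n n (Coord r) :=
  IsNilpotent.exp (∑ m, bVar m • (X m).map (algebraMap ℂ (Coord r))) *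
    zPow d μ (Units.map (algebraMap ℂ (Coord r)).toMonoidHom t) *
    IsNilpotent.exp (∑ m, cVar m • (Y m).map (algebraMap ℂ (Coord r)))

/-- The classical RLL relation
`{L(z) ⊗ 1, 1 ⊗ L(z')} = (z - z')⁻¹ [L(z) ⊗ L(z'), c]`, with `z = t ^ d` and `z' = s ^ d`.
The matrix element of `L` from the initial state `i` to the final state `j` is `L j i`, so in terms
of `L^i_j = L j i` it reads
`{L^i_j(z), L^k_l(z')} = (z - z')⁻¹ ∑ (c^{ik}_{rs} L^r_j(z) L^s_l(z') - L^i_r(z) L^k_s(z') c^{rs}_{jl})`. -/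
def RLL {n : Type*} [Fintype n] [DecidableEq n] {r : ℕ} (d : ℕ) (c : Matrix (n × n) (n × n) ℂ)
    (L : ℂˣ → Matrix n n (Coord r)) (P : PoissonBracket (Coord r)) : Prop :=
  ∀ t s : ℂˣ, (t : ℂ) ^ d ≠ (s : ℂ) ^ d → ∀ i j k l : n,
    P.br (L t j i) (L s l k) =
      ((t : ℂ) ^ d - (s : ℂ) ^ d)⁻¹ •
        ((L t ⊗ₖ L s) * c.map (algebraMap ℂ (Coord r)) -
          c.map (algebraMap ℂ (Coord r)) * (L t ⊗ₖ L s)) (j, l) (i, k)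

/-- The quadratic Casimir `∑ e_a ⊗ e^a` of the invariant form `B`, acting on the tensor square of a
representation `ρ`; here `e_a` and `e^a` are `B`-dual bases of `𝔤`. -/
def casimir {𝔤 : Type*} [LieRing 𝔤] [LieAlgebra ℂ 𝔤] [Module.Finite ℂ 𝔤]
    (B : LinearMap.BilinForm ℂ 𝔤) (hB : B.Nondegenerate)
    {n : Type*} (ρ : 𝔤 → Matrix n n ℂ) : Matrix (n × n) (n × n) ℂ :=
  ∑ a, ρ (Module.finBasis ℂ 𝔤 a) ⊗ₖ ρ (B.dualBasis hB (Module.finBasis ℂ 𝔤) a)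

/-- The adjoint representation, in matrices with respect to a basis of `𝔤`. -/
def adMatrix {𝔤 : Type*} [LieRing 𝔤] [LieAlgebra ℂ 𝔤] [Module.Finite ℂ 𝔤] (x : 𝔤) :
    Matrix (Fin (Module.finrank ℂ 𝔤)) (Fin (Module.finrank ℂ 𝔤)) ℂ :=
  LinearMap.toMatrix (Module.finBasis ℂ 𝔤) (Module.finBasis ℂ 𝔤) (LieAlgebra.ad ℂ 𝔤 x)

/-! ### Type A -/

/-- `SL_n(ℂ)` inside `GL_n(ℂ)`. -/
def SLGroup (n : ℕ) : Subgroup (GL (Fin n) ℂ) :=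
  (Matrix.GeneralLinearGroup.det (n := Fin n) (R := ℂ)).ker

/-- The coweight `Diag(1, 0, …, 0) - (1/n)` of `𝔰𝔩_n`, `n = m + 1`. -/
def muA (m : ℕ) : Matrix (Fin (m + 1)) (Fin (m + 1)) ℂ :=
  Matrix.single 0 0 1 - ((m + 1 : ℂ)⁻¹) • 1

/-- The oscillator `L`-operator
`[[z + ∑ bᵢ cᵢ, b₁, …, b_m], [c₁, 1, …, 0], …, [c_m, 0, …, 1]]`. -/
def oscL {R : Type*} [CommRing R] {m : ℕ} (b c : Fin m → R) (z : R) :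
    Matrix (Fin (m + 1)) (Fin (m + 1)) R :=
  Matrix.of (Fin.cons (Fin.cons (z + ∑ i, b i * c i) b)
    (fun i => Fin.cons (c i) (fun j => if i = j then 1 else 0)))

/-- The quadratic Casimir of `𝔤𝔩_n`, which exchanges the two tensor factors. -/
def swapMatrix (n : Type*) [DecidableEq n] : Matrix (n × n) (n × n) ℂ :=
  Matrix.of fun p q => if p.1 = q.2 ∧ p.2 = q.1 then 1 else 0

end HooftLine

end

/-! Write `z = t ^ d` and `w = z⁻¹`, and call the eigenvalues of `ad μ` weights. Only the weights
-1, 0, 1 occur in `𝔤`. Hence `𝔫⁺` and `𝔫⁻` are abelian, their elements are nilpotent matrices, and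
conjugation by `z ^ μ` multiplies weight `k` by `z ^ k`.

Phase space. The condition at 0 is visible for `e^x z^μ e^y`, and the one at infinity follows from
`e^x z^μ e^y = (e^x e^{wy} e^{-x}) z^μ e^{wx}` (`expForm_eq`). Conversely, let `L` have Laurent
polynomial entries and lie in the phase space, and let `y ∈ 𝔫⁻`. Near 0, `L y L⁻¹` is `z⁻¹` times a
power series in `z`. Near infinity `L = C z^μ D` with `D = 1 + β w + ...`, and the parts of `D y
D⁻¹` of weight -1, 0, 1 start in order 0, 1, 2 in `w`. So `L y L⁻¹` is divisible by `w`, with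
leading coefficient `y + [x, y] + ½ [x, [x, y]] = e^x y e^{-x}`, where `x` is the weight 1 part of
`β`. Both bounds together force `L y L⁻¹ = z⁻¹ e^x y e^{-x}` (`laurent_conj_eq`). The same argument
for `L⁻¹` and `𝔫⁺`, with `μ` replaced by `-μ`, produces `y' ∈ 𝔫⁻`. The loop `c = e^{-x} L e^{y'}
z^{-μ}` then commutes with `𝔫⁺` and `𝔫⁻`, hence with `𝔤`, which they generate because `𝔤` is simple
(`IsMinuscule.lieSpan_eq_top`). Its logarithmic derivative is central in `𝔤`, so it vanishes and `c`
is constant (`exists_eq_extM_of_commute`). Comparison of diagonal blocks at infinity gives `c = 1`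
(`CoweightData.eq_one_of_coset`). If the factors at infinity are polynomial in `w`, then `L` has
Laurent polynomial entries, so that version reduces to this one (`CoweightData.exists_laurent`).

The group enters through its complex points and their exponentials only. What is needed about
`R`-points (products, conjugation preserves `𝔤`, first order deformations of the identity lie in
`𝔤`) is transferred from `G(ℂ)` by polynomial identities.

RLL relation. Since `𝔫⁺` and `𝔫⁻` are abelian, every coordinate derivative of `L` is `e^x V z^μ
e^y`, with `V = X^m` or `V = z⁻¹ Y_m`. The Casimir commutes with `e^x ⊗ e^x` and `e^y ⊗ e^y`, so
only its commutator with `z^μ ⊗ z'^μ` matters. After division by `z - z'` this commutator is exactly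
the canonical bivector contracted with the matrices `V` (`RLLData.zPow_casimir`). Thus the two sides
differ by the brackets of the coordinates minus their canonical values, contracted with the tensors
`V_a ⊗ V_b`. These are linearly independent, since a nonzero representation of a simple algebra is
faithful, and the equivalence follows (`RLLData.rll_iff`).

Type A. The nilpotent matrices square to zero, so `e^x = 1 + x`, and `M(z)` is the product of an
upper unipotent, a diagonal and a lower unipotent matrix. The hypotheses of the general arguments
are checked directly for `SL_n` and for the permutation matrix. -/

noncomputable section

namespace HooftLine

set_option linter.unusedSectionVars false

/-! ### Spectral projections and weights -/

section Weights

variable {n : Type*} [Fintype n] [DecidableEq n] {R : Type*} [CommRing R] [Algebra ℂ R]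

/-- Extension of scalars for matrices. -/
abbrev extM (R : Type*) [CommRing R] [Algebra ℂ R] (M : Matrix n n ℂ) : Matrix n n R :=
  M.map (algebraMap ℂ R)

theorem extM_mul (M M' : Matrix n n ℂ) : extM R (M * M') = extM R M * extM R M' :=
  Matrix.map_mul

theorem extM_one : extM R (1 : Matrix n n ℂ) = 1 :=
  Matrix.map_one _ (map_zero _) (map_one _)

theorem extM_smul (c : ℂ) (M : Matrix n n ℂ) : extM R (c • M) = c • extM R M := by
  ext i j
  change algebraMap ℂ R (c * M i j) = c • algebraMap ℂ R (M i j)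
  rw [map_mul, Algebra.smul_def]

theorem extM_add (M M' : Matrix n n ℂ) : extM R (M + M') = extM R M + extM R M' := by
  ext i j; simp

theorem extM_sub (M M' : Matrix n n ℂ) : extM R (M - M') = extM R M - extM R M' := by
  ext i j; simp

theorem extM_neg (M : Matrix n n ℂ) : extM R (-M) = -extM R M := by
  ext i j; simp

theorem extM_zero : extM R (0 : Matrix n n ℂ) = 0 := by
  ext i j; simp

theorem extM_sum {ι : Type*} (s : Finset ι) (f : ι → Matrix n n ℂ) :
    extM R (∑ i ∈ s, f i) = ∑ i ∈ s, extM R (f i) :=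
  map_sum (AddMonoidHom.mapMatrix (algebraMap ℂ R : ℂ →+ R)) f s

theorem extM_pow (M : Matrix n n ℂ) (k : ℕ) : extM R (M ^ k) = extM R M ^ k :=
  map_pow (RingHom.mapMatrix (algebraMap ℂ R)) M k

theorem matrix_ext_of_eigenvectors {d : ℕ} {T : Matrix n n ℂ} (hT : IsFractional d T)
    {M M' : Matrix n n ℂ}
    (h : ∀ (k : ℤ) (v : n → ℂ), v ≠ 0 → T.mulVec v = ((k : ℂ) / d) • v →
      M.mulVec v = M'.mulVec v) : M = M' := by
  apply Matrix.toLin'.injective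
  apply LinearMap.ext
  intro v
  have hv : v ∈ ⨆ k : ℤ, Module.End.eigenspace (Matrix.toLin' T) ((k : ℂ) / d) := by
    rw [hT]; trivial
  induction hv using Submodule.iSup_induction' with
  | mem k v hv =>
    rw [Module.End.mem_eigenspace_iff] at hv
    by_cases h0 : v = 0
    · simp [h0]
    · simpa using h k v h0 (by simpa using hv)
  | zero => simp
  | add v w _ _ hv hw => rw [map_add, map_add, hv, hw]

theorem aeval_mul_of_mul_eq {T M : Matrix n n ℂ} {c : ℂ} (h : T * M = c • M) (p : ℂ[X]) :
    Polynomial.aeval T p * M = p.eval c • M := by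
  induction p using Polynomial.induction_on' with
  | add p q hp hq => simp [add_mul, hp, hq, add_smul]
  | monomial k a =>
    have : T ^ k * M = c ^ k • M := by
      induction k with
      | zero => simp
      | succ k ih => rw [pow_succ, mul_assoc, h, mul_smul_comm, ih, smul_smul, pow_succ, mul_comm]
    simp [Polynomial.aeval_monomial, this, Algebra.algebraMap_eq_smul_one, smul_smul]

theorem aeval_mulVec {T : Matrix n n ℂ} {c : ℂ} {v : n → ℂ} (h : T.mulVec v = c • v) (p : ℂ[X]) :
    (Polynomial.aeval T p).mulVec v = p.eval c • v := by
  induction p using Polynomial.induction_on' with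
  | add p q hp hq => simp [Matrix.add_mulVec, hp, hq, add_smul]
  | monomial k a =>
    have : (T ^ k).mulVec v = c ^ k • v := by
      induction k with
      | zero => simp
      | succ k ih =>
        rw [pow_succ, ← Matrix.mulVec_mulVec, h, Matrix.mulVec_smul, ih, smul_smul, pow_succ,
          mul_comm]
    simp [Polynomial.aeval_monomial, Algebra.algebraMap_eq_smul_one, this, smul_smul,
      Matrix.smul_mulVec]

theorem mem_eigenvalues_of_mulVec {T : Matrix n n ℂ} {c : ℂ} {v : n → ℂ} (hv : v ≠ 0)
    (h : T.mulVec v = c • v) : c ∈ eigenvalues T := by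
  have : Module.End.HasEigenvalue (Matrix.toLin' T) c :=
    Module.End.hasEigenvalue_of_hasEigenvector
      (x := v) ⟨Module.End.mem_eigenspace_iff.2 (by simpa using h), hv⟩
  rw [Module.End.hasEigenvalue_iff_isRoot_charpoly] at this
  rw [eigenvalues, Multiset.mem_toFinset, Polynomial.mem_roots (Matrix.charpoly_monic T).ne_zero]
  simpa using this

theorem eigenProj_mulVec {T : Matrix n n ℂ} {c c' : ℂ} {v : n → ℂ} (hv : v ≠ 0)
    (h : T.mulVec v = c' • v) (hc : c ∈ eigenvalues T) :
    (eigenProj T c).mulVec v = if c = c' then v else 0 := by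
  have hc' := mem_eigenvalues_of_mulVec hv h
  rw [eigenProj, aeval_mulVec h]
  split_ifs with hcc
  · subst hcc
    have := Lagrange.eval_basis_self (s := eigenvalues T) (v := id) (i := c)
      (Set.injOn_id _) hc
    simp only [id] at this
    rw [this, one_smul]
  · have := Lagrange.eval_basis_of_ne (s := eigenvalues T) (v := id) (i := c) (j := c') hcc hc'
    simp only [id] at this
    rw [this, zero_smul]

variable {d : ℕ} {T : Matrix n n ℂ}

theorem sum_mulVec {ι : Type*} (s : Finset ι) (f : ι → Matrix n n ℂ) (v : n → ℂ) :
    (∑ i ∈ s, f i).mulVec v = ∑ i ∈ s, (f i).mulVec v := by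
  classical
  induction s using Finset.induction_on with
  | empty => simp
  | insert a s ha ih => simp [Finset.sum_insert ha, Matrix.add_mulVec, ih]

theorem sum_eigenProj (hT : IsFractional d T) : ∑ c ∈ eigenvalues T, eigenProj T c = 1 := by
  refine matrix_ext_of_eigenvectors hT fun k v hv h => ?_
  rw [sum_mulVec, Finset.sum_congr rfl fun c hc => eigenProj_mulVec hv h hc]
  simp [mem_eigenvalues_of_mulVec hv h]

theorem mul_eigenProj (hT : IsFractional d T) {c : ℂ} (hc : c ∈ eigenvalues T) :
    T * eigenProj T c = c • eigenProj T c := by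
  refine matrix_ext_of_eigenvectors hT fun k v hv h => ?_
  rw [← Matrix.mulVec_mulVec, Matrix.smul_mulVec, eigenProj_mulVec hv h hc]
  split_ifs with hcc
  · rw [h, hcc]
  · simp

theorem eigenProj_comm (c : ℂ) : eigenProj T c * T = T * eigenProj T c := by
  have := Polynomial.aeval_mul (R := ℂ) (x := T) (p := Lagrange.basis (eigenvalues T) id c)
    (q := Polynomial.X)
  rw [mul_comm, Polynomial.aeval_mul] at this
  simpa [eigenProj] using this.symm

theorem eigenProj_mul (hT : IsFractional d T) {c : ℂ} (hc : c ∈ eigenvalues T) :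
    eigenProj T c * T = c • eigenProj T c := by
  rw [eigenProj_comm, mul_eigenProj hT hc]

theorem eigenProj_mul_eigenProj (hT : IsFractional d T) {c c' : ℂ} (hc : c ∈ eigenvalues T)
    (hc' : c' ∈ eigenvalues T) :
    eigenProj T c * eigenProj T c' = if c = c' then eigenProj T c else 0 := by
  refine matrix_ext_of_eigenvectors hT fun k v hv h => ?_
  rw [← Matrix.mulVec_mulVec, eigenProj_mulVec hv h hc']
  split_ifs with h1 h2 h2
  · rfl
  · rw [eigenProj_mulVec hv h hc, if_neg (by rintro rfl; exact h2 h1.symm)]; simp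
  · rw [eigenProj_mulVec hv h hc, if_neg (by rintro rfl; exact h1 h2.symm)]; simp
  · simp

/-- `M` is an eigenvector of `ad T` with eigenvalue `a`. -/
def HasWeight (T : Matrix n n ℂ) (a : ℂ) (M : Matrix n n R) : Prop :=
  extM R T * M - M * extM R T = a • M

theorem HasWeight.mul {a b : ℂ} {M M' : Matrix n n R} (h : HasWeight T a M)
    (h' : HasWeight T b M') : HasWeight T (a + b) (M * M') := by
  have : extM R T * (M * M') - M * M' * extM R T =
    (extM R T * M - M * extM R T) * M' + M * (extM R T * M' - M' * extM R T) := by noncomm_ring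
  rw [HasWeight, this, h, h', add_smul, smul_mul_assoc, mul_smul_comm]

theorem HasWeight.one : HasWeight T 0 (1 : Matrix n n R) := by simp [HasWeight]

theorem HasWeight.pow {a : ℂ} {M : Matrix n n R} (h : HasWeight T a M) (k : ℕ) :
    HasWeight T (k * a) (M ^ k) := by
  induction k with
  | zero => simpa using HasWeight.one
  | succ k ih => rw [pow_succ]; convert ih.mul h using 1; push_cast; ring

theorem HasWeight.extend {a : ℂ} {M : Matrix n n ℂ} (h : T * M - M * T = a • M) :
    HasWeight T a (extM R M) := by
  rw [HasWeight, ← extM_mul, ← extM_mul, ← extM_sub, h, extM_smul]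

theorem HasWeight.map {S : Type*} [CommRing S] [Algebra ℂ S] {a : ℂ} {M : Matrix n n R}
    (h : HasWeight T a M) (f : R →ₐ[ℂ] S) : HasWeight T a (M.map f) := by
  have h1 := congrArg (fun N => N.map f) (show _ = _ from h)
  have h2 : (extM R T).map f = extM S T := by ext i j; simp
  rw [HasWeight, ← h2, ← Matrix.map_mul, ← Matrix.map_mul]
  ext i j
  simpa only [Matrix.map_apply, Matrix.sub_apply, Matrix.smul_apply, map_sub, map_smul]
    using congrFun (congrFun h1 i) j

theorem HasWeight.add {a : ℂ} {M M' : Matrix n n R} (h : HasWeight T a M)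
    (h' : HasWeight T a M') : HasWeight T a (M + M') := by
  have : extM R T * (M + M') - (M + M') * extM R T =
    (extM R T * M - M * extM R T) +
      (extM R T * M' - M' * extM R T) := by noncomm_ring
  rw [HasWeight, this, h, h', smul_add]

theorem HasWeight.smul {a : ℂ} {M : Matrix n n R} (h : HasWeight T a M) (r : R) :
    HasWeight T a (r • M) := by
  rw [HasWeight, mul_smul_comm, smul_mul_assoc, ← smul_sub, h, smul_comm]

theorem HasWeight.zero {a : ℂ} : HasWeight T a (0 : Matrix n n R) := by simp [HasWeight]

theorem HasWeight.sum {a : ℂ} {ι : Type*} (s : Finset ι) {M : ι → Matrix n n R}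
    (h : ∀ i ∈ s, HasWeight T a (M i)) : HasWeight T a (∑ i ∈ s, M i) := by
  classical
  induction s using Finset.induction_on with
  | empty => simpa using HasWeight.zero
  | insert i s hi ih =>
    rw [Finset.sum_insert hi]
    exact (h i (by simp)).add (ih fun j hj => h j (by simp [hj]))

theorem smul_matrix_cancel {a : ℂ} (ha : a ≠ 0) {M : Matrix n n R} (h : a • M = 0) : M = 0 := by
  have := congrArg (a⁻¹ • ·) h
  simpa [smul_smul, ha] using this

/-- On the block from the `c'`-eigenspace to the `c`-eigenspace, `ad T` acts as the scalar `c - c'`.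
A matrix of weight `a` therefore has only blocks with `c - c' = a`. -/
theorem extM_eigenProj_mul_mul (hT : IsFractional d T) {a : ℂ} {M : Matrix n n R}
    (h : HasWeight T a M) {c c' : ℂ} (hc : c ∈ eigenvalues T) (hc' : c' ∈ eigenvalues T)
    (hne : c - c' ≠ a) : extM R (eigenProj T c) * M * extM R (eigenProj T c') = 0 := by
  have h1 : extM R (eigenProj T c) * (extM R T * M - M * extM R T) * extM R (eigenProj T c') =
      (c - c') • (extM R (eigenProj T c) * M * extM R (eigenProj T c')) := by
    have e1 : extM R (eigenProj T c) * extM R T = c • extM R (eigenProj T c) := by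
      rw [← extM_mul, eigenProj_mul hT hc, extM_smul]
    have e2 : extM R T * extM R (eigenProj T c') = c' • extM R (eigenProj T c') := by
      rw [← extM_mul, mul_eigenProj hT hc', extM_smul]
    rw [mul_sub, sub_mul, ← mul_assoc, e1, ← mul_assoc, mul_assoc _ (extM R T), e2, sub_smul]
    simp
  rw [show _ = _ from h, mul_smul_comm, smul_mul_assoc] at h1
  refine smul_matrix_cancel (sub_ne_zero.2 hne) ?_
  rw [sub_smul, ← h1, sub_self]

theorem sum_extM_eigenProj (hT : IsFractional d T) :
    ∑ c ∈ eigenvalues T, extM R (eigenProj T c) = 1 := by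
  rw [← extM_sum, sum_eigenProj hT, extM_one]

theorem HasWeight.eq_zero (hT : IsFractional d T) {a : ℂ} {M : Matrix n n R}
    (h : HasWeight T a M) (ha : ∀ c ∈ eigenvalues T, ∀ c' ∈ eigenvalues T, c - c' ≠ a) : M = 0 := by
  rw [← one_mul M, ← mul_one (1 * M), ← sum_extM_eigenProj hT, Finset.sum_mul, Finset.sum_mul]
  refine Finset.sum_eq_zero fun c hc => ?_
  rw [Finset.mul_sum]
  exact Finset.sum_eq_zero fun c' hc' => extM_eigenProj_mul_mul hT h hc hc' (ha c hc c' hc')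

theorem HasWeight.isNilpotent (hT : IsFractional d T) {a : ℂ} (ha : a ≠ 0) {M : Matrix n n R}
    (h : HasWeight T a M) : IsNilpotent M := by
  classical
  -- `M ^ k` has weight `k * a`, so it can be nonzero only if `k * a` is a difference of two
  -- eigenvalues of `T`. `S` is the finite set of these exceptional `k`.
  let S : Finset ℂ := (eigenvalues T ×ˢ eigenvalues T).image fun p => (p.1 - p.2) / a
  obtain ⟨k, hk⟩ : ∃ k : ℕ, (k : ℂ) ∉ S := by
    by_contra! hall
    exact Set.infinite_univ (α := ℕ) (Set.Finite.of_finite_image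
      (S.finite_toSet.subset (by rintro _ ⟨k, -, rfl⟩; exact hall k)) (Nat.cast_injective.injOn))
  refine ⟨k, (h.pow k).eq_zero hT fun c hc c' hc' hcc => hk ?_⟩
  exact Finset.mem_image.2 ⟨(c, c'), by simp [hc, hc'], by simp [hcc, ha]⟩

theorem zPow_mul_extM_eigenProj (hT : IsFractional d T) (t : Rˣ) {c : ℂ} (hc : c ∈ eigenvalues T) :
    zPow d T t * extM R (eigenProj T c) =
      ((t ^ (round ((d : ℂ) * c).re : ℤ) : Rˣ) : R) • extM R (eigenProj T c) := by
  rw [zPow, Finset.sum_mul, Finset.sum_eq_single c]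
  · rw [smul_mul_assoc, ← Matrix.map_mul, eigenProj_mul_eigenProj hT hc hc, if_pos rfl]
  · intro b hb hbc
    rw [smul_mul_assoc, ← Matrix.map_mul, eigenProj_mul_eigenProj hT hb hc, if_neg hbc]
    simp
  · exact fun h => absurd hc h

theorem extM_eigenProj_mul_zPow (hT : IsFractional d T) (t : Rˣ) {c : ℂ} (hc : c ∈ eigenvalues T) :
    extM R (eigenProj T c) * zPow d T t =
      ((t ^ (round ((d : ℂ) * c).re : ℤ) : Rˣ) : R) • extM R (eigenProj T c) := by
  rw [zPow, Finset.mul_sum, Finset.sum_eq_single c]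
  · rw [mul_smul_comm, ← Matrix.map_mul, eigenProj_mul_eigenProj hT hc hc, if_pos rfl]
  · intro b hb hbc
    rw [mul_smul_comm, ← Matrix.map_mul, eigenProj_mul_eigenProj hT hc hb, if_neg hbc.symm]
    simp
  · exact fun h => absurd hc h

theorem zPow_mul_zPow_inv (hT : IsFractional d T) (t : Rˣ) :
    zPow d T t * zPow d T t⁻¹ = 1 := by
  rw [← sum_extM_eigenProj hT, zPow.eq_def d T t⁻¹, Finset.mul_sum]
  refine Finset.sum_congr rfl fun c hc => ?_
  rw [mul_smul_comm, zPow_mul_extM_eigenProj hT t hc, smul_smul, ← Units.val_mul, inv_zpow,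
    inv_mul_cancel, Units.val_one, one_smul]

theorem zPow_inv_mul_zPow (hT : IsFractional d T) (t : Rˣ) :
    zPow d T t⁻¹ * zPow d T t = 1 := by
  simpa using zPow_mul_zPow_inv hT t⁻¹

theorem map_zPow {S : Type*} [CommRing S] [Algebra ℂ S] (f : R →ₐ[ℂ] S) (t : Rˣ) :
    (zPow d T t).map f = zPow d T (Units.map (f : R →* S) t) := by
  ext i j
  simp [zPow, Matrix.sum_apply, ← map_zpow]

/-- Conjugation by `z ^ T` multiplies a matrix of integral weight `k` by `z ^ k`. -/
theorem HasWeight.zPow_mul (hT : IsFractional d T) {k : ℤ} {M : Matrix n n R}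
    (h : HasWeight T k M) (t : Rˣ) :
    zPow d T t * M = ((t ^ (d * k : ℤ) : Rˣ) : R) • (M * zPow d T t) := by
  have e1 : zPow d T t * M = zPow d T t * (∑ c ∈ eigenvalues T, extM R (eigenProj T c)) * M *
      ∑ c' ∈ eigenvalues T, extM R (eigenProj T c') := by
    rw [sum_extM_eigenProj hT, mul_one, mul_one]
  have e2 : M * zPow d T t = (∑ c ∈ eigenvalues T, extM R (eigenProj T c)) * M *
      ((∑ c' ∈ eigenvalues T, extM R (eigenProj T c')) * zPow d T t) := by
    rw [sum_extM_eigenProj hT, one_mul, one_mul]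
  rw [e1, e2]
  simp only [Finset.mul_sum, Finset.sum_mul, Finset.smul_sum]
  refine Finset.sum_congr rfl fun c' hc' => Finset.sum_congr rfl fun c hc => ?_
  rw [zPow_mul_extM_eigenProj hT t hc, extM_eigenProj_mul_zPow hT t hc', smul_mul_assoc,
    smul_mul_assoc, mul_smul_comm, smul_smul, ← Units.val_mul, ← zpow_add]
  -- Only blocks with `c = k + c'` survive. There `d c` and `d c'` differ by the integer `d k`,
  -- which `round` passes through.
  by_cases hcc : c - c' = k
  · have : ((d : ℂ) * c).re = ((d * k : ℤ) : ℝ) + ((d : ℂ) * c').re := by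
      rw [show c = k + c' by rw [← hcc]; ring, mul_add, Complex.add_re]
      congr 1
      have : ((d : ℂ) * (k : ℂ)) = (((d * k : ℤ) : ℝ) : ℂ) := by push_cast; ring
      rw [this, Complex.ofReal_re]
    rw [this, round_intCast_add]
  · rw [extM_eigenProj_mul_mul hT h hc hc' hcc]
    simp

theorem zPow_mul_of_mul_eq {k : ℤ} (hd : d ≠ 0) {M : Matrix n n ℂ}
    (h : T * M = ((k : ℂ) / d) • M) (t : Rˣ) :
    zPow d T t * extM R M = ((t ^ k : Rˣ) : R) • extM R M := by
  by_cases hM : M = 0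
  · simp [hM]
  have hk : (k : ℂ) / d ∈ eigenvalues T := by
    obtain ⟨j, hj⟩ : ∃ j, (fun i => M i j) ≠ 0 := by
      by_contra! hall
      exact hM (by ext i j; exact congrFun (hall j) i)
    refine mem_eigenvalues_of_mulVec hj ?_
    funext i
    exact congrFun (congrFun h i) j
  have hP : ∀ c ∈ eigenvalues T, eigenProj T c * M = if c = (k : ℂ) / d then M else 0 := by
    intro c hc
    rw [eigenProj, aeval_mul_of_mul_eq h]
    split_ifs with hcc
    · have := Lagrange.eval_basis_self (s := eigenvalues T) (v := id) (i := c) (Set.injOn_id _) hc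
      simp only [id] at this
      rw [← hcc, this, one_smul]
    · have := Lagrange.eval_basis_of_ne (s := eigenvalues T) (v := id) (i := c) hcc hk
      simp only [id] at this
      rw [this, zero_smul]
  rw [zPow, Finset.sum_mul, Finset.sum_eq_single ((k : ℂ) / d)]
  · rw [smul_mul_assoc, ← Matrix.map_mul, hP _ hk, if_pos rfl]
    congr 3
    rw [mul_div_cancel₀ _ (by exact_mod_cast hd)]
    simp
  · intro b hb hbc
    rw [smul_mul_assoc, ← Matrix.map_mul, hP _ hb, if_neg hbc]
    simp
  · exact fun h => absurd hk h

theorem zPow_mulVec {k : ℤ} (hd : d ≠ 0) {v : n → ℂ}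
    (h : T.mulVec v = ((k : ℂ) / d) • v) (t : ℂˣ) :
    (zPow d T t).mulVec v = ((t ^ k : ℂˣ) : ℂ) • v := by
  by_cases hv : v = 0
  · simp [hv]
  have hk := mem_eigenvalues_of_mulVec hv h
  rw [zPow, sum_mulVec, Finset.sum_eq_single ((k : ℂ) / d)]
  · rw [Matrix.smul_mulVec, show (eigenProj T ((k : ℂ) / d)).map (algebraMap ℂ ℂ) =
      eigenProj T ((k : ℂ) / d) from rfl, eigenProj_mulVec hv h hk, if_pos rfl,
      mul_div_cancel₀ _ (by exact_mod_cast hd)]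
    simp
  · intro b hb hbc
    rw [Matrix.smul_mulVec, show (eigenProj T b).map (algebraMap ℂ ℂ) =
      eigenProj T b from rfl, eigenProj_mulVec hv h hb, if_neg hbc, smul_zero]
  · exact fun h => absurd hk h

/-- Every positive power of `M` shifts eigenvalues by a nonzero amount, so it has no diagonal block.
Only the constant term of the exponential contributes. -/
theorem HasWeight.eigenProj_exp (hT : IsFractional d T) {a : ℂ} (ha : a ≠ 0) {M : Matrix n n ℂ}
    (h : HasWeight T a M) {c : ℂ} (hc : c ∈ eigenvalues T) :
    eigenProj T c * IsNilpotent.exp M * eigenProj T c = eigenProj T c := by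
  obtain ⟨k, hk⟩ := h.isNilpotent hT ha
  have hk' : M ^ (k + 1) = 0 := by rw [pow_succ, hk, zero_mul]
  rw [IsNilpotent.exp_eq_sum hk', Finset.sum_range_succ', mul_add, add_mul, Finset.mul_sum,
    Finset.sum_mul, Finset.sum_eq_zero]
  · simp [eigenProj_mul_eigenProj hT hc hc]
  · intro i _
    have := extM_eigenProj_mul_mul hT (h.pow (i + 1)) hc hc (by
      rw [sub_self]
      exact (mul_ne_zero (by exact_mod_cast i.succ_ne_zero) ha).symm)
    rw [show extM ℂ (eigenProj T c) = eigenProj T c from rfl] at this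
    rw [mul_smul_comm, smul_mul_assoc, this, smul_zero]

end Weights

/-! ### Poisson brackets on polynomial rings -/

section Poisson

open MvPolynomial

theorem PoissonBracket.br_swap {A : Type*} [CommRing A] [Algebra ℂ A] (P : PoissonBracket A)
    (a b : A) : P.br a b = -P.br b a := by
  have h := P.br_self (a + b)
  simp only [map_add, LinearMap.add_apply, P.br_self, zero_add, add_zero] at h
  rw [eq_neg_iff_add_eq_zero, add_comm, h]

/-- The Hamiltonian derivation `{f, ·}`. -/
def PoissonBracket.ham {A : Type*} [CommRing A] [Algebra ℂ A] (P : PoissonBracket A) (f : A) :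
    Derivation ℂ A A :=
  Derivation.mk' (P.br f) fun a b => by
    rw [P.leibniz, smul_eq_mul, smul_eq_mul]; ring

theorem PoissonBracket.ham_apply {A : Type*} [CommRing A] [Algebra ℂ A] (P : PoissonBracket A)
    (f g : A) : P.ham f g = P.br f g := rfl

theorem derivation_eq_sum_pderiv {σ : Type*} [Fintype σ]
    (D : Derivation ℂ (MvPolynomial σ ℂ) (MvPolynomial σ ℂ)) (f : MvPolynomial σ ℂ) :
    D f = ∑ i, pderiv i f * D (X i) := by
  classical
  have : D = ∑ i, D (X i) • pderiv (R := ℂ) i := by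
    refine derivation_ext fun j => ?_
    have hs : ∀ s : Finset σ, (∑ i ∈ s, D (X i) • pderiv (R := ℂ) i) (X j) =
        ∑ i ∈ s, D (X i) * pderiv i (X j) := by
      intro s
      induction s using Finset.induction_on with
      | empty => simp
      | insert a s ha ih => simp [Finset.sum_insert ha, ih]
    rw [hs]
    simp [pderiv_X, Pi.single_apply]
  conv_lhs => rw [this]
  have hs : ∀ s : Finset σ, (∑ i ∈ s, D (X i) • pderiv (R := ℂ) i) f =
      ∑ i ∈ s, pderiv i f * D (X i) := by
    intro s
    induction s using Finset.induction_on with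
    | empty => simp
    | insert a s ha ih => simp [Finset.sum_insert ha, ih, mul_comm]
  rw [hs]

/-- A bracket that is a derivation in both arguments is a bivector. All questions about `P` thereby
reduce to its values on the variables. -/
theorem PoissonBracket.br_eq_sum {σ : Type*} [Fintype σ] (P : PoissonBracket (MvPolynomial σ ℂ))
    (f g : MvPolynomial σ ℂ) :
    P.br f g = ∑ a, ∑ b, P.br (X a) (X b) * (pderiv a f * pderiv b g) := by
  rw [← P.ham_apply, derivation_eq_sum_pderiv, Finset.sum_comm]
  refine Finset.sum_congr rfl fun b _ => ?_
  rw [P.ham_apply, P.br_swap, ← P.ham_apply, derivation_eq_sum_pderiv (P.ham (X b)) f, mul_neg,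
    Finset.mul_sum, ← Finset.sum_neg_distrib]
  refine Finset.sum_congr rfl fun a _ => ?_
  rw [P.ham_apply, P.br_swap (X a)]
  ring

theorem PoissonBracket.ext_X {σ : Type*} [Fintype σ] {P P' : PoissonBracket (MvPolynomial σ ℂ)}
    (h : ∀ a b, P.br (X a) (X b) = P'.br (X a) (X b)) : P = P' := by
  have : P.br = P'.br := by
    refine LinearMap.ext₂ fun f g => ?_
    simp only [P.br_eq_sum f g, P'.br_eq_sum f g, h]
  cases P; cases P'; congr

/-- The structure constants of the canonical bracket. -/
def canonicalTensor (r : ℕ) (a b : Fin r ⊕ Fin r) : Coord r :=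
  match a, b with
  | .inl n, .inr m => if n = m then 1 else 0
  | .inr n, .inl m => if n = m then -1 else 0
  | _, _ => 0

theorem isCanonical_iff {r : ℕ} (P : PoissonBracket (Coord r)) :
    IsCanonical P ↔ ∀ a b, P.br (X a) (X b) = canonicalTensor r a b := by
  constructor
  · rintro ⟨h1, h2, h3⟩ (a | a) (b | b)
    · exact h2 a b
    · exact h1 a b
    · rw [P.br_swap]
      have := h1 b a
      rw [bVar, cVar] at this
      rw [this, canonicalTensor]
      simp only [eq_comm (a := a)]
      split_ifs <;> simp
    · exact h3 a b
  · exact fun h => ⟨fun a b => h (.inl a) (.inr b), fun a b => h (.inl a) (.inl b),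
      fun a b => h (.inr a) (.inr b)⟩

theorem pderiv_pderiv_comm {σ : Type*} (i j : σ) (f : MvPolynomial σ ℂ) :
    pderiv i (pderiv j f) = pderiv j (pderiv i f) := by
  classical
  have : ⁅pderiv (R := ℂ) i, pderiv (R := ℂ) j⁆ = 0 := by
    refine derivation_ext fun k => ?_
    rw [Derivation.commutator_apply, pderiv_X, pderiv_X]
    simp only [Pi.single_apply]
    split_ifs <;> simp
  have h := DFunLike.congr_fun this f
  rw [Derivation.commutator_apply] at h
  exact sub_eq_zero.1 h

/-- The canonical bracket as a bilinear map. -/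
def canonicalBr (r : ℕ) : Coord r →ₗ[ℂ] Coord r →ₗ[ℂ] Coord r :=
  LinearMap.mk₂ ℂ
    (fun f g => ∑ m : Fin r, (pderiv (Sum.inl m) f * pderiv (Sum.inr m) g -
      pderiv (Sum.inr m) f * pderiv (Sum.inl m) g))
    (by intro f f' g; rw [← Finset.sum_add_distrib]; simp only [map_add]; congr; ext1; ring)
    (by intro c f g; rw [Finset.smul_sum]; simp [smul_sub])
    (by intro f g g'; rw [← Finset.sum_add_distrib]; simp only [map_add]; congr; ext1; ring)
    (by intro c f g; rw [Finset.smul_sum]; simp [smul_sub])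

theorem canonicalBr_apply {r : ℕ} (f g : Coord r) : canonicalBr r f g =
    ∑ m : Fin r, (pderiv (Sum.inl m) f * pderiv (Sum.inr m) g -
      pderiv (Sum.inr m) f * pderiv (Sum.inl m) g) := rfl

theorem canonicalBr_leibniz {r : ℕ} (f g h : Coord r) :
    canonicalBr r f (g * h) = canonicalBr r f g * h + g * canonicalBr r f h := by
  rw [canonicalBr_apply, canonicalBr_apply, canonicalBr_apply, Finset.sum_mul, Finset.mul_sum,
    ← Finset.sum_add_distrib]
  refine Finset.sum_congr rfl fun m _ => ?_
  rw [pderiv_mul, pderiv_mul]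
  ring

theorem pderiv_canonicalBr {r : ℕ} (k : Fin r ⊕ Fin r) (f g : Coord r) :
    pderiv k (canonicalBr r f g) =
      canonicalBr r (pderiv k f) g + canonicalBr r f (pderiv k g) := by
  rw [canonicalBr_apply, canonicalBr_apply, canonicalBr_apply, map_sum, ← Finset.sum_add_distrib]
  refine Finset.sum_congr rfl fun m _ => ?_
  rw [map_sub, pderiv_mul, pderiv_mul, pderiv_pderiv_comm k, pderiv_pderiv_comm k,
    pderiv_pderiv_comm k, pderiv_pderiv_comm k]
  ring

theorem canonicalBr_swap {r : ℕ} (f g : Coord r) : canonicalBr r f g = -canonicalBr r g f := by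
  rw [canonicalBr_apply, canonicalBr_apply, ← Finset.sum_neg_distrib]
  exact Finset.sum_congr rfl fun m _ => by ring

theorem canonicalBr_X {r : ℕ} (a b : Fin r ⊕ Fin r) :
    canonicalBr r (X a) (X b) = canonicalTensor r a b := by
  classical
  rw [canonicalBr_apply]
  rcases a with a | a <;> rcases b with b | b <;>
    simp [pderiv_X, Pi.single_apply, canonicalTensor]
  split_ifs <;> simp

theorem canonicalBr_X_right {r : ℕ} (f : Coord r) :
    (∀ m, canonicalBr r f (X (Sum.inl m)) = -pderiv (Sum.inr m) f) ∧
    (∀ m, canonicalBr r f (X (Sum.inr m)) = pderiv (Sum.inl m) f) := by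
  classical
  constructor <;> intro m <;> rw [canonicalBr_apply] <;> simp [pderiv_X, Pi.single_apply]

/-- The canonical Poisson bracket. -/
def canonicalBracket (r : ℕ) : PoissonBracket (Coord r) where
  br := canonicalBr r
  br_self f := by rw [canonicalBr_apply]; exact Finset.sum_eq_zero fun m _ => by ring
  leibniz := canonicalBr_leibniz
  jacobi := by
    let D : Coord r → Derivation ℂ (Coord r) (Coord r) := fun f =>
      Derivation.mk' (canonicalBr r f) fun a b => by
        rw [canonicalBr_leibniz, smul_eq_mul, smul_eq_mul]; ring
    -- The Jacobi identity says that `f ↦ {f, ·}` respects commutators. Both sides are derivations,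
    -- so the variables suffice, and on a variable the bracket is a partial derivative, which is
    -- itself a derivation of the bracket.
    have key : ∀ f g, ⁅D f, D g⁆ = D (canonicalBr r f g) := by
      intro f g
      refine derivation_ext fun k => ?_
      rw [Derivation.commutator_apply]
      change canonicalBr r f (canonicalBr r g (X k)) - canonicalBr r g (canonicalBr r f (X k)) =
        canonicalBr r (canonicalBr r f g) (X k)
      rcases k with k | k
      · simp only [(canonicalBr_X_right _).1, pderiv_canonicalBr, map_neg]
        rw [canonicalBr_swap (pderiv _ f) g]; ring
      · simp only [(canonicalBr_X_right _).2, pderiv_canonicalBr]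
        rw [canonicalBr_swap (pderiv _ f) g]; ring
    intro f g h
    have := DFunLike.congr_fun (key f g) h
    rw [Derivation.commutator_apply] at this
    change canonicalBr r f (canonicalBr r g h) - canonicalBr r g (canonicalBr r f h) =
        canonicalBr r (canonicalBr r f g) h at this
    rw [canonicalBr_swap h f, canonicalBr_swap h (canonicalBr r f g), ← this, map_neg]
    ring

theorem isCanonical_canonicalBracket (r : ℕ) : IsCanonical (canonicalBracket r) :=
  (isCanonical_iff _).2 canonicalBr_X

theorem existsUnique_isCanonical (r : ℕ) : ∃! P : PoissonBracket (Coord r), IsCanonical P :=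
  ⟨canonicalBracket r, isCanonical_canonicalBracket r, fun P hP =>
    PoissonBracket.ext_X fun a b => by
      rw [(isCanonical_iff P).1 hP, (isCanonical_iff _).1 (isCanonical_canonicalBracket r)]⟩

end Poisson

/-! ### The RLL relation -/

section RLL

variable {n : Type*} [Fintype n] [DecidableEq n]

/-- `M ↦ M ⊗ 1` as a ring homomorphism. -/
def kronLeft (n R : Type*) [Fintype n] [DecidableEq n] [CommRing R] :
    Matrix n n R →+* Matrix (n × n) (n × n) R where
  toFun M := M ⊗ₖ 1
  map_one' := Matrix.one_kronecker_one
  map_mul' M M' := by rw [← Matrix.mul_kronecker_mul, mul_one]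
  map_zero' := Matrix.zero_kronecker _
  map_add' M M' := Matrix.add_kronecker _ _ _

/-- `M ↦ 1 ⊗ M` as a ring homomorphism. -/
def kronRight (n R : Type*) [Fintype n] [DecidableEq n] [CommRing R] :
    Matrix n n R →+* Matrix (n × n) (n × n) R where
  toFun M := 1 ⊗ₖ M
  map_one' := Matrix.one_kronecker_one
  map_mul' M M' := by rw [← Matrix.mul_kronecker_mul, mul_one]
  map_zero' := Matrix.kronecker_zero _
  map_add' M M' := Matrix.kronecker_add _ _ _

theorem kronLeft_apply {R : Type*} [CommRing R] (M : Matrix n n R) : kronLeft n R M = M ⊗ₖ 1 := rfl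

theorem kronRight_apply {R : Type*} [CommRing R] (M : Matrix n n R) :
    kronRight n R M = 1 ⊗ₖ M := rfl

theorem kronLeft_mul_kronRight {R : Type*} [CommRing R] (M M' : Matrix n n R) :
    kronLeft n R M * kronRight n R M' = M ⊗ₖ M' := by
  rw [kronLeft_apply, kronRight_apply, ← Matrix.mul_kronecker_mul, mul_one, one_mul]

theorem commute_kron {R : Type*} [CommRing R] (M M' : Matrix n n R) :
    Commute (kronLeft n R M) (kronRight n R M') := by
  rw [Commute, SemiconjBy, kronLeft_mul_kronRight, kronLeft_apply, kronRight_apply,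
    ← Matrix.mul_kronecker_mul, mul_one, one_mul]

theorem commute_isNilpotent_exp {A : Type*} [Ring A] [Algebra ℚ A] {a b : A} (h : Commute a b) :
    Commute a (IsNilpotent.exp b) :=
  Commute.sum_right _ _ _ fun i _ => (h.pow_right i).smul_right _

/-- The two summands commute, so `e^x ⊗ e^x` is the exponential of `x ⊗ 1 + 1 ⊗ x`. -/
theorem commute_exp_kron {R : Type*} [CommRing R] [Algebra ℚ R]
    {c : Matrix (n × n) (n × n) R} {x : Matrix n n R} (hx : IsNilpotent x)
    (h : Commute c (x ⊗ₖ 1 + 1 ⊗ₖ x)) :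
    Commute c (IsNilpotent.exp x ⊗ₖ IsNilpotent.exp x) := by
  rw [← kronLeft_mul_kronRight, IsNilpotent.map_exp hx (kronLeft n R),
    IsNilpotent.map_exp hx (kronRight n R),
    ← IsNilpotent.exp_add_of_commute (commute_kron x x) (hx.map _) (hx.map _)]
  exact commute_isNilpotent_exp h

theorem map_derivation_mul {R : Type*} [CommRing R] [Algebra ℂ R] (D : Derivation ℂ R R)
    (M M' : Matrix n n R) : (M * M').map D = M.map D * M' + M * M'.map D := by
  ext i j
  simp only [Matrix.map_apply, Matrix.mul_apply, Matrix.add_apply, map_sum, Derivation.leibniz,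
    smul_eq_mul, ← Finset.sum_add_distrib]
  exact Finset.sum_congr rfl fun k _ => by ring

theorem map_derivation_pow {R : Type*} [CommRing R] [Algebra ℂ R] (D : Derivation ℂ R R)
    {x : Matrix n n R} (h : Commute (x.map D) x) (k : ℕ) :
    (x ^ (k + 1)).map D = (k + 1) • (x.map D * x ^ k) := by
  induction k with
  | zero => simp
  | succ k ih =>
    rw [pow_succ, map_derivation_mul, ih, smul_mul_assoc, mul_assoc, ← pow_succ,
      ← (h.pow_right (k + 1)).eq, ← succ_nsmul]

/-- This naive formula needs `D x` to commute with `x`. It applies below because `𝔫⁺` and `𝔫⁻` are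
abelian. -/
theorem map_derivation_exp {R : Type*} [CommRing R] [Algebra ℂ R] [Algebra ℚ R]
    (D : Derivation ℂ R R) {x : Matrix n n R} (hx : IsNilpotent x) (h : Commute (x.map D) x) :
    (IsNilpotent.exp x).map D = x.map D * IsNilpotent.exp x := by
  obtain ⟨k, hk⟩ := hx
  have hk' : x ^ (k + 1) = 0 := by rw [pow_succ, hk, zero_mul]
  let Dm : Matrix n n R →+ Matrix n n R := AddMonoidHom.mapMatrix (D : R →+ R)
  change Dm (IsNilpotent.exp x) = _
  conv_lhs => rw [IsNilpotent.exp_eq_sum hk']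
  rw [Finset.sum_range_succ', map_add, map_sum, IsNilpotent.exp_eq_sum hk, Finset.mul_sum]
  have h1 : Dm (((Nat.factorial 0 : ℕ) : ℚ)⁻¹ • x ^ 0) = 0 := by
    rw [map_rat_smul, pow_zero]
    have : Dm 1 = 0 := by
      ext i j
      change D ((1 : Matrix n n R) i j) = 0
      rw [Matrix.one_apply]
      split_ifs <;> simp
    rw [this, smul_zero]
  rw [h1, add_zero]
  refine Finset.sum_congr rfl fun i _ => ?_
  have h2 : Dm (x ^ (i + 1)) = (i + 1) • (x.map D * x ^ i) := map_derivation_pow D h i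
  rw [map_rat_smul, h2, mul_smul_comm, ← Nat.cast_smul_eq_nsmul ℚ, smul_smul]
  congr 1
  rw [Nat.factorial_succ]
  push_cast
  field_simp

theorem linearIndependent_extM {σ ι : Type*} [Fintype ι] {V : ι → Matrix n n ℂ}
    (hV : LinearIndependent ℂ V) {f : ι → MvPolynomial σ ℂ}
    (h : ∀ i j, ∑ a, f a * algebraMap ℂ (MvPolynomial σ ℂ) (V a i j) = 0) : f = 0 := by
  funext a
  refine MvPolynomial.ext _ _ fun m => ?_
  refine Fintype.linearIndependent_iff.1 hV (fun a => (f a).coeff m) ?_ a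
  ext i j
  have := congrArg (MvPolynomial.coeff m) (h i j)
  rw [MvPolynomial.coeff_sum] at this
  simpa [Matrix.sum_apply, MvPolynomial.algebraMap_eq, mul_comm (f _), MvPolynomial.coeff_C_mul,
    mul_comm (V _ _ _)] using this

/-- Independence over `ℂ` persists over polynomials, monomial by monomial. It is used once for each
tensor factor. -/
theorem linearIndependent_extM_kron {σ ι : Type*} [Fintype ι] {V W : ι → Matrix n n ℂ}
    (hV : LinearIndependent ℂ V) (hW : LinearIndependent ℂ W) {f : ι → ι → MvPolynomial σ ℂ}
    (h : ∑ a, ∑ b, f a b • (extM (MvPolynomial σ ℂ) (V a) ⊗ₖ extM (MvPolynomial σ ℂ) (W b)) = 0) :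
    f = 0 := by
  have key : ∀ k l, (fun a => ∑ b, f a b * algebraMap ℂ (MvPolynomial σ ℂ) (W b k l)) = 0 := by
    intro k l
    refine linearIndependent_extM hV fun i j => ?_
    have := congrFun (congrFun h (i, k)) (j, l)
    simp only [Matrix.sum_apply, Matrix.smul_apply, Matrix.kronecker_apply, Matrix.map_apply,
      smul_eq_mul, Matrix.zero_apply] at this
    rw [← this]
    refine Finset.sum_congr rfl fun a _ => ?_
    rw [Finset.sum_mul]
    exact Finset.sum_congr rfl fun b _ => by ring
  funext a
  exact linearIndependent_extM hW fun k l => congrFun (key k l) a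

/-- The data of a representation that enter the RLL relation: matrices `T`, `X m`, `Y m` for `μ`
and for bases of `𝔫⁺` and `𝔫⁻`, and a matrix `c` for the Casimir. -/
structure RLLData (d r : ℕ) (T : Matrix n n ℂ) (X Y : Fin r → Matrix n n ℂ)
    (c : Matrix (n × n) (n × n) ℂ) : Prop where
  frac : IsFractional d T
  weightX : ∀ m, T * X m - X m * T = X m
  weightY : ∀ m, T * Y m - Y m * T = -Y m
  commX : ∀ m m', Commute (X m) (X m')
  commY : ∀ m m', Commute (Y m) (Y m')
  casX : ∀ m, Commute c (X m ⊗ₖ 1 + 1 ⊗ₖ X m)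
  casY : ∀ m, Commute c (Y m ⊗ₖ 1 + 1 ⊗ₖ Y m)
  casLeft : Commute (c - ∑ m, (X m ⊗ₖ Y m + Y m ⊗ₖ X m)) (T ⊗ₖ 1)
  casRight : Commute (c - ∑ m, (X m ⊗ₖ Y m + Y m ⊗ₖ X m)) (1 ⊗ₖ T)
  indep : LinearIndependent ℂ (Sum.elim X Y)

variable {d r : ℕ} {T : Matrix n n ℂ} {X Y : Fin r → Matrix n n ℂ} {c : Matrix (n × n) (n × n) ℂ}

theorem zPow_eq_extM {R : Type*} [CommRing R] [Algebra ℂ R] (t : ℂˣ) :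
    zPow d T (Units.map (algebraMap ℂ R).toMonoidHom t) = extM R (zPow d T t) := by
  have := map_zPow (d := d) (T := T) (Algebra.ofId ℂ R) t
  exact this.symm

theorem commute_aeval {A : Type*} [Ring A] [Algebra ℂ A] {a b : A} (h : Commute a b) (p : ℂ[X]) :
    Commute a (Polynomial.aeval b p) := by
  induction p using Polynomial.induction_on' with
  | add p q hp hq => rw [map_add]; exact hp.add_right hq
  | monomial k x =>
    rw [Polynomial.aeval_monomial]
    exact (Algebra.commute_algebraMap_right x a).mul_right (h.pow_right k)

theorem kronLeft_aeval (p : ℂ[X]) :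
    kronLeft n ℂ (Polynomial.aeval T p) = Polynomial.aeval (kronLeft n ℂ T) p := by
  induction p using Polynomial.induction_on' with
  | add p q hp hq => rw [map_add, map_add, map_add, hp, hq]
  | monomial k x =>
    rw [Polynomial.aeval_monomial, Polynomial.aeval_monomial, map_mul, map_pow,
      Algebra.algebraMap_eq_smul_one, Algebra.algebraMap_eq_smul_one, kronLeft_apply (x • 1),
      Matrix.smul_kronecker, Matrix.one_kronecker_one]

theorem kronRight_aeval (p : ℂ[X]) :
    kronRight n ℂ (Polynomial.aeval T p) = Polynomial.aeval (kronRight n ℂ T) p := by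
  induction p using Polynomial.induction_on' with
  | add p q hp hq => rw [map_add, map_add, map_add, hp, hq]
  | monomial k x =>
    rw [Polynomial.aeval_monomial, Polynomial.aeval_monomial, map_mul, map_pow,
      Algebra.algebraMap_eq_smul_one, Algebra.algebraMap_eq_smul_one, kronRight_apply (x • 1),
      Matrix.kronecker_smul, Matrix.one_kronecker_one]

theorem zPow_complex (t : ℂˣ) : zPow d T t =
    ∑ c ∈ eigenvalues T, ((t ^ (round ((d : ℂ) * c).re : ℤ) : ℂˣ) : ℂ) • eigenProj T c := rfl

theorem commute_kronLeft_zPow {c : Matrix (n × n) (n × n) ℂ} (h : Commute c (T ⊗ₖ 1)) (t : ℂˣ) :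
    Commute c (kronLeft n ℂ (zPow d T t)) := by
  rw [zPow_complex, map_sum]
  refine Commute.sum_right _ _ _ fun a _ => ?_
  rw [kronLeft_apply, Matrix.smul_kronecker, ← kronLeft_apply, eigenProj, kronLeft_aeval]
  exact (commute_aeval h _).smul_right _

theorem commute_kronRight_zPow {c : Matrix (n × n) (n × n) ℂ} (h : Commute c (1 ⊗ₖ T)) (t : ℂˣ) :
    Commute c (kronRight n ℂ (zPow d T t)) := by
  rw [zPow_complex, map_sum]
  refine Commute.sum_right _ _ _ fun a _ => ?_
  rw [kronRight_apply, Matrix.kronecker_smul, ← kronRight_apply, eigenProj, kronRight_aeval]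
  exact (commute_aeval h _).smul_right _

theorem RLLData.zPow_mul_X (h : RLLData d r T X Y c) (t : ℂˣ) (m : Fin r) :
    zPow d T t * X m = ((t : ℂ) ^ d) • (X m * zPow d T t) := by
  have hw : HasWeight (R := ℂ) T ((1 : ℤ) : ℂ) (X m) :=
    HasWeight.extend (R := ℂ) (by rw [h.weightX]; simp)
  rw [hw.zPow_mul h.frac t, mul_one, zpow_natCast, Units.val_pow_eq_pow_val]

theorem RLLData.zPow_mul_Y (h : RLLData d r T X Y c) (t : ℂˣ) (m : Fin r) :
    zPow d T t * Y m = ((t : ℂ) ^ d)⁻¹ • (Y m * zPow d T t) := by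
  have hw : HasWeight (R := ℂ) T ((-1 : ℤ) : ℂ) (Y m) :=
    HasWeight.extend (R := ℂ) (by rw [h.weightY]; simp)
  rw [hw.zPow_mul h.frac t, mul_neg, mul_one, zpow_neg, zpow_natCast, Units.val_inv_eq_inv_val,
    Units.val_pow_eq_pow_val]

/-- The logarithmic derivatives of `e^x z^T e^y` with respect to the coordinates, up to conjugation
by `e^x`. -/
def logDeriv (d : ℕ) (X Y : Fin r → Matrix n n ℂ) (t : ℂˣ) : Fin r ⊕ Fin r → Matrix n n ℂ :=
  Sum.elim X fun m => ((t : ℂ) ^ d)⁻¹ • Y m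

theorem RLLData.linearIndependent_logDeriv (h : RLLData d r T X Y c) (t : ℂˣ) :
    LinearIndependent ℂ (logDeriv d X Y t) := by
  have := h.indep.units_smul (Sum.elim (fun _ => 1) fun _ => (t ^ d)⁻¹)
  convert this using 1
  funext a
  rcases a with a | a
  · simp [logDeriv]
  · simp [logDeriv, Units.smul_def]

/-- Put `z = t ^ d` and `z' = s ^ d`. The charge zero part of `c` commutes with `z^T ⊗ z'^T`, while
`X ⊗ Y` is scaled by `z / z'` and `Y ⊗ X` by `z' / z`. The factors `z / z' - 1` and `z' / z - 1`
cancel the pole at `z = z'` and leave `1 / z'` and `-1 / z`. -/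
theorem RLLData.zPow_casimir (h : RLLData d r T X Y c) (t s : ℂˣ)
    (hts : (t : ℂ) ^ d ≠ (s : ℂ) ^ d) :
    ((t : ℂ) ^ d - (s : ℂ) ^ d)⁻¹ • ((zPow d T t ⊗ₖ zPow d T s) * c -
      c * (zPow d T t ⊗ₖ zPow d T s)) =
    (∑ m, ((((s : ℂ) ^ d)⁻¹ • (X m ⊗ₖ Y m)) - (((t : ℂ) ^ d)⁻¹ • (Y m ⊗ₖ X m)))) *
      (zPow d T t ⊗ₖ zPow d T s) := by
  set Z := zPow d T t ⊗ₖ zPow d T s with hZ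
  set c₀ := c - ∑ m, (X m ⊗ₖ Y m + Y m ⊗ₖ X m) with hc₀
  have hcomm : Commute c₀ Z := by
    rw [hZ, ← kronLeft_mul_kronRight]
    exact (commute_kronLeft_zPow h.casLeft t).mul_right (commute_kronRight_zPow h.casRight s)
  have hc : c = c₀ + ∑ m, (X m ⊗ₖ Y m + Y m ⊗ₖ X m) := by rw [hc₀]; abel
  have ht : ((t : ℂ) ^ d) ≠ 0 := pow_ne_zero _ t.ne_zero
  have hs : ((s : ℂ) ^ d) ≠ 0 := pow_ne_zero _ s.ne_zero
  have h1 : ∀ m, Z * (X m ⊗ₖ Y m) = (((t : ℂ) ^ d) * ((s : ℂ) ^ d)⁻¹) • ((X m ⊗ₖ Y m) * Z) := by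
    intro m
    rw [hZ, ← Matrix.mul_kronecker_mul, h.zPow_mul_X, h.zPow_mul_Y, Matrix.smul_kronecker,
      Matrix.kronecker_smul, smul_smul, Matrix.mul_kronecker_mul]
  have h2 : ∀ m, Z * (Y m ⊗ₖ X m) = (((t : ℂ) ^ d)⁻¹ * ((s : ℂ) ^ d)) • ((Y m ⊗ₖ X m) * Z) := by
    intro m
    rw [hZ, ← Matrix.mul_kronecker_mul, h.zPow_mul_X, h.zPow_mul_Y, Matrix.smul_kronecker,
      Matrix.kronecker_smul, smul_smul, Matrix.mul_kronecker_mul]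
  rw [hc, mul_add, add_mul, hcomm.eq, add_sub_add_left_eq_sub, Finset.mul_sum, Finset.sum_mul,
    Finset.sum_mul, ← Finset.sum_sub_distrib, Finset.smul_sum]
  refine Finset.sum_congr rfl fun m _ => ?_
  rw [mul_add, h1, h2, sub_mul, smul_mul_assoc, smul_mul_assoc, add_mul]
  have e1 : ((t : ℂ) ^ d - (s : ℂ) ^ d)⁻¹ * ((t : ℂ) ^ d * ((s : ℂ) ^ d)⁻¹ - 1) =
      ((s : ℂ) ^ d)⁻¹ := by
    have := sub_ne_zero.2 hts
    field_simp
  have e2 : ((t : ℂ) ^ d - (s : ℂ) ^ d)⁻¹ * (((t : ℂ) ^ d)⁻¹ * (s : ℂ) ^ d - 1) =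
      -((t : ℂ) ^ d)⁻¹ := by
    have := sub_ne_zero.2 hts
    field_simp
    ring
  rw [show ∀ (a b : ℂ) (M N : Matrix (n × n) (n × n) ℂ), a • M + b • N - (M + N) =
    (a - 1) • M + (b - 1) • N from fun a b M N => by module, smul_add, smul_smul, smul_smul,
    e1, e2, neg_smul, ← sub_eq_add_neg]

/-- The matrix `∑ b_m X^m` over the coordinate ring. -/
def genericX (X : Fin r → Matrix n n ℂ) : Matrix n n (Coord r) := ∑ m, bVar m • extM (Coord r) (X m)

/-- The matrix `∑ c^m Y_m` over the coordinate ring. -/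
def genericY (Y : Fin r → Matrix n n ℂ) : Matrix n n (Coord r) := ∑ m, cVar m • extM (Coord r) (Y m)

theorem LOp_eq (t : ℂˣ) : LOp d T X Y t = IsNilpotent.exp (genericX X) *
    extM (Coord r) (zPow d T t) * IsNilpotent.exp (genericY Y) := by
  rw [LOp, zPow_eq_extM]; rfl

theorem RLLData.isNilpotent_genericX (h : RLLData d r T X Y c) : IsNilpotent (genericX X) := by
  refine HasWeight.isNilpotent (a := 1) h.frac one_ne_zero (HasWeight.sum _ fun m _ => ?_)
  exact HasWeight.smul (HasWeight.extend (by rw [h.weightX, one_smul])) _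

theorem RLLData.isNilpotent_genericY (h : RLLData d r T X Y c) : IsNilpotent (genericY Y) := by
  refine HasWeight.isNilpotent (a := -1) h.frac (by norm_num) (HasWeight.sum _ fun m _ => ?_)
  exact HasWeight.smul (HasWeight.extend (by rw [h.weightY, neg_smul, one_smul])) _

theorem map_pderiv_extM (a : Fin r ⊕ Fin r) (M : Matrix n n ℂ) :
    (extM (Coord r) M).map (MvPolynomial.pderiv a) = 0 := by
  ext1 i j
  exact MvPolynomial.pderiv_C

theorem map_pderiv_sum_extM (a : Fin r ⊕ Fin r) (v : Fin r → Coord r) (X : Fin r → Matrix n n ℂ) :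
    (∑ m, v m • extM (Coord r) (X m)).map (MvPolynomial.pderiv a) =
      ∑ m, MvPolynomial.pderiv a (v m) • extM (Coord r) (X m) := by
  ext1 i j
  rw [Matrix.map_apply, Matrix.sum_apply, Matrix.sum_apply, map_sum]
  refine Finset.sum_congr rfl fun m _ => ?_
  rw [Matrix.smul_apply, Matrix.smul_apply, smul_eq_mul, smul_eq_mul, MvPolynomial.pderiv_mul]
  have : MvPolynomial.pderiv a (extM (Coord r) (X m) i j) = 0 := MvPolynomial.pderiv_C
  rw [this, mul_zero, add_zero]

theorem map_pderiv_genericX (a : Fin r ⊕ Fin r) :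
    (genericX X).map (MvPolynomial.pderiv a) =
      Sum.elim (fun m => extM (Coord r) (X m)) (fun _ => 0) a := by
  rw [genericX, map_pderiv_sum_extM]
  rcases a with a | a <;> simp [bVar, MvPolynomial.pderiv_X, Pi.single_apply]

theorem map_pderiv_genericY (a : Fin r ⊕ Fin r) :
    (genericY Y).map (MvPolynomial.pderiv a) =
      Sum.elim (fun _ => 0) (fun m => extM (Coord r) (Y m)) a := by
  rw [genericY, map_pderiv_sum_extM]
  rcases a with a | a <;> simp [cVar, MvPolynomial.pderiv_X, Pi.single_apply]

theorem commute_sum_extM (v : Fin r → Coord r) {X : Fin r → Matrix n n ℂ} {M : Matrix n n ℂ}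
    (h : ∀ m, Commute M (X m)) : Commute (extM (Coord r) M) (∑ m, v m • extM (Coord r) (X m)) := by
  refine Commute.sum_right _ _ _ fun m _ => Commute.smul_right ?_ _
  exact (h m).map (RingHom.mapMatrix (algebraMap ℂ (Coord r)))

theorem RLLData.map_pderiv_LOp (h : RLLData d r T X Y c) (t : ℂˣ) (a : Fin r ⊕ Fin r) :
    (LOp d T X Y t).map (MvPolynomial.pderiv a) =
      IsNilpotent.exp (genericX X) * extM (Coord r) (logDeriv d X Y t a) *
        (extM (Coord r) (zPow d T t) * IsNilpotent.exp (genericY Y)) := by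
  have hx : Commute ((genericX X).map (MvPolynomial.pderiv a)) (genericX X) := by
    rw [map_pderiv_genericX]
    rcases a with a | a
    · exact commute_sum_extM _ (h.commX a)
    · exact Commute.zero_left _
  have hy : Commute ((genericY Y).map (MvPolynomial.pderiv a)) (genericY Y) := by
    rw [map_pderiv_genericY]
    rcases a with a | a
    · exact Commute.zero_left _
    · exact commute_sum_extM _ (h.commY a)
  rw [LOp_eq, map_derivation_mul, map_derivation_mul, map_pderiv_extM, mul_zero, add_zero,
    map_derivation_exp _ h.isNilpotent_genericX hx, map_derivation_exp _ h.isNilpotent_genericY hy]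
  rw [map_pderiv_genericX] at hx ⊢
  rw [map_pderiv_genericY]
  rcases a with a | a
  · simp only [Sum.elim_inl, logDeriv, zero_mul, mul_zero, add_zero] at hx ⊢
    rw [(commute_isNilpotent_exp hx).eq]
    simp only [mul_assoc]
  · simp only [Sum.elim_inr, logDeriv, zero_mul, zero_add]
    -- Differentiation in `c^a` puts `Y_a` to the right of `z^T`. Moving it to the left produces the
    -- factor `z⁻¹` of `logDeriv`.
    have e := congrArg (extM (Coord r)) (h.zPow_mul_Y t a)
    rw [extM_mul, extM_smul, extM_mul, ← smul_mul_assoc, ← extM_smul] at e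
    simp only [mul_assoc]
    rw [← mul_assoc (extM _ _) (extM _ _), e]
    simp only [mul_assoc]

theorem extM_kron {R : Type*} [CommRing R] [Algebra ℂ R] (M N : Matrix n n ℂ) :
    extM R (M ⊗ₖ N) = extM R M ⊗ₖ extM R N := by
  ext1 i j; simp

theorem RLLData.commute_casimir_exp_genericX (h : RLLData d r T X Y c) :
    Commute (extM (Coord r) c)
      (IsNilpotent.exp (genericX X) ⊗ₖ IsNilpotent.exp (genericX X)) := by
  refine commute_exp_kron h.isNilpotent_genericX ?_
  have : genericX X ⊗ₖ 1 + 1 ⊗ₖ genericX X =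
      ∑ m, (bVar m : Coord r) • extM (Coord r) (X m ⊗ₖ 1 + 1 ⊗ₖ X m) := by
    rw [← kronLeft_apply, ← kronRight_apply, genericX, map_sum, map_sum, ← Finset.sum_add_distrib]
    refine Finset.sum_congr rfl fun m _ => ?_
    rw [kronLeft_apply, kronRight_apply, Matrix.smul_kronecker, Matrix.kronecker_smul, ← smul_add,
      extM_add, extM_kron, extM_kron, extM_one]
  rw [this]
  exact commute_sum_extM _ h.casX

theorem RLLData.commute_casimir_exp_genericY (h : RLLData d r T X Y c) :
    Commute (extM (Coord r) c)
      (IsNilpotent.exp (genericY Y) ⊗ₖ IsNilpotent.exp (genericY Y)) := by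
  refine commute_exp_kron h.isNilpotent_genericY ?_
  have : genericY Y ⊗ₖ 1 + 1 ⊗ₖ genericY Y =
      ∑ m, (cVar m : Coord r) • extM (Coord r) (Y m ⊗ₖ 1 + 1 ⊗ₖ Y m) := by
    rw [← kronLeft_apply, ← kronRight_apply, genericY, map_sum, map_sum, ← Finset.sum_add_distrib]
    refine Finset.sum_congr rfl fun m _ => ?_
    rw [kronLeft_apply, kronRight_apply, Matrix.smul_kronecker, Matrix.kronecker_smul, ← smul_add,
      extM_add, extM_kron, extM_kron, extM_one]
  rw [this]
  exact commute_sum_extM _ h.casY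

/-- The right side is the one found in `RLLData.zPow_casimir`. This identification is the reason why
the RLL relation singles out the canonical bracket. -/
theorem sum_canonicalTensor_logDeriv (t s : ℂˣ) :
    ∑ a, ∑ b, canonicalTensor r a b •
      (extM (Coord r) (logDeriv d X Y t a) ⊗ₖ extM (Coord r) (logDeriv d X Y s b)) =
    extM (Coord r) (∑ m, ((((s : ℂ) ^ d)⁻¹ • (X m ⊗ₖ Y m)) -
      (((t : ℂ) ^ d)⁻¹ • (Y m ⊗ₖ X m)))) := by
  rw [extM_sum, Fintype.sum_sum_type]
  simp only [Fintype.sum_sum_type, canonicalTensor, logDeriv, Sum.elim_inl, Sum.elim_inr, zero_smul,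
    Finset.sum_const_zero, add_zero, zero_add, ite_smul, one_smul, Finset.sum_ite_eq,
    Finset.mem_univ, if_true, neg_smul, extM_sub, extM_smul, extM_kron, Matrix.smul_kronecker,
    Matrix.kronecker_smul]
  rw [← Finset.sum_add_distrib]
  simp only [← sub_eq_add_neg]

/-- Both sides of the RLL relation differ by a combination of the products of logarithmic
derivatives, whose coefficients are the differences of `P` and the canonical bracket. -/
theorem RLLData.rll_defect (h : RLLData d r T X Y c) (P : PoissonBracket (Coord r)) (t s : ℂˣ)
    (hts : (t : ℂ) ^ d ≠ (s : ℂ) ^ d) :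
    (Matrix.of fun p q : n × n => P.br (LOp d T X Y t p.1 q.1) (LOp d T X Y s p.2 q.2)) -
      ((t : ℂ) ^ d - (s : ℂ) ^ d)⁻¹ • ((LOp d T X Y t ⊗ₖ LOp d T X Y s) * extM (Coord r) c -
        extM (Coord r) c * (LOp d T X Y t ⊗ₖ LOp d T X Y s)) =
    (IsNilpotent.exp (genericX X) ⊗ₖ IsNilpotent.exp (genericX X)) *
      (∑ a, ∑ b, (P.br (MvPolynomial.X a) (MvPolynomial.X b) - canonicalTensor r a b) •
        (extM (Coord r) (logDeriv d X Y t a) ⊗ₖ extM (Coord r) (logDeriv d X Y s b))) *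
      ((extM (Coord r) (zPow d T t) * IsNilpotent.exp (genericY Y)) ⊗ₖ
        (extM (Coord r) (zPow d T s) * IsNilpotent.exp (genericY Y))) := by
  have h1 : (Matrix.of fun p q : n × n => P.br (LOp d T X Y t p.1 q.1) (LOp d T X Y s p.2 q.2)) =
      (IsNilpotent.exp (genericX X) ⊗ₖ IsNilpotent.exp (genericX X)) *
      (∑ a, ∑ b, P.br (MvPolynomial.X a) (MvPolynomial.X b) •
        (extM (Coord r) (logDeriv d X Y t a) ⊗ₖ extM (Coord r) (logDeriv d X Y s b))) *
      ((extM (Coord r) (zPow d T t) * IsNilpotent.exp (genericY Y)) ⊗ₖ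
        (extM (Coord r) (zPow d T s) * IsNilpotent.exp (genericY Y))) := by
    have : (Matrix.of fun p q : n × n =>
        P.br (LOp d T X Y t p.1 q.1) (LOp d T X Y s p.2 q.2)) =
        ∑ a, ∑ b, P.br (MvPolynomial.X a) (MvPolynomial.X b) •
        ((LOp d T X Y t).map (MvPolynomial.pderiv a) ⊗ₖ
          (LOp d T X Y s).map (MvPolynomial.pderiv b)) := by
      ext1 p q
      rw [Matrix.of_apply, P.br_eq_sum]
      simp [Matrix.sum_apply]
    rw [this]
    simp only [Finset.mul_sum, Finset.sum_mul]
    refine Finset.sum_congr rfl fun a _ => Finset.sum_congr rfl fun b _ => ?_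
    rw [h.map_pderiv_LOp, h.map_pderiv_LOp, Matrix.mul_kronecker_mul, Matrix.mul_kronecker_mul,
      mul_smul_comm, smul_mul_assoc]
  have h2 := congrArg (extM (Coord r)) (h.zPow_casimir t s hts)
  rw [extM_smul, extM_sub, extM_mul, extM_mul, extM_mul, ← sum_canonicalTensor_logDeriv,
    extM_kron] at h2
  have h3 : (LOp d T X Y t ⊗ₖ LOp d T X Y s) =
      (IsNilpotent.exp (genericX X) ⊗ₖ IsNilpotent.exp (genericX X)) *
      (extM (Coord r) (zPow d T t) ⊗ₖ extM (Coord r) (zPow d T s)) *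
      (IsNilpotent.exp (genericY Y) ⊗ₖ IsNilpotent.exp (genericY Y)) := by
    rw [LOp_eq, LOp_eq, Matrix.mul_kronecker_mul, Matrix.mul_kronecker_mul]
  simp only [sub_smul, Finset.sum_sub_distrib, mul_sub, sub_mul]
  rw [h1, h3, Matrix.mul_kronecker_mul (extM (Coord r) (zPow d T t)), sub_right_inj]
  have hE := h.commute_casimir_exp_genericX.eq
  have hF := h.commute_casimir_exp_genericY.eq
  generalize IsNilpotent.exp (genericX X) ⊗ₖ IsNilpotent.exp (genericX X) = E at *
  generalize IsNilpotent.exp (genericY Y) ⊗ₖ IsNilpotent.exp (genericY Y) = F at *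
  generalize extM (Coord r) (zPow d T t) ⊗ₖ extM (Coord r) (zPow d T s) = Z at *
  generalize extM (Coord r) c = C at *
  -- Invariance of the Casimir strips off both exponentials, so only the commutator with the powers
  -- of `z` remains.
  have : E * Z * F * C - C * (E * Z * F) = E * (Z * C - C * Z) * F := by
    rw [mul_assoc, ← hF, ← mul_assoc C, ← mul_assoc C, hE]
    noncomm_ring
  rw [this, ← smul_mul_assoc, ← mul_smul_comm, h2]
  simp only [mul_assoc]

/-- In the formula of `RLLData.rll_defect` the outer factors are invertible and the inner tensors
are independent, so the defect vanishes exactly when all coefficients do. For the converse a single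
pair of distinct points is enough. -/
theorem RLLData.rll_iff [NeZero d] (h : RLLData d r T X Y c) (P : PoissonBracket (Coord r)) :
    RLL d c (LOp d T X Y) P ↔ IsCanonical P := by
  rw [isCanonical_iff]
  constructor
  · intro hR
    -- The points `t = 1` and `s = 2` are admissible because `2 ^ d > 1` for `d ≥ 1`.
    let s : ℂˣ := Units.mk0 2 two_ne_zero
    have hts : ((1 : ℂˣ) : ℂ) ^ d ≠ (s : ℂ) ^ d := by
      rw [Units.val_one, one_pow, Units.val_mk0]
      intro h2
      have := one_lt_pow₀ (one_lt_two (α := ℝ)) (NeZero.ne d)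
      exact this.ne (by exact_mod_cast h2)
    have hdef := h.rll_defect P 1 s hts
    have h0 : (Matrix.of fun p q : n × n =>
        P.br (LOp d T X Y 1 p.1 q.1) (LOp d T X Y s p.2 q.2)) =
        (((1 : ℂˣ) : ℂ) ^ d - (s : ℂ) ^ d)⁻¹ •
        ((LOp d T X Y 1 ⊗ₖ LOp d T X Y s) * extM (Coord r) c -
        extM (Coord r) c * (LOp d T X Y 1 ⊗ₖ LOp d T X Y s)) := by
      ext1 ⟨j, l⟩ ⟨i, k⟩
      exact hR 1 s hts i j k l
    rw [h0, sub_self] at hdef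
    have hE : IsUnit (IsNilpotent.exp (genericX X) ⊗ₖ IsNilpotent.exp (genericX X)) := by
      rw [← kronLeft_mul_kronRight]
      exact ((IsNilpotent.isUnit_exp h.isNilpotent_genericX).map _).mul
        ((IsNilpotent.isUnit_exp h.isNilpotent_genericX).map _)
    have hZ : ∀ t : ℂˣ, IsUnit (extM (Coord r) (zPow d T t)) := fun t =>
      IsUnit.map (RingHom.mapMatrix (algebraMap ℂ (Coord r))) (IsUnit.of_mul_eq_one _
        (zPow_mul_zPow_inv h.frac t))
    have hF : IsUnit ((extM (Coord r) (zPow d T 1) * IsNilpotent.exp (genericY Y)) ⊗ₖ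
        (extM (Coord r) (zPow d T s) * IsNilpotent.exp (genericY Y))) := by
      rw [← kronLeft_mul_kronRight]
      exact (((hZ 1).mul (IsNilpotent.isUnit_exp h.isNilpotent_genericY)).map _).mul
        (((hZ s).mul (IsNilpotent.isUnit_exp h.isNilpotent_genericY)).map _)
    have h1 := linearIndependent_extM_kron (h.linearIndependent_logDeriv 1)
      (h.linearIndependent_logDeriv s)
      (f := fun a b => P.br (MvPolynomial.X a) (MvPolynomial.X b) - canonicalTensor r a b)
      (by
        have := hdef.symm
        rwa [hF.mul_left_eq_zero, hE.mul_right_eq_zero] at this)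
    intro a b
    exact sub_eq_zero.1 (congrFun (congrFun h1 a) b)
  · intro hP t s hts i j k l
    have hdef := h.rll_defect P t s hts
    simp only [hP, sub_self, zero_smul, Finset.sum_const_zero, mul_zero, zero_mul] at hdef
    exact congrFun (congrFun (sub_eq_zero.1 hdef) (j, l)) (i, k)

end RLL

/-! ### Minuscule gradings, invariant forms and the Casimir -/

section Grading

variable {𝔤 : Type*} [LieRing 𝔤] [LieAlgebra ℂ 𝔤] {μ : 𝔤}

theorem mem_adEigenspace {a : ℂ} {x : 𝔤} : x ∈ adEigenspace μ a ↔ ⁅μ, x⁆ = a • x := by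
  rw [adEigenspace, Module.End.mem_eigenspace_iff, LieAlgebra.ad_apply]

theorem lie_mem_adEigenspace {a b : ℂ} {x y : 𝔤} (hx : x ∈ adEigenspace μ a)
    (hy : y ∈ adEigenspace μ b) : ⁅x, y⁆ ∈ adEigenspace μ (a + b) := by
  rw [mem_adEigenspace] at *
  rw [leibniz_lie, hx, hy, smul_lie, lie_smul, ← add_smul]

theorem nPlus_lie (x : nPlus μ) : ⁅μ, (x : 𝔤)⁆ = x := by
  simpa using mem_adEigenspace.1 x.2

theorem nMinus_lie (x : nMinus μ) : ⁅μ, (x : 𝔤)⁆ = -x := by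
  simpa using mem_adEigenspace.1 x.2

theorem IsMinuscule.exists_decomposition (hμ : IsMinuscule μ) (x : 𝔤) :
    ∃ x₁ ∈ nMinus μ, ∃ x₂ ∈ adEigenspace μ 0, ∃ x₃ ∈ nPlus μ, x = x₁ + x₂ + x₃ := by
  have hx : x ∈ nMinus μ ⊔ adEigenspace μ 0 ⊔ nPlus μ := by rw [hμ.2]; trivial
  obtain ⟨y, hy, x₃, h₃, rfl⟩ := Submodule.mem_sup.1 hx
  obtain ⟨x₁, h₁, x₂, h₂, rfl⟩ := Submodule.mem_sup.1 hy
  exact ⟨x₁, h₁, x₂, h₂, x₃, h₃, rfl⟩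

/-- The eigenvalues -1, 0, 1 are the roots of `a ^ 3 = a`. In this form the minuscule condition
needs no decomposition and can be applied to one coefficient of a loop at a time. -/
theorem IsMinuscule.lie_cube (hμ : IsMinuscule μ) (x : 𝔤) : ⁅μ, ⁅μ, ⁅μ, x⁆⁆⁆ = ⁅μ, x⁆ := by
  obtain ⟨x₁, h₁, x₂, h₂, x₃, h₃, rfl⟩ := hμ.exists_decomposition x
  rw [mem_adEigenspace] at h₁ h₂ h₃
  simp [h₁, h₂, h₃]

theorem IsMinuscule.eq_zero_of_mem (hμ : IsMinuscule μ) {a : ℂ} (ha : a ^ 3 ≠ a) {x : 𝔤}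
    (hx : x ∈ adEigenspace μ a) : x = 0 := by
  have h := hμ.lie_cube x
  rw [mem_adEigenspace] at hx
  simp only [hx, lie_smul, smul_smul] at h
  rw [← sub_eq_zero, ← sub_smul] at h
  refine (smul_eq_zero.1 h).resolve_left fun h0 => ha ?_
  linear_combination h0

theorem IsMinuscule.nPlus_abelian (hμ : IsMinuscule μ) (x y : nPlus μ) : ⁅(x : 𝔤), (y : 𝔤)⁆ = 0 :=
  hμ.eq_zero_of_mem (a := 1 + 1) (by norm_num) (lie_mem_adEigenspace x.2 y.2)

theorem IsMinuscule.nMinus_abelian (hμ : IsMinuscule μ) (x y : nMinus μ) :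
    ⁅(x : 𝔤), (y : 𝔤)⁆ = 0 :=
  hμ.eq_zero_of_mem (a := -1 + -1) (by norm_num) (lie_mem_adEigenspace x.2 y.2)

variable {B : LinearMap.BilinForm ℂ 𝔤}

theorem form_eq_zero_of_mem (hinv : ∀ x y w : 𝔤, B ⁅x, y⁆ w = B x ⁅y, w⁆) {a b : ℂ} {x y : 𝔤}
    (hx : x ∈ adEigenspace μ a) (hy : y ∈ adEigenspace μ b) (hab : a + b ≠ 0) : B x y = 0 := by
  rw [mem_adEigenspace] at hx hy
  have h := hinv x μ y
  rw [← lie_skew, hx, hy] at h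
  simp only [map_neg, map_smul, LinearMap.neg_apply, LinearMap.smul_apply, smul_eq_mul] at h
  have : (a + b) * B x y = 0 := by linear_combination -h
  exact (mul_eq_zero.1 this).resolve_left hab

theorem symplecticForm_apply (p q : nPlus μ × nMinus μ) :
    symplecticForm B μ p q = B (p.1 : 𝔤) (q.2 : 𝔤) - B (q.1 : 𝔤) (p.2 : 𝔤) := rfl

theorem symplecticForm_isAlt : (symplecticForm B μ).IsAlt := fun p => by
  rw [symplecticForm_apply, sub_self]

theorem symplecticForm_nondegenerate (hB : B.Nondegenerate)
    (hinv : ∀ x y w : 𝔤, B ⁅x, y⁆ w = B x ⁅y, w⁆) (hμ : IsMinuscule μ) :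
    (symplecticForm B μ).Nondegenerate := by
  have key : ∀ p : nPlus μ × nMinus μ, (∀ q, symplecticForm B μ p q = 0) → p = 0 := by
    intro p hp
    have h1 : (p.1 : 𝔤) = 0 := by
      refine hB.1 _ fun x => ?_
      obtain ⟨x₁, h₁, x₂, h₂, x₃, h₃, rfl⟩ := hμ.exists_decomposition x
      have := hp (0, ⟨x₁, h₁⟩)
      simp only [symplecticForm_apply, ZeroMemClass.coe_zero, map_zero, LinearMap.zero_apply,
        sub_zero] at this
      rw [map_add, map_add, this, form_eq_zero_of_mem hinv p.1.2 h₂ (by norm_num),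
        form_eq_zero_of_mem hinv p.1.2 h₃ (by norm_num), add_zero, add_zero]
    have h2 : (p.2 : 𝔤) = 0 := by
      refine hB.2 _ fun x => ?_
      obtain ⟨x₁, h₁, x₂, h₂, x₃, h₃, rfl⟩ := hμ.exists_decomposition x
      have := hp (⟨x₃, h₃⟩, 0)
      simp only [symplecticForm_apply, ZeroMemClass.coe_zero, map_zero, zero_sub,
        neg_eq_zero] at this
      simp only [map_add, LinearMap.add_apply]
      rw [this, form_eq_zero_of_mem hinv h₂ p.2.2 (by norm_num),
        form_eq_zero_of_mem hinv h₁ p.2.2 (by norm_num), add_zero, add_zero]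
    exact Prod.ext (Subtype.ext h1) (Subtype.ext h2)
  refine ⟨key, fun p hp => key p fun q => ?_⟩
  have := hp q
  rw [symplecticForm_apply] at this ⊢
  linear_combination -this

/-- The form pairs `𝔫⁺` only with `𝔫⁻`, so the coefficients extract the components of `x` of weight
1 and -1. `ad μ` is the difference of these two components. -/
theorem lie_eq_sum_dual (hsymm : B.IsSymm) (hinv : ∀ x y w : 𝔤, B ⁅x, y⁆ w = B x ⁅y, w⁆)
    (hμ : IsMinuscule μ) {r : ℕ} (X : Module.Basis (Fin r) ℂ (nPlus μ))
    (Y : Module.Basis (Fin r) ℂ (nMinus μ))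
    (hXY : ∀ m n, B (X m : 𝔤) (Y n : 𝔤) = if m = n then 1 else 0) (x : 𝔤) :
    ⁅μ, x⁆ = ∑ m, (B x (Y m) • (X m : 𝔤) - B x (X m) • (Y m : 𝔤)) := by
  obtain ⟨x₁, h₁, x₂, h₂, x₃, h₃, rfl⟩ := hμ.exists_decomposition x
  have hYX : ∀ m n, B (Y m : 𝔤) (X n : 𝔤) = if m = n then 1 else 0 := fun m n => by
    rw [hsymm.eq, hXY]; simp only [eq_comm]
  have e1 : x₁ = ∑ m, B x₁ (X m) • (Y m : 𝔤) := by
    have hr := congrArg Subtype.val (Y.sum_repr ⟨x₁, h₁⟩).symm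
    simp only [AddSubmonoidClass.coe_finsetSum, SetLike.val_smul] at hr
    have : ∀ m, B x₁ (X m) = Y.repr ⟨x₁, h₁⟩ m := by
      intro m
      conv_lhs => rw [hr]
      simp [map_sum, LinearMap.sum_apply, hYX]
    simp only [this]
    exact hr
  have e3 : x₃ = ∑ m, B x₃ (Y m) • (X m : 𝔤) := by
    have hr := congrArg Subtype.val (X.sum_repr ⟨x₃, h₃⟩).symm
    simp only [AddSubmonoidClass.coe_finsetSum, SetLike.val_smul] at hr
    have : ∀ m, B x₃ (Y m) = X.repr ⟨x₃, h₃⟩ m := by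
      intro m
      conv_lhs => rw [hr]
      simp [map_sum, LinearMap.sum_apply, hXY]
    simp only [this]
    exact hr
  have z1 : ∀ m, B x₁ (Y m) = 0 := fun m => form_eq_zero_of_mem hinv h₁ (Y m).2 (by norm_num)
  have z2 : ∀ m, B x₂ (Y m) = 0 := fun m => form_eq_zero_of_mem hinv h₂ (Y m).2 (by norm_num)
  have z2' : ∀ m, B x₂ (X m) = 0 := fun m => form_eq_zero_of_mem hinv h₂ (X m).2 (by norm_num)
  have z3 : ∀ m, B x₃ (X m) = 0 := fun m => form_eq_zero_of_mem hinv h₃ (X m).2 (by norm_num)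
  rw [mem_adEigenspace] at h₁ h₂ h₃
  simp only [map_add, LinearMap.add_apply, z1, z2, z2', z3, add_zero, zero_add,
    Finset.sum_sub_distrib, ← e1, ← e3, lie_add, h₁, h₂, h₃]
  module

variable [Module.Finite ℂ 𝔤]

section Casimir

variable (B)

theorem sum_form_smul_dualBasis (hB : B.Nondegenerate) (v : 𝔤) :
    ∑ a, B v (Module.finBasis ℂ 𝔤 a) • B.dualBasis hB (Module.finBasis ℂ 𝔤) a = v := by
  have := (B.dualBasis hB (Module.finBasis ℂ 𝔤)).sum_repr v
  simpa only [LinearMap.BilinForm.dualBasis_repr_apply] using this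

theorem sum_form_dualBasis_smul (hB : B.Nondegenerate) (hsymm : B.IsSymm) (v : 𝔤) :
    ∑ a, B v (B.dualBasis hB (Module.finBasis ℂ 𝔤) a) • Module.finBasis ℂ 𝔤 a = v := by
  conv_rhs => rw [← (Module.finBasis ℂ 𝔤).sum_repr v]
  refine Finset.sum_congr rfl fun a _ => ?_
  congr 1
  conv_lhs => rw [← (Module.finBasis ℂ 𝔤).sum_repr v]
  simp only [map_sum, map_smul, LinearMap.sum_apply, LinearMap.smul_apply, smul_eq_mul, mul_ite,
    LinearMap.BilinForm.apply_dualBasis_right hB hsymm, mul_one, mul_zero, Finset.sum_ite_eq',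
    Finset.mem_univ, if_true]

/-- Invariance of the Casimir tensor, tested on an arbitrary bilinear map `Ψ`. The matrices of `ad
x` in dual bases are negative transposes of each other, so the double sums cancel term by term. -/
theorem sum_invariant (hB : B.Nondegenerate) (hsymm : B.IsSymm)
    (hinv : ∀ x y w : 𝔤, B ⁅x, y⁆ w = B x ⁅y, w⁆) {W : Type*} [AddCommGroup W] [Module ℂ W]
    (Ψ : 𝔤 →ₗ[ℂ] 𝔤 →ₗ[ℂ] W) (x : 𝔤) :
    ∑ a, (Ψ ⁅x, Module.finBasis ℂ 𝔤 a⁆ (B.dualBasis hB (Module.finBasis ℂ 𝔤) a) +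
      Ψ (Module.finBasis ℂ 𝔤 a) ⁅x, B.dualBasis hB (Module.finBasis ℂ 𝔤) a⁆) = 0 := by
  have h1 : ∀ v w, Ψ v w = ∑ a, B v (B.dualBasis hB (Module.finBasis ℂ 𝔤) a) •
      Ψ (Module.finBasis ℂ 𝔤 a) w := fun v w => by
    conv_lhs => rw [← sum_form_dualBasis_smul B hB hsymm v]
    simp [map_sum, LinearMap.sum_apply]
  have h2 : ∀ v w, Ψ v w = ∑ a, B w (Module.finBasis ℂ 𝔤 a) •
      Ψ v (B.dualBasis hB (Module.finBasis ℂ 𝔤) a) := fun v w => by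
    conv_lhs => rw [← sum_form_smul_dualBasis B hB w]
    simp [map_sum]
  rw [Finset.sum_add_distrib]
  simp only [h1 ⁅x, _⁆]
  simp only [h2 _ ⁅x, _⁆]
  rw [Finset.sum_comm, ← Finset.sum_add_distrib]
  refine Finset.sum_eq_zero fun a _ => ?_
  rw [← Finset.sum_add_distrib]
  refine Finset.sum_eq_zero fun b _ => ?_
  rw [← add_smul]
  have : B ⁅x, Module.finBasis ℂ 𝔤 b⁆ (B.dualBasis hB (Module.finBasis ℂ 𝔤) a) +
      B ⁅x, B.dualBasis hB (Module.finBasis ℂ 𝔤) a⁆ (Module.finBasis ℂ 𝔤 b) = 0 := by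
    rw [← lie_skew, map_neg, LinearMap.neg_apply, hinv, hsymm.eq _ (Module.finBasis ℂ 𝔤 b)]
    ring
  rw [this, zero_smul]

/-- `ad μ` on the first leg of the Casimir sees only its components in `𝔫⁺ ⊗ 𝔫⁻` and `𝔫⁻ ⊗ 𝔫⁺`, with
opposite signs. The rest of the Casimir therefore has charge zero in each leg. -/
theorem sum_lie_dualBasis (hB : B.Nondegenerate) (hsymm : B.IsSymm)
    (hinv : ∀ x y w : 𝔤, B ⁅x, y⁆ w = B x ⁅y, w⁆)
    (hμ : IsMinuscule μ) {r : ℕ} (X : Module.Basis (Fin r) ℂ (nPlus μ))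
    (Y : Module.Basis (Fin r) ℂ (nMinus μ))
    (hXY : ∀ m n, B (X m : 𝔤) (Y n : 𝔤) = if m = n then 1 else 0)
    {W : Type*} [AddCommGroup W] [Module ℂ W] (Ψ : 𝔤 →ₗ[ℂ] 𝔤 →ₗ[ℂ] W) :
    ∑ a, Ψ ⁅μ, Module.finBasis ℂ 𝔤 a⁆ (B.dualBasis hB (Module.finBasis ℂ 𝔤) a) =
      ∑ m, (Ψ (X m) (Y m) - Ψ (Y m) (X m)) := by
  have h2 : ∀ v w, Ψ v w = ∑ a, B w (Module.finBasis ℂ 𝔤 a) •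
      Ψ v (B.dualBasis hB (Module.finBasis ℂ 𝔤) a) := fun v w => by
    conv_lhs => rw [← sum_form_smul_dualBasis B hB w]
    simp [map_sum]
  simp only [lie_eq_sum_dual hsymm hinv hμ X Y hXY, map_sum, LinearMap.sum_apply, map_sub,
    LinearMap.sub_apply, map_smul, LinearMap.smul_apply]
  rw [Finset.sum_comm]
  refine Finset.sum_congr rfl fun m _ => ?_
  rw [Finset.sum_sub_distrib, h2 (X m : 𝔤) (Y m : 𝔤), h2 (Y m : 𝔤) (X m : 𝔤)]
  simp only [hsymm.eq (Module.finBasis ℂ 𝔤 _)]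

end Casimir

theorem injective_of_isSimple [LieAlgebra.IsSimple ℂ 𝔤] {L : Type*} [LieRing L] [LieAlgebra ℂ L]
    {ρ : 𝔤 →ₗ⁅ℂ⁆ L} (hρ : ρ ≠ 0) : Function.Injective ρ := by
  rw [← LieHom.ker_eq_bot]
  refine (LieAlgebra.IsSimple.eq_bot_or_eq_top (R := ℂ) ρ.ker).resolve_right fun h => hρ ?_
  ext1 x
  have : x ∈ ρ.ker := by rw [h]; trivial
  simpa using this

variable {n : Type*} [Fintype n] [DecidableEq n]

theorem rep_lie (ρ : 𝔤 →ₗ⁅ℂ⁆ Matrix n n ℂ) (x y : 𝔤) : ρ ⁅x, y⁆ = ρ x * ρ y - ρ y * ρ x := by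
  rw [LieHom.map_lie, LieRing.of_associative_ring_bracket]

theorem commute_casimir (hB : B.Nondegenerate) (hsymm : B.IsSymm)
    (hinv : ∀ x y w : 𝔤, B ⁅x, y⁆ w = B x ⁅y, w⁆) (ρ : 𝔤 →ₗ⁅ℂ⁆ Matrix n n ℂ) (x : 𝔤) :
    Commute (casimir B hB ρ) (ρ x ⊗ₖ 1 + 1 ⊗ₖ ρ x) := by
  let Ψ : 𝔤 →ₗ[ℂ] 𝔤 →ₗ[ℂ] Matrix (n × n) (n × n) ℂ := LinearMap.mk₂ ℂ (fun u v => ρ u ⊗ₖ ρ v)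
    (by intro u v w; rw [map_add, Matrix.add_kronecker])
    (by intro a u v; rw [map_smul, Matrix.smul_kronecker])
    (by intro u v w; rw [map_add, Matrix.kronecker_add])
    (by intro a u v; rw [map_smul, Matrix.kronecker_smul])
  have h := sum_invariant B hB hsymm hinv Ψ x
  refine (sub_eq_zero.1 ?_ : (ρ x ⊗ₖ 1 + 1 ⊗ₖ ρ x) * casimir B hB ρ = _).symm
  rw [← h, casimir, Finset.mul_sum, Finset.sum_mul, ← Finset.sum_sub_distrib]
  refine Finset.sum_congr rfl fun a _ => ?_
  change _ = ρ _ ⊗ₖ ρ _ + ρ _ ⊗ₖ ρ _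
  rw [rep_lie, rep_lie, add_mul, mul_add]
  simp only [← Matrix.mul_kronecker_mul, one_mul, mul_one]
  simp only [← kronLeft_mul_kronRight, map_sub]
  noncomm_ring

theorem kronLeft_casimir (hB : B.Nondegenerate) (hsymm : B.IsSymm)
    (hinv : ∀ x y w : 𝔤, B ⁅x, y⁆ w = B x ⁅y, w⁆)
    (hμ : IsMinuscule μ) {r : ℕ} (X : Module.Basis (Fin r) ℂ (nPlus μ))
    (Y : Module.Basis (Fin r) ℂ (nMinus μ))
    (hXY : ∀ m n, B (X m : 𝔤) (Y n : 𝔤) = if m = n then 1 else 0) (ρ : 𝔤 →ₗ⁅ℂ⁆ Matrix n n ℂ) :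
    (ρ μ ⊗ₖ 1) * casimir B hB ρ - casimir B hB ρ * (ρ μ ⊗ₖ 1) =
      ∑ m, (ρ (X m) ⊗ₖ ρ (Y m) - ρ (Y m) ⊗ₖ ρ (X m)) := by
  let Ψ : 𝔤 →ₗ[ℂ] 𝔤 →ₗ[ℂ] Matrix (n × n) (n × n) ℂ := LinearMap.mk₂ ℂ (fun u v => ρ u ⊗ₖ ρ v)
    (by intro u v w; rw [map_add, Matrix.add_kronecker])
    (by intro a u v; rw [map_smul, Matrix.smul_kronecker])
    (by intro u v w; rw [map_add, Matrix.kronecker_add])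
    (by intro a u v; rw [map_smul, Matrix.kronecker_smul])
  have h := sum_lie_dualBasis B hB hsymm hinv hμ X Y hXY Ψ
  refine Eq.trans ?_ h
  rw [casimir, Finset.mul_sum, Finset.sum_mul, ← Finset.sum_sub_distrib]
  refine Finset.sum_congr rfl fun a _ => ?_
  change _ = ρ _ ⊗ₖ ρ _
  rw [rep_lie]
  simp only [← Matrix.mul_kronecker_mul, one_mul, mul_one]
  simp only [← kronLeft_mul_kronRight, map_sub, sub_mul]

theorem linearIndependent_sumElim (hsymm : B.IsSymm)
    (hinv : ∀ x y w : 𝔤, B ⁅x, y⁆ w = B x ⁅y, w⁆) {r : ℕ} (X : Module.Basis (Fin r) ℂ (nPlus μ))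
    (Y : Module.Basis (Fin r) ℂ (nMinus μ))
    (hXY : ∀ m n, B (X m : 𝔤) (Y n : 𝔤) = if m = n then 1 else 0) :
    LinearIndependent ℂ (Sum.elim (fun m => (X m : 𝔤)) fun m => (Y m : 𝔤)) := by
  rw [Fintype.linearIndependent_iff]
  intro g hg
  rw [Fintype.sum_sum_type] at hg
  simp only [Sum.elim_inl, Sum.elim_inr] at hg
  have zX : ∀ m n, B (X m : 𝔤) (X n : 𝔤) = 0 := fun m n =>
    form_eq_zero_of_mem hinv (X m).2 (X n).2 (by norm_num)
  have zY : ∀ m n, B (Y m : 𝔤) (Y n : 𝔤) = 0 := fun m n =>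
    form_eq_zero_of_mem hinv (Y m).2 (Y n).2 (by norm_num)
  have hYX : ∀ m n, B (Y m : 𝔤) (X n : 𝔤) = if m = n then 1 else 0 := fun m n => by
    rw [hsymm.eq, hXY]; simp only [eq_comm]
  rintro (m | m)
  · have := congrArg (fun v => B v (Y m : 𝔤)) hg
    simpa [map_sum, LinearMap.sum_apply, hXY, zY] using this
  · have := congrArg (fun v => B v (X m : 𝔤)) hg
    simpa [map_sum, LinearMap.sum_apply, hYX, zX] using this

theorem rllData_of_rep [LieAlgebra.IsSimple ℂ 𝔤] (hB : B.Nondegenerate) (hsymm : B.IsSymm)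
    (hinv : ∀ x y w : 𝔤, B ⁅x, y⁆ w = B x ⁅y, w⁆)
    (hμ : IsMinuscule μ) {r : ℕ} (X : Module.Basis (Fin r) ℂ (nPlus μ))
    (Y : Module.Basis (Fin r) ℂ (nMinus μ))
    (hXY : ∀ m n, B (X m : 𝔤) (Y n : 𝔤) = if m = n then 1 else 0)
    {ρ : 𝔤 →ₗ⁅ℂ⁆ Matrix n n ℂ} (hρ : ρ ≠ 0) {e : ℕ} (he : IsFractional e (ρ μ)) :
    RLLData e r (ρ μ) (fun m => ρ (X m : 𝔤)) (fun m => ρ (Y m : 𝔤)) (casimir B hB ρ) := by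
  have wX : ∀ m, ρ μ * ρ (X m) - ρ (X m) * ρ μ = ρ (X m) := fun m => by
    rw [← rep_lie, nPlus_lie]
  have wY : ∀ m, ρ μ * ρ (Y m) - ρ (Y m) * ρ μ = -ρ (Y m) := fun m => by
    rw [← rep_lie, nMinus_lie, map_neg]
  have hL : (ρ μ ⊗ₖ 1) * (∑ m, (ρ (X m) ⊗ₖ ρ (Y m) + ρ (Y m) ⊗ₖ ρ (X m))) -
      (∑ m, (ρ (X m) ⊗ₖ ρ (Y m) + ρ (Y m) ⊗ₖ ρ (X m))) * (ρ μ ⊗ₖ 1) =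
      ∑ m, (ρ (X m) ⊗ₖ ρ (Y m) - ρ (Y m) ⊗ₖ ρ (X m)) := by
    rw [Finset.mul_sum, Finset.sum_mul, ← Finset.sum_sub_distrib]
    refine Finset.sum_congr rfl fun m _ => ?_
    rw [mul_add, add_mul, add_sub_add_comm]
    simp only [← Matrix.mul_kronecker_mul, one_mul, mul_one]
    simp only [← kronLeft_mul_kronRight]
    rw [← sub_mul, ← sub_mul, ← map_sub, ← map_sub, wX, wY, map_neg, neg_mul, sub_eq_add_neg]
  have hR : (1 ⊗ₖ ρ μ) * (∑ m, (ρ (X m) ⊗ₖ ρ (Y m) + ρ (Y m) ⊗ₖ ρ (X m))) -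
      (∑ m, (ρ (X m) ⊗ₖ ρ (Y m) + ρ (Y m) ⊗ₖ ρ (X m))) * (1 ⊗ₖ ρ μ) =
      -∑ m, (ρ (X m) ⊗ₖ ρ (Y m) - ρ (Y m) ⊗ₖ ρ (X m)) := by
    rw [Finset.mul_sum, Finset.sum_mul, ← Finset.sum_sub_distrib, ← Finset.sum_neg_distrib]
    refine Finset.sum_congr rfl fun m _ => ?_
    rw [mul_add, add_mul, add_sub_add_comm]
    simp only [← Matrix.mul_kronecker_mul, one_mul, mul_one]
    simp only [← kronLeft_mul_kronRight]
    rw [← mul_sub, ← mul_sub, ← map_sub, ← map_sub, wX, wY, map_neg, mul_neg]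
    abel
  have cL := kronLeft_casimir hB hsymm hinv hμ X Y hXY ρ
  refine ⟨he, wX, wY, fun m m' => ?_, fun m m' => ?_, fun m => commute_casimir hB hsymm hinv ρ _,
    fun m => commute_casimir hB hsymm hinv ρ _, ?_, ?_, ?_⟩
  · have := rep_lie ρ (X m) (X m')
    rw [hμ.nPlus_abelian, map_zero] at this
    exact (sub_eq_zero.1 this.symm)
  · have := rep_lie ρ (Y m) (Y m')
    rw [hμ.nMinus_abelian, map_zero] at this
    exact (sub_eq_zero.1 this.symm)
  · refine (sub_eq_zero.1 ?_ : (ρ μ ⊗ₖ 1) * _ = _).symm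
    rw [mul_sub, sub_mul, sub_sub_sub_comm, cL, hL, sub_self]
  · refine (sub_eq_zero.1 ?_ : (1 ⊗ₖ ρ μ) * _ = _).symm
    -- The Casimir commutes with `μ ⊗ 1 + 1 ⊗ μ`, so its commutator with `1 ⊗ μ` is minus the one
    -- with `μ ⊗ 1`.
    have h1 := (commute_casimir hB hsymm hinv ρ μ).eq
    rw [mul_add, add_mul] at h1
    rw [mul_sub, sub_mul, sub_sub_sub_comm, hR, ← cL, sub_neg_eq_add, sub_add_sub_comm,
      sub_eq_zero, add_comm, ← h1, add_comm]
  · have := (linearIndependent_sumElim hsymm hinv X Y hXY).map' (ρ : 𝔤 →ₗ[ℂ] Matrix n n ℂ)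
      (LinearMap.ker_eq_bot.2 (injective_of_isSimple hρ))
    rw [show Sum.elim (fun m => ρ (X m : 𝔤)) (fun m => ρ (Y m : 𝔤)) =
      (ρ : 𝔤 →ₗ[ℂ] Matrix n n ℂ) ∘ Sum.elim (fun m => (X m : 𝔤)) fun m => (Y m : 𝔤) by
        funext a
        rcases a with a | a <;> rfl]
    exact this

/-- The adjoint representation in matrices, as a homomorphism of Lie algebras. -/
def adRep (𝔤 : Type*) [LieRing 𝔤] [LieAlgebra ℂ 𝔤] [Module.Finite ℂ 𝔤] :
    𝔤 →ₗ⁅ℂ⁆ Matrix (Fin (Module.finrank ℂ 𝔤)) (Fin (Module.finrank ℂ 𝔤)) ℂ where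
  toFun := adMatrix
  map_add' x y := by simp [adMatrix]
  map_smul' c x := by simp [adMatrix]
  map_lie' {x y} := by
    simp only [adMatrix, LieRing.of_associative_ring_bracket, LieHom.map_lie, map_sub,
      Module.End.mul_eq_comp]
    rw [LinearMap.toMatrix_comp _ (Module.finBasis ℂ 𝔤),
      LinearMap.toMatrix_comp _ (Module.finBasis ℂ 𝔤)]

theorem adRep_ne_zero [LieAlgebra.IsSimple ℂ 𝔤] : adRep 𝔤 ≠ 0 := by
  intro h
  refine LieAlgebra.IsSimple.non_abelian (R := ℂ) (L := 𝔤) ⟨fun x y => ?_⟩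
  have h1 : adMatrix x = 0 := DFunLike.congr_fun h x
  rw [adMatrix, LinearEquiv.map_eq_zero_iff] at h1
  exact DFunLike.congr_fun h1 y

theorem isFractional_adRep (hμ : IsMinuscule μ) : IsFractional 1 (adRep 𝔤 μ) := by
  rw [IsFractional, eq_top_iff]
  intro v _
  let b := Module.finBasis ℂ 𝔤
  have key : ∀ (k : ℤ) (x : 𝔤), x ∈ adEigenspace μ k → b.equivFun x ∈
      ⨆ k : ℤ, Module.End.eigenspace (Matrix.toLin' (adRep 𝔤 μ)) ((k : ℂ) / (1 : ℕ)) := by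
    intro k x hx
    refine Submodule.mem_iSup_of_mem k ?_
    rw [mem_adEigenspace] at hx
    rw [Module.End.mem_eigenspace_iff, Matrix.toLin'_apply]
    have := LinearMap.toMatrix_mulVec_repr b b (LieAlgebra.ad ℂ 𝔤 μ) x
    change (LinearMap.toMatrix b b (LieAlgebra.ad ℂ 𝔤 μ)).mulVec (b.repr x) = _
    rw [this, LieAlgebra.ad_apply, hx]
    simp
  obtain ⟨x, rfl⟩ := b.equivFun.surjective v
  obtain ⟨x₁, h₁, x₂, h₂, x₃, h₃, rfl⟩ := hμ.exists_decomposition x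
  rw [map_add, map_add]
  refine add_mem (add_mem (key (-1) _ ?_) (key 0 _ ?_)) (key 1 _ ?_)
  · simpa using h₁
  · simpa using h₂
  · simpa using h₃

end Grading

/-! ### Points of linear algebraic groups -/

section Points

variable {N : ℕ} {G : Subgroup (GL (Fin N) ℂ)} {R S : Type*} [CommRing R] [Algebra ℂ R]
  [CommRing S] [Algebra ℂ S]

/-- The value of a polynomial in the matrix entries. -/
def evalAt (M : Matrix (Fin N) (Fin N) R) : MvPolynomial (Fin N × Fin N) ℂ →ₐ[ℂ] R :=
  MvPolynomial.aeval fun p => M p.1 p.2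

theorem evalAt_X (M : Matrix (Fin N) (Fin N) R) (p : Fin N × Fin N) :
    evalAt M (MvPolynomial.X p) = M p.1 p.2 := MvPolynomial.aeval_X _ _

/-- A matrix that satisfies the equations of `G`. -/
def IsPoint (G : Subgroup (GL (Fin N) ℂ)) (M : Matrix (Fin N) (Fin N) R) : Prop :=
  ∀ f, VanishesOn G f → evalAt M f = 0

theorem isPoint_coe {g : GL (Fin N) ℂ} (hg : g ∈ G) : IsPoint G (g : Matrix (Fin N) (Fin N) ℂ) :=
  fun _ hf => hf g hg

theorem evalAt_map (φ : R →ₐ[ℂ] S) (M : Matrix (Fin N) (Fin N) R)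
    (f : MvPolynomial (Fin N × Fin N) ℂ) : evalAt (M.map φ) f = φ (evalAt M f) := by
  rw [evalAt, evalAt, ← AlgHom.comp_apply, MvPolynomial.comp_aeval]
  rfl

theorem IsPoint.map {M : Matrix (Fin N) (Fin N) R} (hM : IsPoint G M) (φ : R →ₐ[ℂ] S) :
    IsPoint G (M.map φ) := fun f hf => by
  rw [evalAt_map, hM f hf, map_zero]

theorem IsPoint.of_map {M : Matrix (Fin N) (Fin N) R} (φ : R →ₐ[ℂ] S)
    (hφ : Function.Injective φ) (hM : IsPoint G (M.map φ)) : IsPoint G M := fun f hf => by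
  apply hφ
  rw [map_zero, ← evalAt_map, hM f hf]

theorem IsPoint.exists_mem (hG : IsAlgebraicGroup G) {M : Matrix (Fin N) (Fin N) ℂ}
    (hM : IsPoint G M) (hu : IsUnit M) : ∃ g ∈ G, (g : Matrix (Fin N) (Fin N) ℂ) = M :=
  ⟨hu.unit, hG _ hM, rfl⟩

/-- The generic matrix. -/
def genericM (N : ℕ) : Matrix (Fin N) (Fin N) (MvPolynomial (Fin N × Fin N) ℂ) :=
  Matrix.of fun i j => MvPolynomial.X (i, j)

theorem genericM_map_evalAt (M : Matrix (Fin N) (Fin N) R) : (genericM N).map (evalAt M) = M := by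
  ext i j
  rw [Matrix.map_apply, genericM, Matrix.of_apply, evalAt_X]

theorem extM_map {n : Type*} [Fintype n] [DecidableEq n] (φ : R →ₐ[ℂ] S) (M : Matrix n n ℂ) :
    (extM R M).map φ = extM S M := by
  ext i j
  exact φ.commutes _

theorem evalAt_mul_left (A : Matrix (Fin N) (Fin N) ℂ) (M : Matrix (Fin N) (Fin N) R)
    (f : MvPolynomial (Fin N × Fin N) ℂ) :
    evalAt M (evalAt (extM _ A * genericM N) f) = evalAt (extM R A * M) f := by
  rw [← evalAt_map, Matrix.map_mul, genericM_map_evalAt, extM_map]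

theorem VanishesOn.mul_left {f : MvPolynomial (Fin N × Fin N) ℂ} (hf : VanishesOn G f)
    {g : GL (Fin N) ℂ} (hg : g ∈ G) :
    VanishesOn G (evalAt (extM _ (g : Matrix (Fin N) (Fin N) ℂ) * genericM N) f) := by
  intro x hx
  have := hf (g * x) (G.mul_mem hg hx)
  change evalAt (x : Matrix (Fin N) (Fin N) ℂ) _ = 0
  rw [evalAt_mul_left]
  exact this

theorem IsPoint.mul_left {M : Matrix (Fin N) (Fin N) R} (hM : IsPoint G M) {g : GL (Fin N) ℂ}
    (hg : g ∈ G) : IsPoint G (extM R (g : Matrix (Fin N) (Fin N) ℂ) * M) := fun f hf => by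
  rw [← evalAt_mul_left, hM _ (hf.mul_left hg)]

/-- A polynomial over `R` that vanishes at the `ℂ`-points of a variety vanishes at its `R`-points. -/
theorem eval_eq_zero_of_forall_complex {σ : Type*} (s : Set (σ → ℂ)) (F : MvPolynomial σ R)
    (hF : ∀ x ∈ s, MvPolynomial.eval (fun i => algebraMap ℂ R (x i)) F = 0) (M : σ → R)
    (hM : ∀ f : MvPolynomial σ ℂ, (∀ x ∈ s, MvPolynomial.eval x f = 0) →
      MvPolynomial.aeval M f = 0) : MvPolynomial.eval M F = 0 := by
  classical
  -- Expanding the coefficients of `F` in a `ℂ`-basis of `R` writes `F` as a finite combination of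
  -- complex polynomials `f i`. Each of them vanishes on `s` by linear independence, hence at `M`.
  let b := Module.Basis.ofVectorSpace ℂ R
  let I := F.support.biUnion fun m => (b.repr (F.coeff m)).support
  have hcoeff : ∀ m ∈ F.support, F.coeff m = ∑ i ∈ I, b.repr (F.coeff m) i • b i := by
    intro m hm
    conv_lhs => rw [← b.linearCombination_repr (F.coeff m)]
    rw [Finsupp.linearCombination_apply]
    exact Finsupp.sum_of_support_subset _ (Finset.subset_biUnion_of_mem
      (fun m => (b.repr (F.coeff m)).support) hm) _ (by simp)
  let f : _ → MvPolynomial σ ℂ := fun i =>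
    ∑ m ∈ F.support, MvPolynomial.monomial m (b.repr (F.coeff m) i)
  have hf : ∀ i, MvPolynomial.aeval M (f i) = 0 := by
    intro i
    refine hM _ fun x hx => ?_
    have h := congrArg (fun v => b.repr v i) (hF x hx)
    simp only [MvPolynomial.eval_eq, map_sum, map_zero, Finsupp.coe_zero, Pi.zero_apply,
      Finsupp.coe_finsetSum, Finset.sum_apply] at h
    rw [map_sum, ← h]
    refine Finset.sum_congr rfl fun m _ => ?_
    rw [MvPolynomial.eval_monomial, Finsupp.prod]
    have : (∏ i ∈ m.support, algebraMap ℂ R (x i) ^ m i) =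
        algebraMap ℂ R (∏ i ∈ m.support, x i ^ m i) := by simp
    rw [this, mul_comm (MvPolynomial.coeff m F), ← Algebra.smul_def, map_smul, Finsupp.smul_apply,
      smul_eq_mul, mul_comm]
  rw [MvPolynomial.eval_eq]
  have : ∀ m ∈ F.support, F.coeff m * ∏ i ∈ m.support, M i ^ m i =
      ∑ i ∈ I, b i * MvPolynomial.aeval M (MvPolynomial.monomial m (b.repr (F.coeff m) i)) := by
    intro m hm
    conv_lhs => rw [hcoeff m hm]
    rw [Finset.sum_mul]
    refine Finset.sum_congr rfl fun i _ => ?_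
    rw [MvPolynomial.aeval_monomial, Finsupp.prod, Algebra.smul_def]
    ring
  rw [Finset.sum_congr rfl this, Finset.sum_comm]
  refine Finset.sum_eq_zero fun i _ => ?_
  rw [← Finset.mul_sum, ← map_sum, show ∑ m ∈ F.support, MvPolynomial.monomial m
    (b.repr (F.coeff m) i) = f i from rfl, hf, mul_zero]

/-- With `M'` fixed, `f (A * M')` is a polynomial over `R` in the entries of `A`. It vanishes for `A
∈ G(ℂ)` because equations of `G` may be translated by elements of `G`, hence it vanishes at every
`R`-point. -/
theorem IsPoint.mul {M M' : Matrix (Fin N) (Fin N) R} (hM : IsPoint G M) (hM' : IsPoint G M') :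
    IsPoint G (M * M') := by
  intro f hf
  let F : MvPolynomial (Fin N × Fin N) R :=
    MvPolynomial.aeval (fun p : Fin N × Fin N =>
      ∑ k, MvPolynomial.X (p.1, k) * MvPolynomial.C (M' k p.2)) f
  have hF : ∀ A : Matrix (Fin N) (Fin N) R,
      MvPolynomial.eval (fun p => A p.1 p.2) F = evalAt (A * M') f := by
    intro A
    let φ : MvPolynomial (Fin N × Fin N) R →ₐ[ℂ] R :=
      (MvPolynomial.aeval (R := R) fun p : Fin N × Fin N => A p.1 p.2).restrictScalars ℂ
    have hX : ∀ p, φ (MvPolynomial.X p) = A p.1 p.2 := fun p => MvPolynomial.aeval_X _ p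
    have hC : ∀ r, φ (MvPolynomial.C r) = r := fun r => MvPolynomial.aeval_C _ r
    have : ∀ q, MvPolynomial.eval (fun p => A p.1 p.2) q = φ q := fun q => by
      rw [← MvPolynomial.aeval_eq_eval]; rfl
    rw [this, evalAt]
    change φ (MvPolynomial.aeval _ f) = _
    rw [← AlgHom.comp_apply, MvPolynomial.comp_aeval]
    congr 2
    funext p
    rw [map_sum, Matrix.mul_apply]
    exact Finset.sum_congr rfl fun k _ => by rw [map_mul, hX, hC]
  rw [← hF]
  refine eval_eq_zero_of_forall_complex
    (Set.range fun g : G => fun p : Fin N × Fin N => (g : GL (Fin N) ℂ).1 p.1 p.2) F ?_ _ ?_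
  · rintro _ ⟨g, rfl⟩
    have := hF (extM R (g : GL (Fin N) ℂ).1)
    rw [hM'.mul_left g.2 f hf] at this
    exact this
  · intro q hq
    refine hM q fun g hg => ?_
    have := hq _ ⟨⟨g, hg⟩, rfl⟩
    rwa [← MvPolynomial.aeval_eq_eval] at this

end Points

/-! ### The exponential and the Lie algebra of an algebraic group -/

section Exponential

variable {n : Type*} [Fintype n] [DecidableEq n]

theorem hasDerivAt_matrix_exp (α : Matrix n n ℂ) (s : ℂ) :
    HasDerivAt (fun u : ℂ => fun i j => NormedSpace.exp (u • α) i j)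
      (fun i j => (NormedSpace.exp (s • α) * α) i j) s := by
  have h : HasDerivAt (fun u : ℂ => NormedSpace.exp (u • α)) (NormedSpace.exp (s • α) * α) s := by
    open scoped Matrix.Norms.Operator in exact hasDerivAt_exp_smul_const α s
  exact h

theorem hasDerivAt_matrix_exp_apply (α : Matrix n n ℂ) (s : ℂ) (i j : n) :
    HasDerivAt (fun u : ℂ => NormedSpace.exp (u • α) i j)
      ((NormedSpace.exp (s • α) * α) i j) s :=
  hasDerivAt_pi.1 (hasDerivAt_pi.1 (hasDerivAt_matrix_exp α s) i) j

theorem exp_eq_isNilpotent_exp {X : Matrix n n ℂ} (hX : IsNilpotent X) :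
    NormedSpace.exp X = IsNilpotent.exp X := by
  obtain ⟨k, hk⟩ := hX
  rw [IsNilpotent.exp_eq_sum hk, NormedSpace.exp_eq_tsum_rat]
  refine tsum_eq_sum fun m hm => ?_
  rw [pow_eq_zero_of_le (by simpa using hm) hk, smul_zero]

theorem exp_mulVec {A : Matrix n n ℂ} {a : ℂ} {v : n → ℂ} (h : A.mulVec v = a • v) :
    (NormedSpace.exp A).mulVec v = Complex.exp a • v := by
  have h1 : HasSum (fun k : ℕ => ((k.factorial : ℂ)⁻¹) • A ^ k) (NormedSpace.exp A) := by
    open scoped Matrix.Norms.Operator in exact NormedSpace.exp_series_hasSum_exp' A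
  have h2 := h1.map (AddMonoidHom.mk' (fun M : Matrix n n ℂ => M.mulVec v)
    (fun M M' => Matrix.add_mulVec M M' v)) (Continuous.matrix_mulVec continuous_id continuous_const)
  have h3 : HasSum (fun k : ℕ => ((k.factorial : ℂ)⁻¹ • a ^ k) • v) (Complex.exp a • v) := by
    rw [Complex.exp_eq_exp_ℂ]
    exact (NormedSpace.exp_series_hasSum_exp' a).smul_const v
  refine h2.unique ?_
  convert h3 using 1
  funext k
  have : (A ^ k).mulVec v = a ^ k • v := by
    have := aeval_mulVec h (Polynomial.X ^ k)
    simpa using this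
  change ((k.factorial : ℂ)⁻¹ • A ^ k).mulVec v = _
  rw [Matrix.smul_mulVec, this, smul_smul, smul_eq_mul]

theorem exp_smul_eq_zPow {d : ℕ} (hd : d ≠ 0) {T : Matrix n n ℂ} (hT : IsFractional d T) (s : ℂ)
    (t : ℂˣ) (ht : (t : ℂ) = Complex.exp s) :
    NormedSpace.exp (s • (d : ℂ) • T) = zPow d T t := by
  refine matrix_ext_of_eigenvectors hT fun k v _ hv => ?_
  rw [zPow_mulVec hd hv, exp_mulVec (a := s * k)]
  · rw [Units.val_zpow_eq_zpow_val, ht, ← Complex.exp_int_mul, mul_comm]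
  · rw [Matrix.smul_mulVec, Matrix.smul_mulVec, hv, smul_smul, smul_smul, mul_assoc,
      mul_div_cancel₀ _ (by exact_mod_cast hd)]

end Exponential

/-! ### Tangent vectors, exponentials and cocharacters of an algebraic group. -/

section LieAlgebra

variable {N : ℕ} {G : Subgroup (GL (Fin N) ℂ)} {𝔤 : LieSubalgebra ℂ (Matrix (Fin N) (Fin N) ℂ)}

/-- The matrix `A + ε B` over the dual numbers. -/
def dualMatrix (A B : Matrix (Fin N) (Fin N) ℂ) : Matrix (Fin N) (Fin N) (DualNumber ℂ) :=
  Matrix.of fun i j => (A i j, B i j)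

theorem fst_dualMatrix (A B : Matrix (Fin N) (Fin N) ℂ) (i j : Fin N) :
    (dualMatrix A B i j).fst = A i j := rfl

theorem snd_dualMatrix (A B : Matrix (Fin N) (Fin N) ℂ) (i j : Fin N) :
    (dualMatrix A B i j).snd = B i j := rfl

/-- The left invariant vector field with value `α` at the identity. -/
def leftInvariant (α : Matrix (Fin N) (Fin N) ℂ) :
    Derivation ℂ (MvPolynomial (Fin N × Fin N) ℂ) (MvPolynomial (Fin N × Fin N) ℂ) :=
  MvPolynomial.mkDerivation ℂ fun p => (genericM N * extM (MvPolynomial (Fin N × Fin N) ℂ) α) p.1 p.2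

theorem leftInvariant_X (α : Matrix (Fin N) (Fin N) ℂ) (p : Fin N × Fin N) :
    leftInvariant α (MvPolynomial.X p) = (genericM N * extM (MvPolynomial (Fin N × Fin N) ℂ) α) p.1 p.2 :=
  MvPolynomial.mkDerivation_X _ _ _

theorem evalAt_leftInvariant_X (A α : Matrix (Fin N) (Fin N) ℂ) (p : Fin N × Fin N) :
    evalAt A (leftInvariant α (MvPolynomial.X p)) = (A * α) p.1 p.2 := by
  rw [leftInvariant_X]
  have : (genericM N * extM (MvPolynomial (Fin N × Fin N) ℂ) α).map (evalAt A) = A * α := by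
    rw [Matrix.map_mul, genericM_map_evalAt, extM_map]; rfl
  rw [← this, Matrix.map_apply]

/-- Multiplication of dual numbers is the Leibniz rule, so evaluation at `A + ε A α` gives the value
at `A` together with the left invariant derivative there. -/
theorem evalAt_dualMatrix (A α : Matrix (Fin N) (Fin N) ℂ) (f : MvPolynomial (Fin N × Fin N) ℂ) :
    evalAt (dualMatrix A (A * α)) f =
      TrivSqZeroExt.inl (evalAt A f) + TrivSqZeroExt.inr (evalAt A (leftInvariant α f)) := by
  induction f using MvPolynomial.induction_on with
  | C a => simp [evalAt, TrivSqZeroExt.algebraMap_eq_inl]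
  | add p q hp hq =>
    rw [map_add, hp, hq, map_add, map_add, map_add, TrivSqZeroExt.inl_add, TrivSqZeroExt.inr_add]
    abel
  | mul_X p q hp =>
    rw [map_mul, hp, map_mul, evalAt_X, evalAt_X, Derivation.leibniz, map_add, smul_eq_mul,
      smul_eq_mul, map_mul, map_mul, evalAt_leftInvariant_X, evalAt_X]
    ext
    · simp [fst_dualMatrix]
    · simp [fst_dualMatrix, snd_dualMatrix]
      ring

/-- Translating `1 + ε α` by `g ∈ G` gives the point `g + ε g α`. The `ε`-component of an equation
of `G` at that point is its left invariant derivative at `g`. -/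
theorem leftInvariant_vanishesOn {α : Matrix (Fin N) (Fin N) ℂ} (h : IsPoint G (dualMatrix 1 α))
    {f : MvPolynomial (Fin N × Fin N) ℂ} (hf : VanishesOn G f) :
    VanishesOn G (leftInvariant α f) := by
  intro g hg
  change evalAt (g : Matrix (Fin N) (Fin N) ℂ) _ = 0
  have h1 := h.mul_left hg f hf
  have h2 : extM (DualNumber ℂ) (g : Matrix (Fin N) (Fin N) ℂ) * dualMatrix 1 α =
      dualMatrix (g : Matrix (Fin N) (Fin N) ℂ) ((g : Matrix (Fin N) (Fin N) ℂ) * α) := by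
    ext i j
    · simp [fst_dualMatrix, Matrix.mul_apply, TrivSqZeroExt.algebraMap_eq_inl, Matrix.one_apply,
        TrivSqZeroExt.fst_sum]
    · simp [snd_dualMatrix, Matrix.mul_apply, TrivSqZeroExt.algebraMap_eq_inl,
        TrivSqZeroExt.snd_sum]
  rw [h2, evalAt_dualMatrix] at h1
  simpa using congrArg TrivSqZeroExt.snd h1

theorem hasDerivAt_evalAt_exp (α : Matrix (Fin N) (Fin N) ℂ) (f : MvPolynomial (Fin N × Fin N) ℂ)
    (s : ℂ) : HasDerivAt (fun u : ℂ => evalAt (NormedSpace.exp (u • α)) f)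
      (evalAt (NormedSpace.exp (s • α)) (leftInvariant α f)) s := by
  induction f using MvPolynomial.induction_on with
  | C a => simpa [evalAt] using hasDerivAt_const s a
  | add p q hp hq =>
    have := hp.add hq
    simp only [map_add]
    exact this
  | mul_X p q hp =>
    have := hp.mul (hasDerivAt_matrix_exp_apply α s q.1 q.2)
    simp only [map_mul, evalAt_X, Derivation.leibniz, map_add, smul_eq_mul, evalAt_leftInvariant_X]
    exact this.congr_deriv (by ring)

/-- A first order deformation of the identity in `G` is tangent to a one-parameter subgroup. -/
theorem mem_lieAlgebra_of_isPoint_dualMatrix (hG : IsAlgebraicGroup G) (h𝔤 : IsLieAlgebraOf 𝔤 G)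
    {α : Matrix (Fin N) (Fin N) ℂ} (h : IsPoint G (dualMatrix 1 α)) : α ∈ 𝔤 := by
  refine (h𝔤 α).2 fun s => IsPoint.exists_mem hG (fun f hf => ?_) (Matrix.isUnit_exp _)
  -- All derivatives of `u ↦ f (exp (u α))` are values of iterated left invariant derivatives of
  -- `f`, which are again equations of `G`. At `u = 0` they vanish, and an entire function with zero
  -- Taylor series is zero.
  have hit : ∀ (k : ℕ), VanishesOn G ((leftInvariant α)^[k] f) ∧
      iteratedDeriv k (fun u : ℂ => evalAt (NormedSpace.exp (u • α)) f) =
        fun u : ℂ => evalAt (NormedSpace.exp (u • α)) ((leftInvariant α)^[k] f) := by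
    intro k
    induction k with
    | zero => exact ⟨hf, iteratedDeriv_zero⟩
    | succ k ih =>
      rw [Function.iterate_succ_apply', iteratedDeriv_succ, ih.2]
      exact ⟨leftInvariant_vanishesOn h ih.1,
        funext fun u => (hasDerivAt_evalAt_exp α _ u).deriv⟩
  rw [← Complex.taylorSeries_eq_of_entire' 0 s
    fun u => (hasDerivAt_evalAt_exp α f u).differentiableAt]
  have : ∀ k : ℕ, iteratedDeriv k (fun u : ℂ => evalAt (NormedSpace.exp (u • α)) f) 0 = 0 := by
    intro k
    rw [(hit k).2]
    simpa [evalAt] using (hit k).1 1 G.one_mem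
  simp [this]

theorem conj_mem_lieAlgebra (h𝔤 : IsLieAlgebraOf 𝔤 G) {g : GL (Fin N) ℂ} (hg : g ∈ G)
    {x : Matrix (Fin N) (Fin N) ℂ} (hx : x ∈ 𝔤) :
    (g : Matrix (Fin N) (Fin N) ℂ) * x * (g⁻¹ : GL (Fin N) ℂ) ∈ 𝔤 := by
  refine (h𝔤 _).2 fun s => ?_
  obtain ⟨h, hh, he⟩ := (h𝔤 x).1 hx s
  refine ⟨g * h * g⁻¹, G.mul_mem (G.mul_mem hg hh) (G.inv_mem hg), ?_⟩
  have := Matrix.exp_units_conj g (s • x)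
  rw [← he] at this
  rw [← smul_mul_assoc, ← mul_smul_comm, this]
  rfl

variable {R : Type*} [CommRing R] [Algebra ℂ R]

theorem isPoint_exp (h𝔤 : IsLieAlgebraOf 𝔤 G)
    {x : Matrix (Fin N) (Fin N) ℂ} (hx : x ∈ 𝔤) (s : ℂ) : IsPoint G (NormedSpace.exp (s • x)) := by
  obtain ⟨g, hg, he⟩ := (h𝔤 x).1 hx s
  rw [← he]
  exact isPoint_coe hg

theorem isNilpotent_ext_smul {n : Type*} [Fintype n] [DecidableEq n] {x : Matrix n n ℂ}
    (hx : IsNilpotent x) (r : R) :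
    IsNilpotent (r • extM R x) := by
  obtain ⟨k, hk⟩ := hx
  exact ⟨k, by rw [smul_pow, ← extM_pow, hk, extM_zero, smul_zero]⟩

theorem map_exp_smul {n : Type*} [Fintype n] [DecidableEq n] {S : Type*} [CommRing S] [Algebra ℂ S]
    [Module ℚ (Matrix n n R)] [Module ℚ (Matrix n n S)]
    {x : Matrix n n ℂ} (hx : IsNilpotent x) (φ : R →ₐ[ℂ] S) (r : R) :
    (IsNilpotent.exp (r • extM R x)).map φ = IsNilpotent.exp (φ r • extM S x) := by
  have := IsNilpotent.map_exp (isNilpotent_ext_smul hx r) (RingHom.mapMatrix (φ : R →+* S))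
  refine this.trans (congrArg _ ?_)
  ext i j
  simp

/-- For nilpotent `x` the matrix `exp (s x)` is polynomial in `s` and lies in `G` for every complex
`s`. So it is a point over `ℂ[X]`, and `X` may be specialized to `r`. -/
theorem isPoint_exp_smul (h𝔤 : IsLieAlgebraOf 𝔤 G)
    [Module ℚ (Matrix (Fin N) (Fin N) R)] {x : Matrix (Fin N) (Fin N) ℂ} (hx : x ∈ 𝔤)
    (hn : IsNilpotent x) (r : R) : IsPoint G (IsNilpotent.exp (r • extM R x)) := by
  have h1 : IsPoint G (IsNilpotent.exp ((Polynomial.X : ℂ[X]) • extM ℂ[X] x)) := by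
    intro f hf
    refine Polynomial.funext fun s => ?_
    have := evalAt_map (Polynomial.aeval s) (IsNilpotent.exp ((Polynomial.X : ℂ[X]) • extM ℂ[X] x)) f
    rw [map_exp_smul hn, Polynomial.aeval_X] at this
    rw [Polynomial.eval_zero, ← Polynomial.coe_aeval_eq_eval, ← this]
    have h2 := isPoint_exp h𝔤 hx s f hf
    rwa [exp_eq_isNilpotent_exp (hn.smul s)] at h2
  have := h1.map (Polynomial.aeval r)
  rwa [map_exp_smul hn, Polynomial.aeval_X] at this

/-- Substitution of a unit for the variable of Laurent polynomials. -/
def laurentEval (t : Rˣ) : ℂ[T;T⁻¹] →ₐ[ℂ] R :=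
  { LaurentPolynomial.eval₂ (algebraMap ℂ R) t with
    commutes' := fun r => LaurentPolynomial.eval₂_C _ _ r }

theorem laurentEval_T (t : Rˣ) (k : ℤ) :
    laurentEval t (LaurentPolynomial.T k) = ((t ^ k : Rˣ) : R) :=
  LaurentPolynomial.eval₂_T _ _ k

theorem laurent_eq_zero {p : ℂ[T;T⁻¹]} (h : ∀ t : ℂˣ, laurentEval t p = 0) : p = 0 := by
  obtain ⟨k, q, hq⟩ := LaurentPolynomial.exists_T_pow p
  have hq0 : q = 0 := by
    refine Polynomial.eq_zero_of_infinite_isRoot q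
      ((Set.finite_singleton (0 : ℂ)).infinite_compl.mono fun s hs => ?_)
    have h1 := congrArg (laurentEval (Units.mk0 s hs)) hq
    rw [map_mul, h, zero_mul] at h1
    change LaurentPolynomial.eval₂ _ _ _ = _ at h1
    rw [LaurentPolynomial.eval₂_toLaurent] at h1
    simp only [Algebra.algebraMap_self, Polynomial.eval₂_id] at h1
    exact h1
  rw [hq0, map_zero] at hq
  have := congrArg (· * LaurentPolynomial.T (-(k : ℤ))) hq
  rw [mul_assoc, ← LaurentPolynomial.T_add, add_neg_cancel, LaurentPolynomial.T_zero, mul_one,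
    zero_mul] at this
  exact this.symm

theorem map_laurentEval_TUnit (t : Rˣ) : Units.map (laurentEval t : ℂ[T;T⁻¹] →* R) TUnit = t := by
  ext
  change laurentEval t (LaurentPolynomial.T 1) = t
  rw [laurentEval_T, zpow_one]

/-- For complex `t` this is `exp (log t • d μ)`. The equations of `G` are then Laurent polynomial
identities in a universal `t`, which may be specialized to any unit. -/
theorem isPoint_zPow (h𝔤 : IsLieAlgebraOf 𝔤 G) {d : ℕ} (hd : d ≠ 0)
    {μ : Matrix (Fin N) (Fin N) ℂ} (hμ : μ ∈ 𝔤) (hfrac : IsFractional d μ) (t : Rˣ) :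
    IsPoint G (zPow d μ t) := by
  have hc : ∀ t : ℂˣ, IsPoint G (zPow d μ t) := by
    intro t
    rw [← exp_smul_eq_zPow hd hfrac (Complex.log t) t (Complex.exp_log t.ne_zero).symm]
    exact isPoint_exp h𝔤 (𝔤.smul_mem _ hμ) _
  have hT : IsPoint G (zPow d μ TUnit) := by
    intro f hf
    refine laurent_eq_zero fun t => ?_
    rw [← evalAt_map, map_zPow, map_laurentEval_TUnit]
    exact hc t f hf
  have := hT.map (laurentEval t)
  rwa [map_zPow, map_laurentEval_TUnit] at this

end LieAlgebra

/-! ### Conjugation by points of an algebraic group -/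

section Conjugation

variable {N : ℕ} {G : Subgroup (GL (Fin N) ℂ)} {𝔤 : LieSubalgebra ℂ (Matrix (Fin N) (Fin N) ℂ)}
  {R : Type*} [CommRing R] [Algebra ℂ R]

/-- Conjugation by `M`, with inverse `M'`, maps `𝔤` to `𝔤 ⊗ R`. -/
def Normalizes (𝔤 : LieSubalgebra ℂ (Matrix (Fin N) (Fin N) ℂ)) (M M' : Matrix (Fin N) (Fin N) R) :
    Prop :=
  ∀ x ∈ 𝔤, ∀ φ : R →ₗ[ℂ] ℂ, (M * extM R x * M').map φ ∈ 𝔤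

/-- The extension of scalars of a linear functional on matrices. -/
def extFunctional (f : Matrix (Fin N) (Fin N) ℂ →ₗ[ℂ] ℂ) (M : Matrix (Fin N) (Fin N) R) : R :=
  ∑ i, ∑ j, f (Matrix.single i j 1) • M i j

theorem extFunctional_map {S : Type*} [CommRing S] [Algebra ℂ S]
    (f : Matrix (Fin N) (Fin N) ℂ →ₗ[ℂ] ℂ) (φ : R →ₗ[ℂ] S) (M : Matrix (Fin N) (Fin N) R) :
    extFunctional f (M.map φ) = φ (extFunctional f M) := by
  simp [extFunctional]

theorem extFunctional_self (f : Matrix (Fin N) (Fin N) ℂ →ₗ[ℂ] ℂ) (M : Matrix (Fin N) (Fin N) ℂ) :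
    extFunctional f M = f M := by
  conv_rhs => rw [Matrix.matrix_eq_sum_single M]
  simp only [extFunctional, map_sum]
  refine Finset.sum_congr rfl fun i _ => Finset.sum_congr rfl fun j _ => ?_
  rw [← mul_one (M i j), ← smul_eq_mul (M i j), ← Matrix.smul_single, map_smul, smul_eq_mul,
    smul_eq_mul, smul_eq_mul, mul_one, mul_comm]

theorem extFunctional_smul (f : Matrix (Fin N) (Fin N) ℂ →ₗ[ℂ] ℂ) (r : R)
    (M : Matrix (Fin N) (Fin N) R) : extFunctional f (r • M) = r * extFunctional f M := by
  simp [extFunctional, Finset.mul_sum]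

/-- Membership in `𝔤` is tested by the linear functionals that vanish on it, so it becomes a system
of equations that can be transferred between rings. -/
theorem mem_of_extFunctional {x : Matrix (Fin N) (Fin N) ℂ}
    (h : ∀ f : Matrix (Fin N) (Fin N) ℂ →ₗ[ℂ] ℂ, (∀ y ∈ 𝔤, f y = 0) → extFunctional f x = 0) :
    x ∈ 𝔤 := by
  by_contra hx
  obtain ⟨f, hf, hp⟩ := Submodule.exists_le_ker_of_notMem (p := 𝔤.toSubmodule) (v := x) hx
  exact hf (by rw [← extFunctional_self]; exact h f fun y hy => hp hy)

theorem adjugate_eq_det_smul {n : Type*} [Fintype n] [DecidableEq n] {M M' : Matrix n n R}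
    (h : M * M' = 1) : M.adjugate = M.det • M' := by
  rw [← mul_one M.adjugate, ← h, ← mul_assoc, Matrix.adjugate_mul, smul_mul_assoc, one_mul]

theorem isUnit_det_of_mul_eq_one {n : Type*} [Fintype n] [DecidableEq n] {M M' : Matrix n n R}
    (h : M * M' = 1) : IsUnit M.det :=
  IsUnit.of_mul_eq_one M'.det (by rw [← Matrix.det_mul, h, Matrix.det_one])

theorem genericM_conj_map {A A' : Matrix (Fin N) (Fin N) R} (hA : A * A' = 1)
    (x : Matrix (Fin N) (Fin N) ℂ) :
    (genericM N * extM _ x * (genericM N).adjugate).map (evalAt A) = A.det • (A * extM R x * A') ∧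
    (((genericM N).adjugate * extM _ x * genericM N).map (evalAt A) =
      A.det • (A' * extM R x * A)) := by
  have h1 : (genericM N).adjugate.map (evalAt A) = A.det • A' := by
    have := AlgHom.map_adjugate (evalAt A) (genericM N)
    rw [AlgHom.mapMatrix_apply, AlgHom.mapMatrix_apply, genericM_map_evalAt] at this
    rw [this, adjugate_eq_det_smul hA]
  simp only [Matrix.map_mul, h1, genericM_map_evalAt, extM_map, mul_smul_comm,
    smul_mul_assoc, and_self]

/-- For a functional `f` that vanishes on `𝔤`, `f (a x adj(a))` is a polynomial in `a` that vanishes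
on `G(ℂ)`, hence on `R`-points. The adjugate stands in for the inverse to keep the expression
polynomial, and the two differ by the unit `det a`. -/
theorem IsPoint.normalizes (h𝔤 : IsLieAlgebraOf 𝔤 G) {M M' : Matrix (Fin N) (Fin N) R}
    (hM : IsPoint G M) (h : M * M' = 1) : Normalizes 𝔤 M M' ∧ Normalizes 𝔤 M' M := by
  have key : ∀ x ∈ 𝔤, ∀ f : Matrix (Fin N) (Fin N) ℂ →ₗ[ℂ] ℂ, (∀ y ∈ 𝔤, f y = 0) →
      VanishesOn G (extFunctional f (genericM N * extM _ x * (genericM N).adjugate)) ∧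
      VanishesOn G (extFunctional f ((genericM N).adjugate * extM _ x * genericM N)) := by
    intro x hx f hf
    constructor
    all_goals
      intro a ha
      change evalAt (a : Matrix (Fin N) (Fin N) ℂ) _ = 0
      rw [← AlgHom.coe_toLinearMap, ← extFunctional_map, AlgHom.coe_toLinearMap]
    · rw [(genericM_conj_map (A' := (a⁻¹ : GL (Fin N) ℂ).1)
        (by rw [← Units.val_mul, mul_inv_cancel, Units.val_one]) x).1,
        extFunctional_smul, extFunctional_self]
      exact mul_eq_zero_of_right _ (hf _ (conj_mem_lieAlgebra h𝔤 ha hx))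
    · rw [(genericM_conj_map (A' := (a⁻¹ : GL (Fin N) ℂ).1)
        (by rw [← Units.val_mul, mul_inv_cancel, Units.val_one]) x).2,
        extFunctional_smul, extFunctional_self]
      have := conj_mem_lieAlgebra h𝔤 (G.inv_mem ha) hx
      rw [inv_inv] at this
      exact mul_eq_zero_of_right _ (hf _ this)
  have hu := isUnit_det_of_mul_eq_one h
  constructor
  all_goals
    intro x hx φ
    refine mem_of_extFunctional fun f hf => ?_
    rw [extFunctional_map]
    refine (congrArg φ ?_).trans (map_zero φ)
    rw [← hu.mul_right_eq_zero, ← extFunctional_smul]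
  · rw [← (genericM_conj_map h x).1, ← AlgHom.coe_toLinearMap, extFunctional_map]
    exact hM _ (key x hx f hf).1
  · rw [← (genericM_conj_map h x).2, ← AlgHom.coe_toLinearMap, extFunctional_map]
    exact hM _ (key x hx f hf).2

/-- The first order Taylor expansion of a power series. -/
def toDual : PowerSeries ℂ →ₐ[ℂ] DualNumber ℂ where
  toFun p := TrivSqZeroExt.inl (PowerSeries.constantCoeff p) +
    TrivSqZeroExt.inr (PowerSeries.coeff 1 p)
  map_one' := by
    ext <;> simp [PowerSeries.coeff_one]
  map_zero' := by
    ext <;> simp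
  map_add' p q := by
    ext <;> simp
  map_mul' p q := by
    ext
    · simp
    · simp [PowerSeries.coeff_mul, Finset.Nat.antidiagonal_succ]
  commutes' c := by
    ext
    · simp [TrivSqZeroExt.algebraMap_eq_inl]
    · simp [TrivSqZeroExt.algebraMap_eq_inl]

/-- Truncation modulo the square of the variable turns `B` into the dual number point `1 + ε B₁`. -/
theorem coeff_one_mem (hG : IsAlgebraicGroup G) (h𝔤 : IsLieAlgebraOf 𝔤 G)
    {B : Matrix (Fin N) (Fin N) (PowerSeries ℂ)} (hB : IsPoint G B)
    (h1 : B.map (PowerSeries.constantCoeff (R := ℂ)) = 1) : B.map (PowerSeries.coeff 1) ∈ 𝔤 := by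
  apply mem_lieAlgebra_of_isPoint_dualMatrix hG h𝔤
  convert hB.map toDual using 1
  rw [← h1]
  ext i j
  · simp [toDual, fst_dualMatrix]
  · simp [toDual, snd_dualMatrix]

end Conjugation

/-! ### Identities in a Lie algebra graded by the weights -1, 0, 1. -/

section MinusculeIdentities

variable {L : Type*} [LieRing L] [LieAlgebra ℂ L] {T : L}

/-- The weight `1` component, for an element with `ad T ^ 3 = ad T`. -/
def plusPart (T x : L) : L := (1 / 2 : ℂ) • (⁅T, ⁅T, x⁆⁆ + ⁅T, x⁆)

theorem lie_plusPart (hT : ∀ x : L, ⁅T, ⁅T, ⁅T, x⁆⁆⁆ = ⁅T, x⁆) (x : L) :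
    ⁅T, plusPart T x⁆ = plusPart T x := by
  rw [plusPart, lie_smul, lie_add, hT, add_comm]

theorem eq_zero_of_lie_eq_smul (hT : ∀ x : L, ⁅T, ⁅T, ⁅T, x⁆⁆⁆ = ⁅T, x⁆) {x : L} {a : ℂ}
    (h : ⁅T, x⁆ = a • x) (ha : a ^ 3 ≠ a) : x = 0 := by
  have h1 := hT x
  simp only [h, lie_smul, smul_smul] at h1
  have h2 : (a ^ 3 - a) • x = 0 := by rw [sub_smul, ← h1]; ring_nf; simp
  exact (smul_eq_zero.1 h2).resolve_left (sub_ne_zero.2 ha)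

theorem lie_lie_of_weights {x y : L} {a b : ℂ} (hx : ⁅T, x⁆ = a • x) (hy : ⁅T, y⁆ = b • y) :
    ⁅T, ⁅x, y⁆⁆ = (a + b) • ⁅x, y⁆ := by
  rw [leibniz_lie, hx, hy, smul_lie, lie_smul, ← add_smul]

theorem plusPart_of_weight_zero {x : L} (h : ⁅T, x⁆ = 0) : plusPart T x = 0 := by
  simp [plusPart, h]

theorem plusPart_of_weight_neg {x : L} (h : ⁅T, x⁆ = -x) : plusPart T x = 0 := by
  simp [plusPart, h]

theorem plusPart_of_weight_one {x : L} (h : ⁅T, x⁆ = x) : plusPart T x = x := by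
  rw [plusPart, h, h, ← two_smul ℂ x, smul_smul]
  norm_num

theorem plusPart_add (x y : L) : plusPart T (x + y) = plusPart T x + plusPart T y := by
  simp only [plusPart, lie_add, smul_add]
  abel

theorem plusPart_neg (x : L) : plusPart T (-x) = -plusPart T x := by
  simp only [plusPart, lie_neg, smul_add, smul_neg]
  abel

theorem plusPart_lie_self (hT : ∀ x : L, ⁅T, ⁅T, ⁅T, x⁆⁆⁆ = ⁅T, x⁆) (x : L) :
    plusPart T ⁅T, x⁆ = plusPart T x := by
  rw [plusPart, hT, plusPart, add_comm]

/-- Decomposition of `x` into `x₊ + x₀ + x₋`. -/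
theorem exists_weights (hT : ∀ x : L, ⁅T, ⁅T, ⁅T, x⁆⁆⁆ = ⁅T, x⁆) (x : L) :
    ∃ x0 xm : L, x = plusPart T x + x0 + xm ∧ ⁅T, x0⁆ = 0 ∧ ⁅T, xm⁆ = -xm := by
  refine ⟨x - ⁅T, ⁅T, x⁆⁆, (1 / 2 : ℂ) • (⁅T, ⁅T, x⁆⁆ - ⁅T, x⁆), ?_, ?_, ?_⟩
  · rw [plusPart]; module
  · rw [lie_sub, hT, sub_self]
  · rw [lie_smul, lie_sub, hT]; module

variable (hT : ∀ x : L, ⁅T, ⁅T, ⁅T, x⁆⁆⁆ = ⁅T, x⁆) {y : L} (hy : ⁅T, y⁆ = -y) (β : L)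
include hT hy

/-- For `y` of weight `-1`, the weight decomposition of `[β, y]`. -/
theorem exists_lie_eq : ∃ w : L, ⁅β, y⁆ = ⁅plusPart T β, y⁆ + w ∧ ⁅T, ⁅plusPart T β, y⁆⁆ = 0 ∧
    ⁅T, w⁆ = -w := by
  obtain ⟨x0, xm, hx, h0, hm⟩ := exists_weights hT β
  have hp := lie_plusPart hT β
  have h1 : ⁅xm, y⁆ = 0 := eq_zero_of_lie_eq_smul hT (a := -2)
    (by rw [leibniz_lie, hm, hy, neg_lie, lie_neg]; module) (by norm_num)
  refine ⟨⁅x0, y⁆, ?_, ?_, ?_⟩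
  · conv_lhs => rw [hx]
    rw [add_lie, add_lie, h1, add_zero]
  · rw [leibniz_lie, hp, hy, lie_neg, add_neg_cancel]
  · rw [leibniz_lie, h0, hy, zero_lie, lie_neg, zero_add]

theorem plusPart_lie_eq_zero : plusPart T ⁅β, y⁆ = 0 := by
  obtain ⟨w, h, h0, hw⟩ := exists_lie_eq hT hy β
  rw [h, plusPart_add, plusPart_of_weight_zero h0, plusPart_of_weight_neg hw, add_zero]

/-- `1 - (ad T)²` projects to weight 0. Only the weight 1 part of `β` can bring `y` from weight -1
to weight 0. -/
theorem lie_sub_lie_lie_eq : ⁅β, y⁆ - ⁅T, ⁅T, ⁅β, y⁆⁆⁆ = ⁅plusPart T β, y⁆ := by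
  obtain ⟨w, h, h0, hw⟩ := exists_lie_eq hT hy β
  rw [h, lie_add, h0, lie_add, lie_zero, hw, lie_neg, hw]
  abel

/-- For a loop `D = 1 + β w + ...`, the hypothesis is the coefficient of `w²` in `[D T D⁻¹, D y D⁻¹]
= -D y D⁻¹`. In weight 1 the unknown `q` drops out, because `[q, y]` has no such part, and `[T, Q]`
contributes the same as `Q`. So `2 Q₊ = [β₊, [β₊, y]]`: the second order term is determined by `β`.
-/
theorem plusPart_second_order {Q q : L} (h : ⁅T, Q⁆ + ⁅⁅β, T⁆, ⁅β, y⁆⁆ + ⁅q, y⁆ = -Q) :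
    plusPart T Q = (1 / 2 : ℂ) • ⁅plusPart T β, ⁅plusPart T β, y⁆⁆ := by
  obtain ⟨w, hb, h0, hw⟩ := exists_lie_eq hT hy β
  have hp := lie_plusPart hT β
  have h1 : plusPart T ⁅⁅β, T⁆, ⁅β, y⁆⁆ = -⁅plusPart T β, ⁅plusPart T β, y⁆⁆ := by
    obtain ⟨x0, xm, hx, hx0, hxm⟩ := exists_weights hT β
    have e1 : ⁅β, T⁆ = -plusPart T β + xm := by
      rw [← lie_skew]
      conv_lhs => rw [hx, lie_add, lie_add, hp, hx0, hxm]
      abel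
    rw [e1, hb, lie_add, add_lie, add_lie, neg_lie, neg_lie, plusPart_add, plusPart_add,
      plusPart_add, plusPart_neg, plusPart_neg]
    rw [plusPart_of_weight_one (x := ⁅plusPart T β, ⁅plusPart T β, y⁆⁆)
      (by rw [leibniz_lie, hp, h0, lie_zero, add_zero]),
      plusPart_of_weight_neg (x := ⁅xm, ⁅plusPart T β, y⁆⁆)
      (by rw [leibniz_lie, hxm, h0, lie_zero, add_zero, neg_lie]),
      plusPart_of_weight_zero (x := ⁅plusPart T β, w⁆)
      (by rw [leibniz_lie, hp, hw, lie_neg, add_neg_cancel]), plusPart_lie_eq_zero hT hw xm]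
    abel
  have h2 := congrArg (plusPart T) h
  rw [plusPart_add, plusPart_add, plusPart_lie_self hT, h1, plusPart_lie_eq_zero hT hy q,
    plusPart_neg, add_zero] at h2
  have h3 : (2 : ℂ) • plusPart T Q = ⁅plusPart T β, ⁅plusPart T β, y⁆⁆ := by
    rw [two_smul]
    nth_rewrite 1 [← neg_eq_iff_eq_neg.2 h2]
    abel
  rw [← h3, smul_smul]
  norm_num

end MinusculeIdentities

/-! ### Laurent series and Laurent polynomials -/

section Laurent

variable {d : ℕ} [NeZero d]

/-- `ofPower` as an algebra homomorphism. -/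
def ofPowerAlg (d : ℕ) [NeZero d] : PowerSeries ℂ →ₐ[ℂ] LaurentSeries ℂ :=
  { ofPower d with
    commutes' := fun c => by
      change HahnSeries.ofPowerSeries ℤ ℂ (PowerSeries.expand d (NeZero.ne d) (algebraMap _ _ c)) = _
      rw [AlgHom.commutes]
      rfl }

theorem coe_ofPowerAlg : ⇑(ofPowerAlg d) = ofPower d := rfl

/-- `ofPolyInv` as an algebra homomorphism. -/
def ofPolyInvAlg (d : ℕ) : ℂ[X] →ₐ[ℂ] LaurentSeries ℂ :=
  Polynomial.aeval ((tUnit ^ (-(d : ℤ)) : (LaurentSeries ℂ)ˣ) : LaurentSeries ℂ)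

theorem coe_ofPolyInvAlg : ⇑(ofPolyInvAlg d) = ofPolyInv d := rfl

theorem algebraMap_laurentSeries (c : ℂ) :
    algebraMap ℂ (LaurentSeries ℂ) c = HahnSeries.C c := by
  rw [HahnSeries.algebraMap_apply']
  exact HahnSeries.ofPowerSeries_C c

theorem coe_tUnit_zpow (k : ℤ) :
    ((tUnit ^ k : (LaurentSeries ℂ)ˣ) : LaurentSeries ℂ) = HahnSeries.single k 1 := by
  have hn : ∀ k : ℕ, ((tUnit ^ k : (LaurentSeries ℂ)ˣ) : LaurentSeries ℂ) =
      HahnSeries.single (k : ℤ) 1 := by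
    intro k
    rw [Units.val_pow_eq_pow_val]
    change (HahnSeries.single (1 : ℤ) (1 : ℂ)) ^ k = _
    rw [HahnSeries.single_pow]
    simp
  obtain ⟨k, rfl | rfl⟩ := k.eq_nat_or_neg
  · rw [zpow_natCast, hn]
  · rw [zpow_neg, zpow_natCast, Units.inv_eq_of_mul_eq_one_right]
    rw [hn, HahnSeries.single_mul_single]
    simp

theorem ofPower_X : ofPower d PowerSeries.X = ((tUnit ^ (d : ℤ) : (LaurentSeries ℂ)ˣ) : LaurentSeries ℂ) := by
  change HahnSeries.ofPowerSeries ℤ ℂ (PowerSeries.expand d (NeZero.ne d) _) = _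
  rw [PowerSeries.expand_X, map_pow, HahnSeries.ofPowerSeries_X, coe_tUnit_zpow,
    HahnSeries.single_pow]
  simp

theorem coeff_ofPower_natCast (p : PowerSeries ℂ) (k : ℕ) :
    (ofPower d p).coeff ((d * k : ℕ) : ℤ) = PowerSeries.coeff k p := by
  change (HahnSeries.ofPowerSeries ℤ ℂ (PowerSeries.expand d (NeZero.ne d) p)).coeff _ = _
  rw [HahnSeries.ofPowerSeries_apply_coeff, PowerSeries.coeff_expand_mul]

theorem coeff_ofPower_zero (p : PowerSeries ℂ) :
    (ofPower d p).coeff 0 = PowerSeries.constantCoeff p := by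
  simpa using coeff_ofPower_natCast (d := d) p 0

theorem coeff_ofPower_of_neg (p : PowerSeries ℂ) {k : ℤ} (hk : k < 0) :
    (ofPower d p).coeff k = 0 := by
  change (HahnSeries.ofPowerSeries ℤ ℂ (PowerSeries.expand d (NeZero.ne d) p)).coeff _ = _
  rw [HahnSeries.ofPowerSeries_apply]
  refine HahnSeries.embDomain_of_notMem_range ?_
  rintro ⟨m, hm⟩
  have : ((m : ℕ) : ℤ) = k := hm
  omega

theorem coeff_tUnit_zpow_mul (a k : ℤ) (p : LaurentSeries ℂ) :
    (((tUnit ^ a : (LaurentSeries ℂ)ˣ) : LaurentSeries ℂ) * p).coeff k = p.coeff (k - a) := by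
  rw [coe_tUnit_zpow, HahnSeries.coeff_single_mul, one_mul]

/-- `expandZero` as an algebra homomorphism. -/
def expandZeroAlg : ℂ[T;T⁻¹] →ₐ[ℂ] LaurentSeries ℂ := laurentEval tUnit

theorem coe_expandZeroAlg : ⇑expandZeroAlg = expandZero := rfl

/-- `expandInfty` as an algebra homomorphism. -/
def expandInftyAlg : ℂ[T;T⁻¹] →ₐ[ℂ] LaurentSeries ℂ := laurentEval tUnit⁻¹

theorem coe_expandInftyAlg : ⇑expandInftyAlg = expandInfty := rfl

theorem laurentEval_C_mul_T {R : Type*} [CommRing R] [Algebra ℂ R] (t : Rˣ) (a : ℂ) (m : ℤ) :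
    laurentEval t (LaurentPolynomial.C a * LaurentPolynomial.T m) =
      algebraMap ℂ R a * ((t ^ m : Rˣ) : R) := by
  rw [← LaurentPolynomial.smul_eq_C_mul, map_smul, laurentEval_T, Algebra.smul_def]

theorem coeff_C_mul_T (a : ℂ) (m k : ℤ) :
    (LaurentPolynomial.C a * LaurentPolynomial.T m : ℂ[T;T⁻¹]).coeff k = if m = k then a else 0 := by
  rw [← LaurentPolynomial.smul_eq_C_mul]
  simp

theorem coeff_algebraMap_mul_tUnit_zpow (a : ℂ) (m k : ℤ) :
    (algebraMap ℂ (LaurentSeries ℂ) a * ((tUnit ^ m : (LaurentSeries ℂ)ˣ) : LaurentSeries ℂ)).coeff k =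
      if m = k then a else 0 := by
  rw [mul_comm, coeff_tUnit_zpow_mul, algebraMap_laurentSeries, HahnSeries.C_apply]
  split_ifs with h
  · rw [h, sub_self, HahnSeries.coeff_single_same]
  · rw [HahnSeries.coeff_single_of_ne (by omega)]

theorem coeff_expandZero (p : ℂ[T;T⁻¹]) (k : ℤ) : (expandZero p).coeff k = p.coeff k := by
  induction p using LaurentPolynomial.induction_on' with
  | add p q hp hq => simp [hp, hq]
  | C_mul_T m a =>
    rw [← coe_expandZeroAlg, expandZeroAlg, laurentEval_C_mul_T, coeff_C_mul_T,
      coeff_algebraMap_mul_tUnit_zpow]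

theorem coeff_expandInfty (p : ℂ[T;T⁻¹]) (k : ℤ) : (expandInfty p).coeff k = p.coeff (-k) := by
  induction p using LaurentPolynomial.induction_on' with
  | add p q hp hq => simp [hp, hq]
  | C_mul_T m a =>
    rw [← coe_expandInftyAlg, expandInftyAlg, laurentEval_C_mul_T, coeff_C_mul_T, inv_zpow',
      coeff_algebraMap_mul_tUnit_zpow]
    exact if_congr (by omega) rfl rfl

theorem expandZero_injective : Function.Injective expandZero := by
  intro p q h
  refine LaurentPolynomial.ext fun k => ?_
  rw [← coeff_expandZero, h, coeff_expandZero]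

/-- A Laurent polynomial with a pole of order at most `a` at `0` and a zero of order at least `a`
at `∞` is a multiple of `t ^ (-a)`. -/
theorem laurent_eq_of_expand {p : ℂ[T;T⁻¹]} {a : ℤ} {q q' : PowerSeries ℂ}
    (h : expandZero p = ((tUnit ^ (-a) : (LaurentSeries ℂ)ˣ) : LaurentSeries ℂ) * ofPower d q)
    (h' : expandInfty p = ((tUnit ^ a : (LaurentSeries ℂ)ˣ) : LaurentSeries ℂ) * ofPower d q') :
    p = LaurentPolynomial.C (PowerSeries.constantCoeff q') * LaurentPolynomial.T (-a) := by
  refine LaurentPolynomial.ext fun k => ?_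
  rw [coeff_C_mul_T]
  split_ifs with hk
  · have := congrArg (fun f => HahnSeries.coeff f a) h'
    simp only [coeff_expandInfty, coeff_tUnit_zpow_mul, sub_self, coeff_ofPower_zero] at this
    rw [← hk, this]
  · rcases lt_or_gt_of_ne hk with hk | hk
    · have := congrArg (fun f => HahnSeries.coeff f (-k)) h'
      simp only [coeff_expandInfty, coeff_tUnit_zpow_mul] at this
      rwa [coeff_ofPower_of_neg _ (by omega), neg_neg] at this
    · have := congrArg (fun f => HahnSeries.coeff f k) h
      simp only [coeff_expandZero, coeff_tUnit_zpow_mul] at this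
      rwa [coeff_ofPower_of_neg _ (by omega)] at this

end Laurent

section WeightParts

variable {n : Type*} [Fintype n] [DecidableEq n] {R : Type*} [CommRing R] [Algebra ℂ R]

/-- The commutator with a constant matrix. -/
def adM (T : Matrix n n ℂ) : Matrix n n R →ₗ[ℂ] Matrix n n R :=
  LinearMap.mulLeft ℂ (extM R T) - LinearMap.mulRight ℂ (extM R T)

theorem adM_apply (T : Matrix n n ℂ) (M : Matrix n n R) :
    adM T M = extM R T * M - M * extM R T := rfl

theorem adM_map_linear (T : Matrix n n ℂ) (φ : R →ₗ[ℂ] ℂ) (M : Matrix n n R) :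
    (adM T M).map φ = ⁅T, M.map φ⁆ := by
  rw [Ring.lie_def]
  ext i j
  simp [adM_apply, Matrix.mul_apply, ← Algebra.smul_def, mul_comm _ (algebraMap ℂ R _)]
  simp [mul_comm]

theorem HasWeight.of_adM {T : Matrix n n ℂ} {a : ℂ} {M : Matrix n n R} (h : adM T M = a • M) :
    HasWeight T a M := h

end WeightParts

/-! ### Coefficients of products of matrices of power series. -/

section PowerSeriesMatrices

variable {n : Type*} [Fintype n] [DecidableEq n]

theorem map_coeff_ext {M M' : Matrix n n (PowerSeries ℂ)}
    (h : ∀ k, M.map (PowerSeries.coeff k) = M'.map (PowerSeries.coeff k)) : M = M' := by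
  ext i j k
  exact congrFun (congrFun (h k) i) j

theorem map_coeff_mul (M M' : Matrix n n (PowerSeries ℂ)) (k : ℕ) :
    (M * M').map (PowerSeries.coeff k) = ∑ p ∈ Finset.HasAntidiagonal.antidiagonal k,
      M.map (PowerSeries.coeff p.1) * M'.map (PowerSeries.coeff p.2) := by
  ext i j
  simp only [Matrix.map_apply, Matrix.mul_apply, map_sum, PowerSeries.coeff_mul, Matrix.sum_apply]
  exact Finset.sum_comm

theorem map_coeff_extM (x : Matrix n n ℂ) (k : ℕ) :
    (extM (PowerSeries ℂ) x).map (PowerSeries.coeff k) = if k = 0 then x else 0 := by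
  ext i j
  simp only [Matrix.map_apply]
  change PowerSeries.coeff k (PowerSeries.C (x i j)) = _
  rw [PowerSeries.coeff_C]
  split_ifs <;> rfl

theorem map_coeff_zero_mul (M M' : Matrix n n (PowerSeries ℂ)) :
    (M * M').map (PowerSeries.coeff 0) =
      M.map (PowerSeries.coeff 0) * M'.map (PowerSeries.coeff 0) := by
  rw [map_coeff_mul, Finset.Nat.antidiagonal_zero, Finset.sum_singleton]

theorem map_coeff_one_mul (M M' : Matrix n n (PowerSeries ℂ)) :
    (M * M').map (PowerSeries.coeff 1) =
      M.map (PowerSeries.coeff 0) * M'.map (PowerSeries.coeff 1) +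
      M.map (PowerSeries.coeff 1) * M'.map (PowerSeries.coeff 0) := by
  rw [map_coeff_mul, Finset.Nat.sum_antidiagonal_eq_sum_range_succ
    fun i j => M.map (PowerSeries.coeff i) * M'.map (PowerSeries.coeff j)]
  simp only [Finset.sum_range_succ, Finset.sum_range_zero, zero_add, Nat.sub_zero, Nat.sub_self]

theorem map_coeff_two_mul (M M' : Matrix n n (PowerSeries ℂ)) :
    (M * M').map (PowerSeries.coeff 2) =
      M.map (PowerSeries.coeff 0) * M'.map (PowerSeries.coeff 2) +
      M.map (PowerSeries.coeff 1) * M'.map (PowerSeries.coeff 1) +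
      M.map (PowerSeries.coeff 2) * M'.map (PowerSeries.coeff 0) := by
  rw [map_coeff_mul, Finset.Nat.sum_antidiagonal_eq_sum_range_succ
    fun i j => M.map (PowerSeries.coeff i) * M'.map (PowerSeries.coeff j)]
  simp only [Finset.sum_range_succ, Finset.sum_range_zero, zero_add, Nat.sub_zero, Nat.sub_self,
    Nat.reduceSub]

theorem map_coeff_zero_extM (x : Matrix n n ℂ) :
    (extM (PowerSeries ℂ) x).map (PowerSeries.coeff 0) = x := by
  rw [map_coeff_extM, if_pos rfl]

theorem map_coeff_one_extM (x : Matrix n n ℂ) :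
    (extM (PowerSeries ℂ) x).map (PowerSeries.coeff 1) = 0 := by
  rw [map_coeff_extM, if_neg one_ne_zero]

theorem exists_eq_X_pow_smul (M : Matrix n n (PowerSeries ℂ)) (m : ℕ)
    (h : ∀ k < m, M.map (PowerSeries.coeff k) = 0) : ∃ M' : Matrix n n (PowerSeries ℂ),
      M = (PowerSeries.X ^ m : PowerSeries ℂ) • M' ∧
      ∀ k, M'.map (PowerSeries.coeff k) = M.map (PowerSeries.coeff (k + m)) := by
  refine ⟨M.map fun p => PowerSeries.mk fun k => PowerSeries.coeff (k + m) p, ?_, ?_⟩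
  · ext i j k
    rw [Matrix.smul_apply, smul_eq_mul, PowerSeries.coeff_X_pow_mul', Matrix.map_apply,
      PowerSeries.coeff_mk]
    split_ifs with hk
    · rw [Nat.sub_add_cancel hk]
    · exact congrFun (congrFun (h k (by omega)) i) j
  · intro k
    ext i j
    simp

end PowerSeriesMatrices

/-! ### Conjugation of charge `-1` elements by elements of the phase space -/

section ConjugationTheorem

variable {N : ℕ} {𝔤 : LieSubalgebra ℂ (Matrix (Fin N) (Fin N) ℂ)} {d : ℕ} [NeZero d]
  {T : Matrix (Fin N) (Fin N) ℂ}

section Parts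

variable {R : Type*} [CommRing R] [Algebra ℂ R]

/-- The weight `1` part of a matrix on which `ad T ^ 3 = ad T`. -/
def partPlus (T : Matrix (Fin N) (Fin N) ℂ) (M : Matrix (Fin N) (Fin N) R) :
    Matrix (Fin N) (Fin N) R := (1 / 2 : ℂ) • (adM T (adM T M) + adM T M)

/-- The weight `-1` part of a matrix on which `ad T ^ 3 = ad T`. -/
def partMinus (T : Matrix (Fin N) (Fin N) ℂ) (M : Matrix (Fin N) (Fin N) R) :
    Matrix (Fin N) (Fin N) R := (1 / 2 : ℂ) • (adM T (adM T M) - adM T M)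

/-- The weight `0` part of a matrix on which `ad T ^ 3 = ad T`. -/
def partZero (T : Matrix (Fin N) (Fin N) ℂ) (M : Matrix (Fin N) (Fin N) R) :
    Matrix (Fin N) (Fin N) R := M - adM T (adM T M)

theorem eq_parts (M : Matrix (Fin N) (Fin N) R) :
    M = partPlus T M + partZero T M + partMinus T M := by
  rw [partPlus, partMinus, partZero]
  module

variable {M : Matrix (Fin N) (Fin N) R} (hM : adM T (adM T (adM T M)) = adM T M)
include hM

theorem hasWeight_partPlus : HasWeight T ((1 : ℤ) : ℂ) (partPlus T M) := by
  refine HasWeight.of_adM ?_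
  rw [partPlus, map_smul, map_add, hM]
  push_cast
  module

theorem hasWeight_partMinus : HasWeight T ((-1 : ℤ) : ℂ) (partMinus T M) := by
  refine HasWeight.of_adM ?_
  rw [partMinus, map_smul, map_sub, hM]
  push_cast
  module

theorem hasWeight_partZero : HasWeight T ((0 : ℤ) : ℂ) (partZero T M) := by
  refine HasWeight.of_adM ?_
  rw [partZero, map_sub, hM]
  simp

end Parts

theorem partPlus_map (φ : PowerSeries ℂ →ₗ[ℂ] ℂ) (M : Matrix (Fin N) (Fin N) (PowerSeries ℂ)) :
    (partPlus T M).map φ = plusPart T (M.map φ) := by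
  rw [plusPart, ← adM_map_linear, ← adM_map_linear, partPlus]
  ext i j
  simp [mul_add]

theorem partMinus_map (φ : PowerSeries ℂ →ₗ[ℂ] ℂ) (M : Matrix (Fin N) (Fin N) (PowerSeries ℂ)) :
    (partMinus T M).map φ = (1 / 2 : ℂ) • (⁅T, ⁅T, M.map φ⁆⁆ - ⁅T, M.map φ⁆) := by
  rw [← adM_map_linear, ← adM_map_linear, partMinus]
  ext i j
  simp [mul_sub]

theorem partZero_map (φ : PowerSeries ℂ →ₗ[ℂ] ℂ) (M : Matrix (Fin N) (Fin N) (PowerSeries ℂ)) :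
    (partZero T M).map φ = M.map φ - ⁅T, ⁅T, M.map φ⁆⁆ := by
  rw [← adM_map_linear, ← adM_map_linear, partZero]
  ext i j
  simp

theorem adM_cube {M : Matrix (Fin N) (Fin N) (PowerSeries ℂ)}
    (hT : ∀ x ∈ 𝔤, ⁅T, ⁅T, ⁅T, x⁆⁆⁆ = ⁅T, x⁆)
    (h : ∀ k, M.map (PowerSeries.coeff k) ∈ 𝔤) : adM T (adM T (adM T M)) = adM T M := by
  refine map_coeff_ext fun k => ?_
  simp only [adM_map_linear, hT _ (h k)]

section Generic

variable {R : Type*} [CommRing R] [Algebra ℂ R]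

theorem smul_map_algHom (φ : PowerSeries ℂ →ₐ[ℂ] R) (p : PowerSeries ℂ)
    (M : Matrix (Fin N) (Fin N) (PowerSeries ℂ)) : (p • M).map φ = φ p • M.map φ := by
  ext i j
  simp

/-- Conjugation by `Z` multiplies a matrix of weight `k` by `z ^ k`. -/
def IsZConj (d : ℕ) (T : Matrix (Fin N) (Fin N) ℂ) (s : Rˣ) (Z Z' : Matrix (Fin N) (Fin N) R) :
    Prop :=
  ∀ (k : ℤ) (M : Matrix (Fin N) (Fin N) R), HasWeight T k M →
    Z * M * Z' = ((s ^ (d * k : ℤ) : Rˣ) : R) • M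

theorem IsZConj.zPow (hT : IsFractional d T) (s : Rˣ) :
    IsZConj d T s (zPow d T s) (zPow d T s⁻¹) := by
  intro k M hM
  rw [hM.zPow_mul hT, smul_mul_assoc, mul_assoc, zPow_mul_zPow_inv hT, mul_one]

variable {s : Rˣ} {Z Z' : Matrix (Fin N) (Fin N) R}

/-- Replacing `T` by `-T` and `s` by `s⁻¹` describes the same conjugation. This symmetry lets the
statements about `𝔫⁻` and `L` be applied to `𝔫⁺` and `L⁻¹`. -/
theorem IsZConj.neg (h : IsZConj d T s Z Z') : IsZConj d (-T) s⁻¹ Z Z' := by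
  intro k M hM
  have : HasWeight T ((-k : ℤ) : ℂ) M := by
    rw [HasWeight, extM_neg] at hM
    rw [HasWeight]
    push_cast
    rw [neg_smul, ← hM]
    noncomm_ring
  rw [h _ _ this, inv_zpow', mul_neg]

variable {φ : PowerSeries ℂ →ₐ[ℂ] R} {M : Matrix (Fin N) (Fin N) (PowerSeries ℂ)}

theorem IsZConj.parts (h : IsZConj d T s Z Z') (hM : adM T (adM T (adM T M)) = adM T M) :
    Z * M.map φ * Z' = ((s ^ (d : ℤ) : Rˣ) : R) • (partPlus T M).map φ + (partZero T M).map φ +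
      ((s ^ (-d : ℤ) : Rˣ) : R) • (partMinus T M).map φ := by
  have e : M.map φ = (partPlus T M).map φ + (partZero T M).map φ + (partMinus T M).map φ := by
    conv_lhs => rw [eq_parts (T := T) M]
    ext i j
    simp
  rw [e, mul_add, mul_add, add_mul, add_mul, h 1 _ ((hasWeight_partPlus hM).map φ),
    h 0 _ ((hasWeight_partZero hM).map φ), h (-1) _ ((hasWeight_partMinus hM).map φ)]
  simp

theorem IsZConj.exists_eq_smul (h : IsZConj d T s Z Z') (hφ : φ PowerSeries.X = (s : R) ^ d)
    (hM : adM T (adM T (adM T M)) = adM T M) : ∃ Q : Matrix (Fin N) (Fin N) (PowerSeries ℂ),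
      Z * M.map φ * Z' = ((s ^ (-d : ℤ) : Rˣ) : R) • Q.map φ := by
  -- With `z = s ^ d`, the parts of weight 1, 0, -1 acquire the factors `z`, `1`, `z⁻¹`. Taking out
  -- `z⁻¹` leaves `z²`, `z` and `1`.
  refine ⟨(PowerSeries.X ^ 2 : PowerSeries ℂ) • partPlus T M +
    (PowerSeries.X : PowerSeries ℂ) • partZero T M + partMinus T M, ?_⟩
  have e1 : ((s ^ (-d : ℤ) : Rˣ) : R) * s ^ d = 1 := by
    rw [← Units.val_pow_eq_pow_val, ← Units.val_mul, zpow_neg, zpow_natCast, inv_mul_cancel,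
      Units.val_one]
  have e2 : ((s ^ (-d : ℤ) : Rˣ) : R) * (s ^ d) ^ 2 = ((s ^ (d : ℤ) : Rˣ) : R) := by
    rw [sq, ← mul_assoc, e1, one_mul, zpow_natCast, Units.val_pow_eq_pow_val]
  rw [h.parts hM, Matrix.map_add _ (map_add _), Matrix.map_add _ (map_add _), smul_map_algHom,
    smul_map_algHom, smul_add, smul_add, smul_smul, smul_smul, map_pow, hφ, e1, e2, one_smul]

/-- With `w = s ^ d`, conjugation now multiplies the parts of weight 1, 0, -1 by `w⁻¹`, `1`, `w`.
The hypotheses make the weight 1 part vanish to order 2 and the weight 0 part to order 1. So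
everything is divisible by `w`, and the leading coefficient collects the coefficients of order 2, 1,
0 respectively. -/
theorem IsZConj.exists_eq_smul_infty (h : IsZConj d T s⁻¹ Z Z')
    (hφ : φ PowerSeries.X = (s : R) ^ d) (hM : adM T (adM T (adM T M)) = adM T M)
    (h0 : plusPart T (M.map (PowerSeries.coeff 0)) = 0)
    (h1 : plusPart T (M.map (PowerSeries.coeff 1)) = 0)
    (h0' : M.map (PowerSeries.coeff 0) - ⁅T, ⁅T, M.map (PowerSeries.coeff 0)⁆⁆ = 0) :
    ∃ Q : Matrix (Fin N) (Fin N) (PowerSeries ℂ),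
      Z * M.map φ * Z' = ((s ^ (d : ℤ) : Rˣ) : R) • Q.map φ ∧
      Q.map (PowerSeries.coeff 0) = plusPart T (M.map (PowerSeries.coeff 2)) +
        (M.map (PowerSeries.coeff 1) - ⁅T, ⁅T, M.map (PowerSeries.coeff 1)⁆⁆) +
        (partMinus T M).map (PowerSeries.coeff 0) := by
  obtain ⟨P, hP, hPc⟩ := exists_eq_X_pow_smul (partPlus T M) 2 (by
    intro k hk
    rw [partPlus_map]
    interval_cases k
    exacts [h0, h1])
  obtain ⟨P', hP', hPc'⟩ := exists_eq_X_pow_smul (partZero T M) 1 (by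
    intro k hk
    rw [partZero_map]
    interval_cases k
    exact h0')
  have e1 : ((s⁻¹ ^ (d : ℤ) : Rˣ) : R) * (s ^ d) ^ 2 = ((s ^ (d : ℤ) : Rˣ) : R) := by
    rw [sq, ← mul_assoc, ← Units.val_pow_eq_pow_val, ← Units.val_mul, inv_zpow', zpow_neg,
      zpow_natCast, inv_mul_cancel, Units.val_one, one_mul]
  refine ⟨P + P' + partMinus T M, ?_, ?_⟩
  · rw [h.parts hM, Matrix.map_add _ (map_add _), Matrix.map_add _ (map_add _)]
    conv_lhs => rw [hP, hP']
    rw [smul_map_algHom, smul_map_algHom, smul_add, smul_add, smul_smul, map_pow, map_pow, hφ, e1,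
      pow_one, inv_zpow', neg_neg]
    congr 3
  · rw [Matrix.map_add _ (map_add _), Matrix.map_add _ (map_add _), hPc, hPc', partPlus_map,
      partZero_map]

theorem conj_mul_map (A A' B B' : Matrix (Fin N) (Fin N) (PowerSeries ℂ))
    (x : Matrix (Fin N) (Fin N) ℂ) :
    A.map φ * Z * B.map φ * extM R x * (B'.map φ * Z' * A'.map φ) =
      A.map φ * (Z * (B * extM _ x * B').map φ * Z') * A'.map φ := by
  rw [Matrix.map_mul, Matrix.map_mul, extM_map]
  noncomm_ring

theorem smul_conj_map (A A' Q : Matrix (Fin N) (Fin N) (PowerSeries ℂ)) (r : R) :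
    A.map φ * (r • Q.map φ) * A'.map φ = r • (A * Q * A').map φ := by
  rw [mul_smul_comm, smul_mul_assoc, Matrix.map_mul, Matrix.map_mul]

theorem Normalizes.adM_cube {B B' : Matrix (Fin N) (Fin N) (PowerSeries ℂ)}
    (hB : Normalizes 𝔤 B B') (hT : ∀ x ∈ 𝔤, ⁅T, ⁅T, ⁅T, x⁆⁆⁆ = ⁅T, x⁆)
    {x : Matrix (Fin N) (Fin N) ℂ} (hx : x ∈ 𝔤) :
    adM T (adM T (adM T (B * extM _ x * B'))) = adM T (B * extM _ x * B') :=
  HooftLine.adM_cube hT fun k => hB x hx (PowerSeries.coeff k)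

theorem exists_conj_eq (hT : ∀ x ∈ 𝔤, ⁅T, ⁅T, ⁅T, x⁆⁆⁆ = ⁅T, x⁆) (h : IsZConj d T s Z Z')
    (hφ : φ PowerSeries.X = (s : R) ^ d) (A A' : Matrix (Fin N) (Fin N) (PowerSeries ℂ))
    {B B' : Matrix (Fin N) (Fin N) (PowerSeries ℂ)} (hB : Normalizes 𝔤 B B')
    {x : Matrix (Fin N) (Fin N) ℂ} (hx : x ∈ 𝔤) :
    ∃ Q : Matrix (Fin N) (Fin N) (PowerSeries ℂ),
      A.map φ * Z * B.map φ * extM R x * (B'.map φ * Z' * A'.map φ) =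
        ((s ^ (-d : ℤ) : Rˣ) : R) • Q.map φ := by
  obtain ⟨Q, hQ⟩ := h.exists_eq_smul hφ (hB.adM_cube hT hx)
  exact ⟨_, by rw [conj_mul_map, hQ, smul_conj_map]⟩

theorem exists_conj_eq_infty (hT : ∀ x ∈ 𝔤, ⁅T, ⁅T, ⁅T, x⁆⁆⁆ = ⁅T, x⁆) (hT𝔤 : T ∈ 𝔤)
    (h : IsZConj d T s⁻¹ Z Z')
    (hφ : φ PowerSeries.X = (s : R) ^ d) {A A' : Matrix (Fin N) (Fin N) (PowerSeries ℂ)}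
    {B B' : Matrix (Fin N) (Fin N) (PowerSeries ℂ)} (hB : Normalizes 𝔤 B B')
    (hB' : B' * B = 1) (hA1 : A.map (PowerSeries.coeff 0) = 1)
    (hA1' : A'.map (PowerSeries.coeff 0) = 1) (hB1 : B.map (PowerSeries.coeff 0) = 1)
    (hB1' : B'.map (PowerSeries.coeff 0) = 1) {β : Matrix (Fin N) (Fin N) ℂ}
    (hβ : B.map (PowerSeries.coeff 1) = β) (hβ𝔤 : β ∈ 𝔤)
    {y : Matrix (Fin N) (Fin N) ℂ} (hy : y ∈ 𝔤) (hTy : ⁅T, y⁆ = -y) :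
    ∃ Q : Matrix (Fin N) (Fin N) (PowerSeries ℂ),
      A.map φ * Z * B.map φ * extM R y * (B'.map φ * Z' * A'.map φ) =
        ((s ^ (d : ℤ) : Rˣ) : R) • Q.map φ ∧
      Q.map (PowerSeries.coeff 0) = y + ⁅plusPart T β, y⁆ +
        (1 / 2 : ℂ) • ⁅plusPart T β, ⁅plusPart T β, y⁆⁆ := by
  have hβ' : B'.map (PowerSeries.coeff 1) = -β := by
    have := congrArg (fun M => M.map (PowerSeries.coeff 1)) hB'
    rw [← extM_one] at this
    simp only [map_coeff_one_mul, map_coeff_one_extM, hB1, hB1', hβ, one_mul, mul_one] at this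
    rw [eq_neg_iff_add_eq_zero, add_comm, this]
  have c0 : ∀ x : Matrix (Fin N) (Fin N) ℂ, (B * extM _ x * B').map (PowerSeries.coeff 0) = x := by
    intro x
    simp only [map_coeff_zero_mul, map_coeff_zero_extM, hB1, hB1', one_mul, mul_one]
  have c1 : ∀ x : Matrix (Fin N) (Fin N) ℂ,
      (B * extM _ x * B').map (PowerSeries.coeff 1) = ⁅β, x⁆ := by
    intro x
    simp only [map_coeff_zero_mul, map_coeff_one_mul, map_coeff_zero_extM, map_coeff_one_extM, hB1,
      hB1', hβ, hβ', one_mul, mul_one, mul_zero, zero_add, Ring.lie_def]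
    noncomm_ring
  set P := B * extM _ y * B' with hP
  set U := B * extM _ T * B' with hU
  -- The relation `[T, y] = -y` conjugated by `B`. Its second order coefficient is the input of
  -- `plusPart_second_order`.
  have hUP : U * P - P * U = -P := by
    have e1 : U * P = B * extM _ (T * y) * B' := by
      rw [hU, hP, extM_mul]
      calc _ = B * extM _ T * (B' * B) * extM _ y * B' := by noncomm_ring
        _ = _ := by rw [hB']; noncomm_ring
    have e2 : P * U = B * extM _ (y * T) * B' := by
      rw [hU, hP, extM_mul]
      calc _ = B * extM _ y * (B' * B) * extM _ T * B' := by noncomm_ring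
        _ = _ := by rw [hB']; noncomm_ring
    rw [Ring.lie_def] at hTy
    rw [e1, e2, ← sub_mul, ← mul_sub, ← extM_sub, hTy, extM_neg, hP]
    noncomm_ring
  have h2 : ⁅T, P.map (PowerSeries.coeff 2)⁆ + ⁅⁅β, T⁆, ⁅β, y⁆⁆ +
      ⁅U.map (PowerSeries.coeff 2), y⁆ = -P.map (PowerSeries.coeff 2) := by
    have := congrArg (fun M => M.map (PowerSeries.coeff 2)) hUP
    rw [Matrix.map_sub _ (map_sub _), map_coeff_two_mul U P, map_coeff_two_mul P U, c0 y, c0 T, c1 y, c1 T]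
      at this
    rw [show -P.map (PowerSeries.coeff 2) = (-P).map (PowerSeries.coeff 2) by ext i j; simp, ← this,
      Ring.lie_def T, Ring.lie_def ⁅β, T⁆, Ring.lie_def (U.map _)]
    abel
  -- The cubic identity holds on `𝔤` only, not on all matrices, so the graded identities are applied
  -- inside the subtype `𝔤`.
  have hT' : ∀ x : 𝔤, ⁅(⟨T, hT𝔤⟩ : 𝔤), ⁅(⟨T, hT𝔤⟩ : 𝔤), ⁅(⟨T, hT𝔤⟩ : 𝔤), x⁆⁆⁆ = ⁅(⟨T, hT𝔤⟩ : 𝔤), x⁆ :=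
    fun x => Subtype.ext (hT x x.2)
  have hy' : ⁅(⟨T, hT𝔤⟩ : 𝔤), (⟨y, hy⟩ : 𝔤)⁆ = -⟨y, hy⟩ := Subtype.ext hTy
  have k1 : plusPart T ⁅β, y⁆ = 0 :=
    congrArg Subtype.val (plusPart_lie_eq_zero hT' hy' ⟨β, hβ𝔤⟩)
  have k2 : ⁅β, y⁆ - ⁅T, ⁅T, ⁅β, y⁆⁆⁆ = ⁅plusPart T β, y⁆ :=
    congrArg Subtype.val (lie_sub_lie_lie_eq hT' hy' ⟨β, hβ𝔤⟩)
  have k3 : plusPart T (P.map (PowerSeries.coeff 2)) =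
      (1 / 2 : ℂ) • ⁅plusPart T β, ⁅plusPart T β, y⁆⁆ :=
    congrArg Subtype.val (plusPart_second_order hT' hy' ⟨β, hβ𝔤⟩
      (Q := ⟨_, hB y hy (PowerSeries.coeff 2)⟩) (q := ⟨_, hB T hT𝔤 (PowerSeries.coeff 2)⟩)
      (Subtype.ext h2))
  obtain ⟨Q, hQ, hQ0⟩ := h.exists_eq_smul_infty hφ (hB.adM_cube hT hy)
    (by rw [c0, plusPart_of_weight_neg hTy]) (by rw [c1, k1])
    (by rw [c0, hTy, lie_neg, hTy]; abel)
  refine ⟨A * Q * A', by rw [conj_mul_map, hQ, smul_conj_map], ?_⟩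
  rw [map_coeff_zero_mul, map_coeff_zero_mul, hA1, hA1', one_mul, mul_one, hQ0, c1, k2, partMinus_map,
    c0, hTy, lie_neg, hTy, k3]
  module

end Generic

end ConjugationTheorem

/-! ### Loop group elements in the phase space -/

section ExpConj

variable {n : Type*} [Fintype n] [DecidableEq n]

theorem exp_mulLeft_apply {x : Matrix n n ℂ} (hx : IsNilpotent x) (y : Matrix n n ℂ) :
    IsNilpotent.exp (LinearMap.mulLeft ℂ x) y = IsNilpotent.exp x * y := by
  obtain ⟨k, hk⟩ := hx
  have : LinearMap.mulLeft ℂ x ^ k = 0 := by rw [LinearMap.pow_mulLeft, hk, LinearMap.mulLeft_zero_eq_zero]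
  rw [IsNilpotent.exp_eq_sum hk, IsNilpotent.exp_eq_sum this, LinearMap.sum_apply, Finset.sum_mul]
  refine Finset.sum_congr rfl fun i _ => ?_
  rw [LinearMap.smul_apply, LinearMap.pow_mulLeft, LinearMap.mulLeft_apply, smul_mul_assoc]

theorem exp_mulRight_apply {x : Matrix n n ℂ} (hx : IsNilpotent x) (y : Matrix n n ℂ) :
    IsNilpotent.exp (LinearMap.mulRight ℂ x) y = y * IsNilpotent.exp x := by
  obtain ⟨k, hk⟩ := hx
  have : LinearMap.mulRight ℂ x ^ k = 0 := by rw [LinearMap.pow_mulRight, hk, LinearMap.mulRight_zero_eq_zero]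
  rw [IsNilpotent.exp_eq_sum hk, IsNilpotent.exp_eq_sum this, LinearMap.sum_apply, Finset.mul_sum]
  refine Finset.sum_congr rfl fun i _ => ?_
  rw [LinearMap.smul_apply, LinearMap.pow_mulRight, LinearMap.mulRight_apply, mul_smul_comm]

/-- Conjugation by `exp x` is `exp (ad x)`. -/
theorem exp_mul_mul_exp_neg {x y : Matrix n n ℂ} (hx : IsNilpotent x)
    (h : ⁅x, ⁅x, ⁅x, y⁆⁆⁆ = 0) : IsNilpotent.exp x * y * IsNilpotent.exp (-x) =
      y + ⁅x, y⁆ + (1 / 2 : ℂ) • ⁅x, ⁅x, y⁆⁆ := by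
  have had : IsNilpotent (LieAlgebra.ad ℂ (Matrix n n ℂ) x) :=
    LieAlgebra.ad_nilpotent_of_nilpotent hx
  have hR : IsNilpotent (LinearMap.mulRight ℂ x) := (LinearMap.isNilpotent_mulRight_iff ℂ x).2 hx
  -- Left multiplication by `x` is right multiplication plus `ad x`, and these two commute. The
  -- exponential of the sum therefore factors.
  have hsum : LinearMap.mulLeft ℂ x = LinearMap.mulRight ℂ x + LieAlgebra.ad ℂ (Matrix n n ℂ) x := by
    ext y : 1
    simp [Ring.lie_def]
  have hc : Commute (LinearMap.mulRight ℂ x) (LieAlgebra.ad ℂ (Matrix n n ℂ) x) := by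
    rw [← sub_eq_iff_eq_add'.2 hsum]
    exact (LinearMap.commute_mulLeft_right x x).symm.sub_right (Commute.refl _)
  have h1 := exp_mulLeft_apply hx y
  have h2 : IsNilpotent.exp (LieAlgebra.ad ℂ (Matrix n n ℂ) x) y =
      y + ⁅x, y⁆ + (1 / 2 : ℂ) • ⁅x, ⁅x, y⁆⁆ := by
    have := IsNilpotent.exp_smul_eq_sum (a := LieAlgebra.ad ℂ (Matrix n n ℂ) x) (m := y) (k := 3)
      (by simpa [pow_succ] using h) had
    rw [Module.End.smul_def] at this
    rw [this]
    simp only [Finset.sum_range_succ, Finset.sum_range_zero, zero_add]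
    simp [pow_succ, Nat.factorial]
    rw [← algebraMap_smul ℂ]
    simp
  rw [hsum, IsNilpotent.exp_add_of_commute hc hR had, Module.End.mul_apply, h2,
    exp_mulRight_apply hx] at h1
  rw [← h1, mul_assoc, IsNilpotent.exp_mul_exp_neg_self hx, mul_one]

end ExpConj

/-! ### The conjugation formula for elements of the phase space. -/

section Core

variable {N : ℕ} {𝔤 : LieSubalgebra ℂ (Matrix (Fin N) (Fin N) ℂ)} {d : ℕ} [NeZero d]
  {T : Matrix (Fin N) (Fin N) ℂ}

theorem ofPowerAlg_X_tUnit : ofPowerAlg d PowerSeries.X = (tUnit : LaurentSeries ℂ) ^ d := by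
  rw [coe_ofPowerAlg, ofPower_X, zpow_natCast, Units.val_pow_eq_pow_val]

theorem map_coeff_zero_eq {n : Type*} (M : Matrix n n (PowerSeries ℂ)) :
    M.map (PowerSeries.coeff 0) = M.map (PowerSeries.constantCoeff (R := ℂ)) := by
  ext i j
  simp

/-- Conjugation of an element of charge `-1` by an element `L` of the phase space. -/
theorem laurent_conj_eq (hT : ∀ x ∈ 𝔤, ⁅T, ⁅T, ⁅T, x⁆⁆⁆ = ⁅T, x⁆) (hT𝔤 : T ∈ 𝔤)
    {L L' : Matrix (Fin N) (Fin N) ℂ[T;T⁻¹]}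
    {Z Z' W W' : Matrix (Fin N) (Fin N) (LaurentSeries ℂ)}
    (hZ : IsZConj d T tUnit Z Z') (hW : IsZConj d T tUnit⁻¹ W W')
    {A A' B B' C C' D D' : Matrix (Fin N) (Fin N) (PowerSeries ℂ)}
    (hL0 : L.map expandZero = A.map (ofPower d) * Z * B.map (ofPower d))
    (hL0' : L'.map expandZero = B'.map (ofPower d) * Z' * A'.map (ofPower d))
    (hLi : L.map expandInfty = C.map (ofPower d) * W * D.map (ofPower d))
    (hLi' : L'.map expandInfty = D'.map (ofPower d) * W' * C'.map (ofPower d))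
    (hB : Normalizes 𝔤 B B') (hD : Normalizes 𝔤 D D') (hDD : D' * D = 1)
    (hC1 : C.map (PowerSeries.coeff 0) = 1) (hC1' : C'.map (PowerSeries.coeff 0) = 1)
    (hD1 : D.map (PowerSeries.coeff 0) = 1) (hD1' : D'.map (PowerSeries.coeff 0) = 1)
    (hD𝔤 : D.map (PowerSeries.coeff 1) ∈ 𝔤) {y : Matrix (Fin N) (Fin N) ℂ} (hy : y ∈ 𝔤)
    (hTy : ⁅T, y⁆ = -y) {b : Matrix (Fin N) (Fin N) ℂ}
    (hb : plusPart T (D.map (PowerSeries.coeff 1)) = b) (hbn : IsNilpotent b) :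
    L * extM _ y * L' = (LaurentPolynomial.T (-d) : ℂ[T;T⁻¹]) •
      extM _ (IsNilpotent.exp b * y * IsNilpotent.exp (-b)) := by
  obtain ⟨Q, hQ⟩ := exists_conj_eq hT hZ ofPowerAlg_X_tUnit A A' hB hy
  obtain ⟨Q', hQ', hQ0⟩ := exists_conj_eq_infty hT hT𝔤 hW ofPowerAlg_X_tUnit hD hDD hC1 hC1' hD1 hD1'
    rfl hD𝔤 hy hTy
  have hb𝔤 : b ∈ 𝔤 := by
    rw [← hb, plusPart]
    exact 𝔤.smul_mem _ (𝔤.add_mem (𝔤.lie_mem hT𝔤 (𝔤.lie_mem hT𝔤 hD𝔤)) (𝔤.lie_mem hT𝔤 hD𝔤))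
  have hTb : ⁅T, b⁆ = b := by
    have := lie_plusPart (T := (⟨T, hT𝔤⟩ : 𝔤)) (fun x => Subtype.ext (hT x x.2)) ⟨_, hD𝔤⟩
    rw [← hb]
    exact congrArg Subtype.val this
  -- Three brackets with `b` raise the weight from -1 to 2, which does not occur in `𝔤`. The series
  -- for `e^b y e^{-b}` therefore stops after the quadratic term.
  have h3 : ⁅b, ⁅b, ⁅b, y⁆⁆⁆ = 0 := by
    have := eq_zero_of_lie_eq_smul (T := (⟨T, hT𝔤⟩ : 𝔤)) (fun x => Subtype.ext (hT x x.2))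
      (x := ⁅(⟨b, hb𝔤⟩ : 𝔤), ⁅(⟨b, hb𝔤⟩ : 𝔤), ⁅(⟨b, hb𝔤⟩ : 𝔤), (⟨y, hy⟩ : 𝔤)⁆⁆⁆) (a := 2) ?_
      (by norm_num)
    · exact congrArg Subtype.val this
    · have e1 : ⁅(⟨T, hT𝔤⟩ : 𝔤), (⟨b, hb𝔤⟩ : 𝔤)⁆ = (1 : ℂ) • ⟨b, hb𝔤⟩ := by
        rw [one_smul]; exact Subtype.ext hTb
      have e2 : ⁅(⟨T, hT𝔤⟩ : 𝔤), (⟨y, hy⟩ : 𝔤)⁆ = (-1 : ℂ) • ⟨y, hy⟩ := by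
        rw [neg_one_smul]; exact Subtype.ext hTy
      rw [lie_lie_of_weights e1 (lie_lie_of_weights e1 (lie_lie_of_weights e1 e2))]
      norm_num
  rw [exp_mul_mul_exp_neg hbn h3, ← hb, ← hQ0]
  simp only [coe_ofPowerAlg] at hQ hQ'
  rw [← hL0, ← hL0', ← extM_map expandZeroAlg, coe_expandZeroAlg, ← Matrix.map_mul,
    ← Matrix.map_mul] at hQ
  rw [← hLi, ← hLi', ← extM_map expandInftyAlg, coe_expandInftyAlg, ← Matrix.map_mul,
    ← Matrix.map_mul] at hQ'
  refine Matrix.ext fun i j => ?_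
  -- Each entry has a pole of order at most `d` at 0 and a zero of order at least `d` at infinity.
  -- So it is a constant times `t ^ (-d)`, and the constant is the leading coefficient at infinity.
  have := laurent_eq_of_expand (congrFun (congrFun hQ i) j) (congrFun (congrFun hQ' i) j)
  rw [this, Matrix.smul_apply, smul_eq_mul, mul_comm, map_coeff_zero_eq,
    LaurentPolynomial.C_eq_algebraMap]
  rfl

end Core

/-! ### Invertibility over Laurent polynomials. -/

section Inverse

variable {N : ℕ} {d : ℕ} [NeZero d] {μ : Matrix (Fin N) (Fin N) ℂ}

/-- The determinant of `L z^{-μ}` is a Laurent polynomial without pole at 0 or at infinity, hence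
constant. Its value at infinity is 1. -/
theorem exists_inverse_of_expand (hμ : IsFractional d μ) {L : Matrix (Fin N) (Fin N) ℂ[T;T⁻¹]}
    {A B C D : Matrix (Fin N) (Fin N) (PowerSeries ℂ)}
    (hL0 : L.map expandZero = A.map (ofPower d) * zPow d μ tUnit * B.map (ofPower d))
    (hLi : L.map expandInfty = C.map (ofPower d) * zPow d μ tUnit⁻¹ * D.map (ofPower d))
    (hC1 : C.map (PowerSeries.constantCoeff (R := ℂ)) = 1)
    (hD1 : D.map (PowerSeries.constantCoeff (R := ℂ)) = 1) :
    ∃ L' : Matrix (Fin N) (Fin N) ℂ[T;T⁻¹], L * L' = 1 := by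
  have hdet : ∀ {R : Type} [CommRing R] (φ : ℂ[T;T⁻¹] →+* R) (M : Matrix (Fin N) (Fin N) ℂ[T;T⁻¹]),
      φ M.det = (M.map φ).det := fun φ M => RingHom.map_det φ M
  have hdet' : ∀ (M : Matrix (Fin N) (Fin N) (PowerSeries ℂ)),
      (M.map (ofPower d)).det = ofPower d M.det := fun M => (RingHom.map_det (ofPower d) M).symm
  have hz : ∀ s : (LaurentSeries ℂ)ˣ, (zPow d μ s).det * (zPow d μ s⁻¹).det = 1 := fun s => by
    rw [← Matrix.det_mul, zPow_mul_zPow_inv hμ, Matrix.det_one]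
  have e0 : (zPow d μ TUnit⁻¹).map expandZero = zPow d μ tUnit⁻¹ := by
    rw [← coe_expandZeroAlg, map_zPow, map_inv, expandZeroAlg, map_laurentEval_TUnit]
  have ei : (zPow d μ TUnit⁻¹).map expandInfty = zPow d μ tUnit⁻¹⁻¹ := by
    rw [← coe_expandInftyAlg, map_zPow, map_inv, expandInftyAlg, map_laurentEval_TUnit]
  have h1 : L.det * (zPow d μ TUnit⁻¹).det = 1 := by
    have := laurent_eq_of_expand (d := d) (p := L.det * (zPow d μ TUnit⁻¹).det) (a := 0)
      (q := A.det * B.det) (q' := C.det * D.det) ?_ ?_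
    · rw [this, map_mul, RingHom.map_det, RingHom.map_det, RingHom.mapMatrix_apply,
        RingHom.mapMatrix_apply, hC1, hD1]
      simp
    · rw [neg_zero, zpow_zero, Units.val_one, one_mul, map_mul, hdet, hdet, hL0, e0, Matrix.det_mul,
        Matrix.det_mul, hdet', hdet', map_mul]
      linear_combination ofPower d A.det * ofPower d B.det * hz tUnit
    · rw [zpow_zero, Units.val_one, one_mul, map_mul, hdet, hdet, hLi, ei, Matrix.det_mul,
        Matrix.det_mul, hdet', hdet', map_mul]
      linear_combination ofPower d C.det * ofPower d D.det * hz tUnit⁻¹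
  exact ⟨_, Matrix.mul_nonsing_inv _ (IsUnit.of_mul_eq_one _ h1)⟩

end Inverse

/-! ### Loops that centralize the Lie algebra are constant. -/

section Constancy

variable {N : ℕ} {G : Subgroup (GL (Fin N) ℂ)} {𝔤 : LieSubalgebra ℂ (Matrix (Fin N) (Fin N) ℂ)}

/-- The unit `1 + a ε` of the dual numbers. -/
def oneAddEps : Multiplicative ℂ →* (DualNumber ℂ)ˣ :=
  MonoidHom.toHomUnits
    { toFun := fun a => TrivSqZeroExt.inl 1 + TrivSqZeroExt.inr a.toAdd
      map_one' := by ext <;> simp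
      map_mul' := fun a b => by ext <;> simp [add_comm] }

/-- Substitution of `τ (1 + ε)` for the variable. -/
def dualEval (τ : ℂˣ) : ℂ[T;T⁻¹] →ₐ[ℂ] DualNumber ℂ :=
  laurentEval (Units.map (algebraMap ℂ (DualNumber ℂ)).toMonoidHom τ *
    oneAddEps (Multiplicative.ofAdd 1))

theorem dualEval_C_mul_T (τ : ℂˣ) (a : ℂ) (m : ℤ) :
    dualEval τ (LaurentPolynomial.C a * LaurentPolynomial.T m) =
      TrivSqZeroExt.inl (a * (τ : ℂ) ^ m) + TrivSqZeroExt.inr (a * (τ : ℂ) ^ m * m) := by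
  rw [dualEval, laurentEval_C_mul_T, 
    (show Commute _ _ from Units.ext (mul_comm _ _)).mul_zpow, ← map_zpow, ← map_zpow, ← ofAdd_zsmul, Units.val_mul]
  have h1 : ((oneAddEps (Multiplicative.ofAdd (m • (1 : ℂ))) : (DualNumber ℂ)ˣ) : DualNumber ℂ) =
    TrivSqZeroExt.inl 1 + TrivSqZeroExt.inr (m • (1 : ℂ)) := rfl
  have h2 : ((Units.map (algebraMap ℂ (DualNumber ℂ)).toMonoidHom (τ ^ m) : (DualNumber ℂ)ˣ) :
    DualNumber ℂ) = TrivSqZeroExt.inl ((τ : ℂ) ^ m) := by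
    rw [← Units.val_zpow_eq_zpow_val]; rfl
  rw [h1, h2, TrivSqZeroExt.algebraMap_eq_inl]
  ext <;> simp
  ring

theorem fst_dualEval (τ : ℂˣ) (p : ℂ[T;T⁻¹]) : (dualEval τ p).fst = laurentEval τ p := by
  induction p using LaurentPolynomial.induction_on' with
  | add p q hp hq => rw [map_add, TrivSqZeroExt.fst_add, hp, hq, map_add]
  | C_mul_T m a =>
    rw [dualEval_C_mul_T, laurentEval_C_mul_T, Units.val_zpow_eq_zpow_val]
    simp

/-- The `ε`-component of the substitution `t ↦ τ (1 + ε)` is the Euler derivative `t dp/dt` at `τ`,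
which vanishes identically only for constants. -/
theorem exists_snd_dualEval (p : ℂ[T;T⁻¹]) : ∃ q : ℂ[T;T⁻¹],
    (∀ k, q.coeff k = k * p.coeff k) ∧ ∀ τ, (dualEval τ p).snd = laurentEval τ q := by
  induction p using LaurentPolynomial.induction_on' with
  | add p q hp hq =>
    obtain ⟨p', hp, hp'⟩ := hp
    obtain ⟨q', hq, hq'⟩ := hq
    refine ⟨p' + q', fun k => ?_, fun τ => ?_⟩
    · simp [hp, hq, mul_add]
    · rw [map_add, TrivSqZeroExt.snd_add, hp', hq', map_add]
  | C_mul_T m a =>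
    refine ⟨LaurentPolynomial.C (a * m) * LaurentPolynomial.T m, fun k => ?_, fun τ => ?_⟩
    · rw [coeff_C_mul_T, coeff_C_mul_T]
      split_ifs with h
      · rw [h, mul_comm]
      · rw [mul_zero]
    · rw [dualEval_C_mul_T, laurentEval_C_mul_T, Units.val_zpow_eq_zpow_val]
      simp
      ring

theorem eq_C_of_snd_dualEval {p : ℂ[T;T⁻¹]} (h : ∀ τ, (dualEval τ p).snd = 0) :
    p = LaurentPolynomial.C (p.coeff 0) := by
  obtain ⟨q, hq, hq'⟩ := exists_snd_dualEval p
  have hq0 : q = 0 := laurent_eq_zero fun τ => by rw [← hq', h]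
  refine LaurentPolynomial.ext fun k => ?_
  rw [LaurentPolynomial.C_apply]
  split_ifs with hk
  · rw [hk]
  · have := hq k
    rw [hq0] at this
    simpa [hk] using this.symm

theorem dualMatrix_mul_extM (A B x : Matrix (Fin N) (Fin N) ℂ) :
    dualMatrix A B * extM _ x = dualMatrix (A * x) (B * x) := by
  ext i j
  · simp [fst_dualMatrix, Matrix.mul_apply, TrivSqZeroExt.algebraMap_eq_inl, TrivSqZeroExt.fst_sum]
  · simp [snd_dualMatrix, fst_dualMatrix, Matrix.mul_apply, TrivSqZeroExt.algebraMap_eq_inl,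
      TrivSqZeroExt.snd_sum]

theorem extM_mul_dualMatrix (A B x : Matrix (Fin N) (Fin N) ℂ) :
    extM _ x * dualMatrix A B = dualMatrix (x * A) (x * B) := by
  ext i j
  · simp [fst_dualMatrix, Matrix.mul_apply, TrivSqZeroExt.algebraMap_eq_inl, TrivSqZeroExt.fst_sum]
  · simp [snd_dualMatrix, fst_dualMatrix, Matrix.mul_apply, TrivSqZeroExt.algebraMap_eq_inl,
      TrivSqZeroExt.snd_sum]

/-- A Laurent polynomial loop in the centralizer of `𝔤` is constant if `𝔤` has trivial center. -/
theorem exists_eq_extM_of_commute (hG : IsAlgebraicGroup G) (h𝔤 : IsLieAlgebraOf 𝔤 G)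
    (hcenter : ∀ x ∈ 𝔤, (∀ y ∈ 𝔤, ⁅x, y⁆ = 0) → x = 0)
    {c c' : Matrix (Fin N) (Fin N) ℂ[T;T⁻¹]} (hc : IsPoint G c) (hcc : c * c' = 1)
    (hcomm : ∀ x ∈ 𝔤, c * extM _ x = extM _ x * c) : ∃ c0, c = extM _ c0 := by
  refine ⟨c.map fun p => p.coeff 0, Matrix.ext fun i j => eq_C_of_snd_dualEval fun τ => ?_⟩
  let c1 : Matrix (Fin N) (Fin N) ℂ := c.map (laurentEval τ)
  let δ : Matrix (Fin N) (Fin N) ℂ := c.map fun p => (dualEval τ p).snd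
  have hcδ : c.map (dualEval τ) = dualMatrix c1 δ := by
    ext i j
    · exact fst_dualEval τ _
    · rfl
  have hu : IsUnit c1 := by
    refine IsUnit.of_mul_eq_one (c'.map (laurentEval τ)) ?_
    rw [← Matrix.map_mul, hcc, Matrix.map_one _ (map_zero _) (map_one _)]
  obtain ⟨g, hg, hgc⟩ := (hc.map (laurentEval τ)).exists_mem hG hu
  have hgi : ((g⁻¹ : GL (Fin N) ℂ) : Matrix (Fin N) (Fin N) ℂ) * c1 = 1 := by
    rw [show c1 = g from hgc.symm, ← Units.val_mul, inv_mul_cancel, Units.val_one]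
  have hcomm1 : ∀ x ∈ 𝔤, c1 * x = x * c1 ∧ δ * x = x * δ := by
    intro x hx
    have := congrArg (fun M => M.map (dualEval τ)) (hcomm x hx)
    simp only [Matrix.map_mul, extM_map, hcδ, dualMatrix_mul_extM, extM_mul_dualMatrix] at this
    constructor
    · ext i j
      exact congrArg TrivSqZeroExt.fst (congrFun (congrFun this i) j)
    · ext i j
      exact congrArg TrivSqZeroExt.snd (congrFun (congrFun this i) j)
  -- The logarithmic derivative of the loop at `τ`: translation by `g⁻¹` turns the point `c1 + ε δ`
  -- into `1 + ε g⁻¹ δ`, so `g⁻¹ δ` lies in `𝔤`. It commutes with `𝔤` because `c1` and `δ` do, so it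
  -- vanishes.
  have hα : ((g⁻¹ : GL (Fin N) ℂ) : Matrix (Fin N) (Fin N) ℂ) * δ ∈ 𝔤 := by
    apply mem_lieAlgebra_of_isPoint_dualMatrix hG h𝔤
    have := (hc.map (dualEval τ)).mul_left (G.inv_mem hg)
    rwa [hcδ, extM_mul_dualMatrix, hgi] at this
  have hzero := hcenter _ hα fun x hx => by
    have e1 : ((g⁻¹ : GL (Fin N) ℂ) : Matrix (Fin N) (Fin N) ℂ) * x =
        x * ((g⁻¹ : GL (Fin N) ℂ) : Matrix (Fin N) (Fin N) ℂ) := by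
      have h1 : (g : Matrix (Fin N) (Fin N) ℂ) * x = x * g := by
        rw [hgc]; exact (hcomm1 x hx).1
      calc _ = ((g⁻¹ : GL (Fin N) ℂ) : Matrix (Fin N) (Fin N) ℂ) * (x * g) * (g⁻¹ : GL (Fin N) ℂ) := by
            rw [mul_assoc, mul_assoc, ← Units.val_mul, mul_inv_cancel, Units.val_one, mul_one]
        _ = _ := by
            rw [← h1, ← mul_assoc, ← Units.val_mul, inv_mul_cancel, Units.val_one, one_mul]
    rw [Ring.lie_def, mul_assoc, (hcomm1 x hx).2, ← mul_assoc, e1, mul_assoc, sub_self]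
  have hδ : δ = 0 := by
    have := congrArg (fun M => (g : Matrix (Fin N) (Fin N) ℂ) * M) hzero
    simpa [← mul_assoc, ← Units.val_mul] using this
  exact congrFun (congrFun hδ i) j

end Constancy

/-! ### The phase space -/

/-- A linear algebraic group `G` with Lie algebra `𝔤` and a minuscule coweight `μ`, such that the
center of `𝔤` is trivial and `𝔤` is generated by the elements of charge `1` and `-1`. -/
structure CoweightData {N : ℕ} (G : Subgroup (GL (Fin N) ℂ))
    (𝔤 : LieSubalgebra ℂ (Matrix (Fin N) (Fin N) ℂ)) (d : ℕ) (μ : Matrix (Fin N) (Fin N) ℂ) :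
    Prop where
  isAlgebraic : IsAlgebraicGroup G
  isLieAlgebra : IsLieAlgebraOf 𝔤 G
  mem : μ ∈ 𝔤
  cube : ∀ x ∈ 𝔤, ⁅μ, ⁅μ, ⁅μ, x⁆⁆⁆ = ⁅μ, x⁆
  generated : ∀ K : LieSubalgebra ℂ (Matrix (Fin N) (Fin N) ℂ), (∀ x ∈ 𝔤, ⁅μ, x⁆ = x → x ∈ K) →
    (∀ x ∈ 𝔤, ⁅μ, x⁆ = -x → x ∈ K) → 𝔤 ≤ K
  center : ∀ x ∈ 𝔤, (∀ y ∈ 𝔤, ⁅x, y⁆ = 0) → x = 0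
  frac : IsFractional d μ

/-- The subalgebra of constant matrices that commute with `M`. -/
def commutant {N : ℕ} {R : Type*} [CommRing R] [Algebra ℂ R] (M : Matrix (Fin N) (Fin N) R) :
    LieSubalgebra ℂ (Matrix (Fin N) (Fin N) ℂ) where
  carrier := {x | M * extM R x = extM R x * M}
  add_mem' := by
    intro x y hx hy
    simp only [Set.mem_ofPred_eq] at hx hy ⊢
    rw [extM_add, mul_add, add_mul, hx, hy]
  zero_mem' := by simp
  smul_mem' := by
    intro a x hx
    simp only [Set.mem_ofPred_eq] at hx ⊢
    rw [extM_smul, mul_smul_comm, smul_mul_assoc, hx]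
  lie_mem' := by
    intro x y hx hy
    change M * extM R x = extM R x * M at hx
    change M * extM R y = extM R y * M at hy
    change M * extM R ⁅x, y⁆ = extM R ⁅x, y⁆ * M
    rw [Ring.lie_def, extM_sub, extM_mul, extM_mul, mul_sub, sub_mul, ← mul_assoc, hx, mul_assoc, hy,
      ← mul_assoc M (extM R y), hy, mul_assoc (extM R y), hx]
    noncomm_ring

theorem mem_commutant {N : ℕ} {R : Type*} [CommRing R] [Algebra ℂ R] {M : Matrix (Fin N) (Fin N) R}
    {x : Matrix (Fin N) (Fin N) ℂ} : x ∈ commutant M ↔ M * extM R x = extM R x * M := Iff.rfl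

namespace CoweightData

variable {N : ℕ} {G : Subgroup (GL (Fin N) ℂ)} {𝔤 : LieSubalgebra ℂ (Matrix (Fin N) (Fin N) ℂ)}
  {d : ℕ} [NeZero d] {μ : Matrix (Fin N) (Fin N) ℂ} (H : CoweightData G 𝔤 d μ)
  {R : Type*} [CommRing R] [Algebra ℂ R]
include H

theorem hasWeight_plus {x : Matrix (Fin N) (Fin N) ℂ} (hx : ⁅μ, x⁆ = x) :
    HasWeight μ ((1 : ℤ) : ℂ) (extM R x) :=
  HasWeight.extend (by rw [← Ring.lie_def, hx]; simp)

theorem hasWeight_minus {x : Matrix (Fin N) (Fin N) ℂ} (hx : ⁅μ, x⁆ = -x) :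
    HasWeight μ ((-1 : ℤ) : ℂ) (extM R x) :=
  HasWeight.extend (by rw [← Ring.lie_def, hx]; simp)

theorem isNilpotent_plus {x : Matrix (Fin N) (Fin N) ℂ} (hx : ⁅μ, x⁆ = x) : IsNilpotent x :=
  HasWeight.isNilpotent (R := ℂ) H.frac (a := 1) one_ne_zero
    (HasWeight.extend (R := ℂ) (by rw [← Ring.lie_def, hx, one_smul]))

theorem isNilpotent_minus {x : Matrix (Fin N) (Fin N) ℂ} (hx : ⁅μ, x⁆ = -x) : IsNilpotent x :=
  HasWeight.isNilpotent (R := ℂ) H.frac (a := -1) (by norm_num)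
    (HasWeight.extend (R := ℂ) (by rw [← Ring.lie_def, hx, neg_one_smul]))

theorem zPow_mul_plus {x : Matrix (Fin N) (Fin N) ℂ} (hx : ⁅μ, x⁆ = x) (t : Rˣ) :
    zPow d μ t * extM R x = ((t ^ d : Rˣ) : R) • (extM R x * zPow d μ t) := by
  have := (H.hasWeight_plus (R := R) hx).zPow_mul H.frac t
  rwa [mul_one, zpow_natCast] at this

theorem zPow_mul_minus {x : Matrix (Fin N) (Fin N) ℂ} (hx : ⁅μ, x⁆ = -x) (t : Rˣ) :
    ((t ^ d : Rˣ) : R) • (zPow d μ t * extM R x) = extM R x * zPow d μ t := by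
  rw [(H.hasWeight_minus (R := R) hx).zPow_mul H.frac t, smul_smul, ← Units.val_mul,
    ← zpow_natCast, ← zpow_add]
  simp

theorem commute_of_weight_one {x x' : Matrix (Fin N) (Fin N) ℂ} (hx𝔤 : x ∈ 𝔤) (hx𝔤' : x' ∈ 𝔤)
    (hx : ⁅μ, x⁆ = x) (hx' : ⁅μ, x'⁆ = x') : x * x' = x' * x := by
  have := eq_zero_of_lie_eq_smul (T := (⟨μ, H.mem⟩ : 𝔤)) (fun x => Subtype.ext (H.cube x x.2))
    (x := ⁅(⟨x, hx𝔤⟩ : 𝔤), (⟨x', hx𝔤'⟩ : 𝔤)⁆) (a := 2)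
    (by
      rw [lie_lie_of_weights (a := 1) (b := 1) (by rw [one_smul]; exact Subtype.ext hx)
        (by rw [one_smul]; exact Subtype.ext hx')]
      norm_num) (by norm_num)
  rw [← sub_eq_zero, ← Ring.lie_def]
  exact congrArg Subtype.val this

theorem commute_of_weight_neg_one {x x' : Matrix (Fin N) (Fin N) ℂ} (hx𝔤 : x ∈ 𝔤) (hx𝔤' : x' ∈ 𝔤)
    (hx : ⁅μ, x⁆ = -x) (hx' : ⁅μ, x'⁆ = -x') : x * x' = x' * x := by
  have := eq_zero_of_lie_eq_smul (T := (⟨μ, H.mem⟩ : 𝔤)) (fun x => Subtype.ext (H.cube x x.2))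
    (x := ⁅(⟨x, hx𝔤⟩ : 𝔤), (⟨x', hx𝔤'⟩ : 𝔤)⁆) (a := -2)
    (by
      rw [lie_lie_of_weights (a := -1) (b := -1) (by rw [neg_one_smul]; exact Subtype.ext hx)
        (by rw [neg_one_smul]; exact Subtype.ext hx')]
      norm_num) (by norm_num)
  rw [← sub_eq_zero, ← Ring.lie_def]
  exact congrArg Subtype.val this

theorem isPoint_extM_exp {x : Matrix (Fin N) (Fin N) ℂ} (hx : x ∈ 𝔤) (hn : IsNilpotent x) :
    IsPoint G (extM R (IsNilpotent.exp x)) := by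
  have := (isPoint_exp H.isLieAlgebra hx 1).map (Algebra.ofId ℂ R)
  rw [one_smul, exp_eq_isNilpotent_exp hn] at this
  exact this

end CoweightData

theorem exists_inverse_of_mem_points {N : ℕ} {G : Subgroup (GL (Fin N) ℂ)}
    {𝔤 : LieSubalgebra ℂ (Matrix (Fin N) (Fin N) ℂ)} (h𝔤 : IsLieAlgebraOf 𝔤 G) {R : Type*}
    [CommRing R] [Algebra ℂ R] {A : GL (Fin N) R} (hA : A ∈ Points G R) :
    ∃ A' : Matrix (Fin N) (Fin N) R, A.1 * A' = 1 ∧ A' * A.1 = 1 ∧ Normalizes 𝔤 A.1 A' ∧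
      Normalizes 𝔤 A' A.1 :=
  ⟨A⁻¹.1, A.mul_inv, A.inv_mul, IsPoint.normalizes h𝔤 hA A.mul_inv⟩

theorem map_coeff_zero_inverse {n : Type*} [Fintype n] [DecidableEq n]
    {D D' : Matrix n n (PowerSeries ℂ)} (h : D * D' = 1)
    (h1 : D.map (PowerSeries.coeff 0) = 1) : D'.map (PowerSeries.coeff 0) = 1 := by
  have := congrArg (fun M => M.map (PowerSeries.coeff 0)) h
  simp only [map_coeff_zero_mul, h1, one_mul] at this
  rw [this, ← extM_one, map_coeff_zero_extM]

theorem map_coeff_one_inverse {n : Type*} [Fintype n] [DecidableEq n]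
    {D D' : Matrix n n (PowerSeries ℂ)} (h : D * D' = 1)
    (h1 : D.map (PowerSeries.coeff 0) = 1) :
    D'.map (PowerSeries.coeff 1) = -D.map (PowerSeries.coeff 1) := by
  have := congrArg (fun M => M.map (PowerSeries.coeff 1)) h
  simp only [map_coeff_one_mul, h1, map_coeff_zero_inverse h h1, one_mul, mul_one] at this
  rw [← extM_one, map_coeff_one_extM] at this
  exact eq_neg_of_add_eq_zero_left this

theorem ofPower_injective {d : ℕ} [NeZero d] : Function.Injective (ofPower d) := by
  intro p q h
  ext k
  rw [← coeff_ofPower_natCast (d := d), h, coeff_ofPower_natCast]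

theorem smul_unit_cancel {n R : Type*} [CommRing R] (u : Rˣ) {M M' : Matrix n n R}
    (h : (u : R) • M = (u : R) • M') : M = M' := by
  have := congrArg (fun M => ((u⁻¹ : Rˣ) : R) • M) h
  simpa only [smul_smul, Units.inv_mul, one_smul] using this

/-- On a diagonal block `z^T` is an invertible scalar and cancels. -/
theorem extM_eigenProj_congr {n : Type*} [Fintype n] [DecidableEq n] {R : Type*} [CommRing R]
    [Algebra ℂ R] {d : ℕ} {T : Matrix n n ℂ} (hT : IsFractional d T) (t : Rˣ) {k : ℂ}
    (hk : k ∈ eigenvalues T) {M M' : Matrix n n R} (h : M * zPow d T t = zPow d T t * M') :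
    extM R (eigenProj T k) * M * extM R (eigenProj T k) =
      extM R (eigenProj T k) * M' * extM R (eigenProj T k) := by
  have := congrArg (fun M => extM R (eigenProj T k) * M * extM R (eigenProj T k)) h
  rw [mul_assoc, mul_assoc M, zPow_mul_extM_eigenProj hT t hk, ← mul_assoc (extM R _) (zPow d T t),
    extM_eigenProj_mul_zPow hT t hk, mul_smul_comm, mul_smul_comm, smul_mul_assoc, smul_mul_assoc]
    at this
  rw [mul_assoc, smul_unit_cancel _ this]

theorem exp_mul_mul_exp_neg_of_commute {n : Type*} [Fintype n] [DecidableEq n] {x w : Matrix n n ℂ}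
    (hx : IsNilpotent x) (h : x * w = w * x) :
    IsNilpotent.exp x * w * IsNilpotent.exp (-x) = w := by
  have h0 : ⁅x, w⁆ = 0 := by rw [Ring.lie_def, h, sub_self]
  rw [exp_mul_mul_exp_neg hx (by rw [h0, lie_zero, lie_zero]), h0, lie_zero, smul_zero, add_zero,
    add_zero]

namespace CoweightData

variable {N : ℕ} {G : Subgroup (GL (Fin N) ℂ)} {𝔤 : LieSubalgebra ℂ (Matrix (Fin N) (Fin N) ℂ)}
  {d : ℕ} [NeZero d] {μ : Matrix (Fin N) (Fin N) ℂ} (H : CoweightData G 𝔤 d μ)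
include H

theorem lie_plusPart_mem {β : Matrix (Fin N) (Fin N) ℂ} (hβ : β ∈ 𝔤) :
    plusPart μ β ∈ 𝔤 ∧ ⁅μ, plusPart μ β⁆ = plusPart μ β := by
  constructor
  · rw [plusPart]
    exact 𝔤.smul_mem _ (𝔤.add_mem (𝔤.lie_mem H.mem (𝔤.lie_mem H.mem hβ)) (𝔤.lie_mem H.mem hβ))
  · exact congrArg Subtype.val
      (lie_plusPart (T := (⟨μ, H.mem⟩ : 𝔤)) (fun x => Subtype.ext (H.cube x x.2)) ⟨β, hβ⟩)

theorem neg_cube : ∀ x ∈ 𝔤, ⁅-μ, ⁅-μ, ⁅-μ, x⁆⁆⁆ = ⁅-μ, x⁆ := by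
  intro x hx
  simp only [neg_lie, lie_neg, neg_neg, H.cube x hx]

theorem lie_plusPart_neg_mem {β : Matrix (Fin N) (Fin N) ℂ} (hβ : β ∈ 𝔤) :
    plusPart (-μ) β ∈ 𝔤 ∧ ⁅μ, plusPart (-μ) β⁆ = -plusPart (-μ) β := by
  constructor
  · rw [plusPart]
    have h := 𝔤.neg_mem H.mem
    exact 𝔤.smul_mem _ (𝔤.add_mem (𝔤.lie_mem h (𝔤.lie_mem h hβ)) (𝔤.lie_mem h hβ))
  · have := congrArg Subtype.val (lie_plusPart (T := (⟨-μ, 𝔤.neg_mem H.mem⟩ : 𝔤))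
      (fun x => Subtype.ext (H.neg_cube x x.2)) ⟨β, hβ⟩)
    change ⁅-μ, plusPart (-μ) β⁆ = plusPart (-μ) β at this
    rw [neg_lie] at this
    rw [← this, neg_neg, this]

/-- A constant loop in the double coset at infinity which centralizes `𝔤` is trivial. -/
theorem eq_one_of_coset {c0 x y : Matrix (Fin N) (Fin N) ℂ} (hx : ⁅μ, x⁆ = x) (hy : ⁅μ, y⁆ = -y)
    (hc0 : c0 * μ = μ * c0) {C D : Matrix (Fin N) (Fin N) (PowerSeries ℂ)}
    {C' : Matrix (Fin N) (Fin N) (PowerSeries ℂ)} (hCC : C' * C = 1)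
    (hC1' : C'.map (PowerSeries.coeff 0) = 1) (hD1 : D.map (PowerSeries.coeff 0) = 1)
    (h : extM _ (IsNilpotent.exp x * c0) * zPow d μ tUnit⁻¹ * extM _ (IsNilpotent.exp y) =
      C.map (ofPowerAlg d) * zPow d μ tUnit⁻¹ * D.map (ofPowerAlg d)) : c0 = 1 := by
  have hcomm : ∀ k, c0 * eigenProj μ k = eigenProj μ k * c0 := by
    intro k
    rw [eigenProj, Polynomial.aeval_eq_sum_range]
    exact Commute.sum_right _ _ _ fun i _ =>
      ((show Commute c0 μ from hc0).pow_right i).smul_right _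
  have key : ∀ k ∈ eigenvalues μ, eigenProj μ k * c0 = eigenProj μ k := by
    intro k hk
    let P := eigenProj μ k
    have hPx : P * IsNilpotent.exp x * P = P :=
      HasWeight.eigenProj_exp H.frac (a := 1) one_ne_zero
        (HasWeight.extend (R := ℂ) (by rw [← Ring.lie_def, hx, one_smul])) hk
    have hPy : P * IsNilpotent.exp (-y) * P = P :=
      HasWeight.eigenProj_exp H.frac (a := -1) (by norm_num)
        (HasWeight.extend (R := ℂ) (M := -y) (by rw [← Ring.lie_def, lie_neg, hy, neg_one_smul])) hk
    have e1 : IsNilpotent.exp y * IsNilpotent.exp (-y) = 1 :=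
      IsNilpotent.exp_mul_exp_neg_self (H.isNilpotent_minus hy)
    have e2 : C'.map (ofPowerAlg d) * C.map (ofPowerAlg d) = 1 := by
      rw [← Matrix.map_mul, hCC, Matrix.map_one _ (map_zero _) (map_one _)]
    have h1 : C'.map (ofPowerAlg d) * extM _ (IsNilpotent.exp x * c0) * zPow d μ tUnit⁻¹ =
        zPow d μ tUnit⁻¹ * (D.map (ofPowerAlg d) * extM _ (IsNilpotent.exp (-y))) := by
      calc _ = C'.map (ofPowerAlg d) * (extM _ (IsNilpotent.exp x * c0) * zPow d μ tUnit⁻¹ *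
            extM _ (IsNilpotent.exp y)) * extM _ (IsNilpotent.exp (-y)) := by
            rw [mul_assoc _ _ (extM _ (IsNilpotent.exp (-y))),
              mul_assoc _ _ (extM _ (IsNilpotent.exp (-y))), ← extM_mul, e1, extM_one, mul_one,
              mul_assoc]
        _ = (C'.map (ofPowerAlg d) * C.map (ofPowerAlg d)) * zPow d μ tUnit⁻¹ *
            D.map (ofPowerAlg d) * extM _ (IsNilpotent.exp (-y)) := by
            rw [h]; simp only [mul_assoc]
        _ = _ := by rw [e2, one_mul, mul_assoc]
    -- The diagonal block at `k` no longer contains `z^μ`, so it is an identity of power series in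
    -- `w` and may be read off at `w = 0`. There `C'` and `D` become 1, and the diagonal blocks of
    -- `e^x` and `e^{-y}` are identities, so `c0` is the identity on this block.
    have h2 := extM_eigenProj_congr H.frac tUnit⁻¹ hk h1
    have h3 : extM _ P * (C' * extM _ (IsNilpotent.exp x * c0)) * extM _ P =
        extM _ P * (D * extM _ (IsNilpotent.exp (-y))) * extM _ P := by
      refine Matrix.map_injective (ofPower_injective (d := d)) ?_
      simpa only [← coe_ofPowerAlg, Matrix.map_mul, extM_map] using h2
    have h4 := congrArg (fun M => M.map (PowerSeries.coeff 0)) h3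
    simp only [map_coeff_zero_mul, map_coeff_zero_extM, hC1', hD1] at h4
    rw [one_mul, one_mul, hPy, mul_assoc P, mul_assoc _ c0, hcomm, ← mul_assoc _ (eigenProj μ k),
      ← mul_assoc, ← mul_assoc, hPx] at h4
    exact h4
  rw [← one_mul c0, ← sum_eigenProj H.frac, Finset.sum_mul]
  exact Finset.sum_congr rfl key

/-- The exponents are read off from the first order terms at infinity. What is left of `L` after
removing `e^x z^μ e^{-y'}` is shown to centralize `𝔤`, then to be constant, then to be 1. -/
theorem exists_eq_expForm {L : Matrix (Fin N) (Fin N) ℂ[T;T⁻¹]}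
    (hL : L ∈ phaseSpaceFormal G d μ (-μ)) : ∃ x ∈ 𝔤, ∃ y ∈ 𝔤, ⁅μ, x⁆ = x ∧ ⁅μ, y⁆ = -y ∧
      L = expForm d μ TUnit x y := by
  obtain ⟨⟨A, hA, B, hB, hL0⟩, C, hC, D, hD, hC1, hD1, hLi⟩ := hL
  rw [neg_neg] at hLi
  obtain ⟨L', hLL⟩ := exists_inverse_of_expand H.frac hL0 hLi hC1 hD1
  have hLL' : L' * L = 1 := mul_eq_one_comm.1 hLL
  obtain ⟨A', hAA, hAA', hAn, hAn'⟩ := exists_inverse_of_mem_points H.isLieAlgebra hA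
  obtain ⟨B', hBB, hBB', hBn, hBn'⟩ := exists_inverse_of_mem_points H.isLieAlgebra hB
  obtain ⟨C', hCC, hCC', hCn, hCn'⟩ := exists_inverse_of_mem_points H.isLieAlgebra hC
  obtain ⟨D', hDD, hDD', hDn, hDn'⟩ := exists_inverse_of_mem_points H.isLieAlgebra hD
  have hC𝔤 := coeff_one_mem H.isAlgebraic H.isLieAlgebra hC hC1
  have hD𝔤 := coeff_one_mem H.isAlgebraic H.isLieAlgebra hD hD1
  rw [← map_coeff_zero_eq] at hC1 hD1
  have hC1' := map_coeff_zero_inverse hCC hC1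
  have hD1' := map_coeff_zero_inverse hDD hD1
  have hinv : ∀ (s : (LaurentSeries ℂ)ˣ) {φ : ℂ[T;T⁻¹] →+* LaurentSeries ℂ}
      {A A' B B' : Matrix (Fin N) (Fin N) (PowerSeries ℂ)} (_ : A * A' = 1) (_ : B * B' = 1)
      (_ : L.map φ = A.map (ofPower d) * zPow d μ s * B.map (ofPower d)),
      L'.map φ = B'.map (ofPower d) * zPow d μ s⁻¹ * A'.map (ofPower d) := by
    intro s φ A A' B B' hA hB h
    have h1 : ∀ {M M' : Matrix (Fin N) (Fin N) (PowerSeries ℂ)}, M * M' = 1 →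
        M.map (ofPower d) * M'.map (ofPower d) = 1 := fun h => by
      rw [← Matrix.map_mul, h, Matrix.map_one _ (map_zero _) (map_one _)]
    refine left_inv_eq_right_inv (a := L.map φ) ?_ ?_
    · rw [← Matrix.map_mul, hLL', Matrix.map_one _ (map_zero _) (map_one _)]
    · rw [h]
      calc _ = A.map (ofPower d) * (zPow d μ s * (B.map (ofPower d) * B'.map (ofPower d)) *
            zPow d μ s⁻¹) * A'.map (ofPower d) := by simp only [mul_assoc]
        _ = 1 := by rw [h1 hB, mul_one, zPow_mul_zPow_inv H.frac, mul_one, h1 hA]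
  have hL0' := hinv _ hAA hBB hL0
  have hLi' := hinv _ hCC hDD hLi
  have hZ : IsZConj d μ tUnit (zPow d μ tUnit) (zPow d μ tUnit⁻¹) := .zPow H.frac _
  have hZ' : IsZConj d (-μ) tUnit (zPow d μ tUnit⁻¹) (zPow d μ tUnit) := by
    have := (IsZConj.zPow H.frac tUnit⁻¹).neg
    rwa [inv_inv] at this
  have hW : IsZConj d μ tUnit⁻¹ (zPow d μ tUnit⁻¹) (zPow d μ tUnit⁻¹⁻¹) := .zPow H.frac _
  have hW' : IsZConj d (-μ) tUnit⁻¹ (zPow d μ tUnit⁻¹⁻¹) (zPow d μ tUnit⁻¹) := by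
    have := (IsZConj.zPow H.frac tUnit).neg
    rwa [inv_inv]
  have hC'𝔤 : C'.map (PowerSeries.coeff 1) ∈ 𝔤 := by
    rw [map_coeff_one_inverse hCC hC1]
    exact 𝔤.neg_mem hC𝔤
  obtain ⟨hx𝔤, hx⟩ := H.lie_plusPart_mem hD𝔤
  obtain ⟨hy𝔤, hy⟩ := H.lie_plusPart_neg_mem hC'𝔤
  -- For `L = e^x z^μ e^y`, `expForm_eq` gives `D = e^{wx}` and `C = e^x e^{wy} e^{-x}` as possible
  -- factors. So `x` is sought in the first coefficient of `D`, and `-y` in the weight -1 part of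
  -- the first coefficient of `C⁻¹`.
  set x := plusPart μ ((D : Matrix (Fin N) (Fin N) (PowerSeries ℂ)).map (PowerSeries.coeff 1)) with hxd
  set y' := plusPart (-μ) (C'.map (PowerSeries.coeff 1)) with hyd
  have hconj : ∀ w ∈ 𝔤, ⁅μ, w⁆ = -w → L * extM _ w * L' = (LaurentPolynomial.T (-d) : ℂ[T;T⁻¹]) •
      extM _ (IsNilpotent.exp x * w * IsNilpotent.exp (-x)) := fun w hw hμw =>
    laurent_conj_eq H.cube H.mem hZ hW hL0 hL0' hLi hLi' hBn hDn hDD' hC1 hC1' hD1 hD1' hD𝔤 hw hμw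
      hxd.symm (H.isNilpotent_plus hx)
  have hconj' : ∀ w ∈ 𝔤, ⁅μ, w⁆ = w → L' * extM _ w * L = (LaurentPolynomial.T (-d) : ℂ[T;T⁻¹]) •
      extM _ (IsNilpotent.exp y' * w * IsNilpotent.exp (-y')) := fun w hw hμw =>
    -- The same formula with `-μ` in place of `μ`, and with the roles of `L` and its inverse
    -- exchanged.
    laurent_conj_eq H.neg_cube (𝔤.neg_mem H.mem) hZ' hW' hL0' hL0 hLi' hLi hAn' hCn' hCC hD1' hD1 hC1'
      hC1 hC'𝔤 hw (by rw [neg_lie, hμw]) hyd.symm (H.isNilpotent_minus hy)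
  have hxn := H.isNilpotent_plus hx
  have hyn := H.isNilpotent_minus hy
  let E (w : Matrix (Fin N) (Fin N) ℂ) : Matrix (Fin N) (Fin N) ℂ[T;T⁻¹] := extM _ (IsNilpotent.exp w)
  have hE : ∀ {w : Matrix (Fin N) (Fin N) ℂ}, IsNilpotent w → E w * E (-w) = 1 ∧ E (-w) * E w = 1 :=
    fun hw => by
      simp only [E, ← extM_mul, IsNilpotent.exp_mul_exp_neg_self hw,
        IsNilpotent.exp_neg_mul_exp_self hw, extM_one, and_self]
  obtain ⟨hEx, hEx'⟩ := hE hxn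
  obtain ⟨hEy, hEy'⟩ := hE hyn
  set Z := zPow d μ TUnit with hZdef
  set Zi := zPow d μ TUnit⁻¹ with hZidef
  have hZZ : Z * Zi = 1 := zPow_mul_zPow_inv H.frac _
  have hZZ' : Zi * Z = 1 := zPow_inv_mul_zPow H.frac _
  have hT1 : (LaurentPolynomial.T d : ℂ[T;T⁻¹]) * LaurentPolynomial.T (-d) = 1 := by
    rw [← LaurentPolynomial.T_add, add_neg_cancel, LaurentPolynomial.T_zero]
  have hTU : ((TUnit ^ d : (ℂ[T;T⁻¹])ˣ) : ℂ[T;T⁻¹]) = LaurentPolynomial.T d := by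
    rw [Units.val_pow_eq_pow_val]
    change LaurentPolynomial.T 1 ^ d = _
    rw [LaurentPolynomial.T_pow, mul_one]
  set c := E (-x) * L * E y' * Zi with hc
  set c' := Z * E (-y') * L' * E x with hc'
  have hcc : c * c' = 1 := by
    calc c * c' = E (-x) * (L * (E y' * (Zi * Z) * E (-y')) * L') * E x := by
          rw [hc, hc']; simp only [mul_assoc]
      _ = 1 := by rw [hZZ', mul_one, hEy, mul_one, hLL, mul_one, hEx']
  have hcc' : c' * c = 1 := mul_eq_one_comm.1 hcc
  have hcomm : ∀ w ∈ 𝔤, c * extM _ w = extM _ w * c := by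
    -- Constant matrices that commute with `c` form a Lie subalgebra, so charges 1 and -1 suffice.
    -- For charge 1 the formula for `L⁻¹ w L` is used, for charge -1 the one for `L w L⁻¹`. In both
    -- cases the power of `z` from `z^μ` cancels the one in the formula.
    refine H.generated (commutant c) (fun w hw hμw => ?_) (fun w hw hμw => ?_)
    · rw [mem_commutant]
      have : c' * extM _ w * c = extM _ w := by
        calc c' * extM _ w * c = Z * E (-y') * (L' * (E x * extM _ w * E (-x)) * L) * E y' * Zi := by
              rw [hc, hc']; simp only [mul_assoc]
          _ = (LaurentPolynomial.T (-d) : ℂ[T;T⁻¹]) • (Z * ((E (-y') * E y') * extM _ w *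
                (E (-y') * E y')) * Zi) := by
              rw [← extM_mul, ← extM_mul, exp_mul_mul_exp_neg_of_commute hxn
                (H.commute_of_weight_one hx𝔤 hw hx hμw), hconj' w hw hμw, mul_smul_comm,
                smul_mul_assoc, smul_mul_assoc, extM_mul, extM_mul]
              simp only [E, mul_assoc]
          _ = _ := by
              rw [hEy', one_mul, mul_one, H.zPow_mul_plus hμw, smul_mul_assoc, mul_assoc, hZZ, mul_one,
                smul_smul, hTU, mul_comm, hT1, one_smul]
      calc c * extM _ w = c * (c' * extM _ w * c) := by rw [this]
        _ = (c * c') * extM _ w * c := by simp only [mul_assoc]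
        _ = _ := by rw [hcc, one_mul]
    · rw [mem_commutant]
      have : c * extM _ w * c' = extM _ w := by
        have hz : Zi * extM _ w * Z = (LaurentPolynomial.T d : ℂ[T;T⁻¹]) • extM _ w := by
          rw [mul_assoc, ← H.zPow_mul_minus hμw, mul_smul_comm, ← mul_assoc, hZZ', one_mul, hTU]
        calc c * extM _ w * c' = E (-x) * L * E y' * (Zi * extM _ w * Z) * E (-y') * L' * E x := by
              rw [hc, hc']; simp only [mul_assoc]
          _ = (LaurentPolynomial.T d : ℂ[T;T⁻¹]) •
                (E (-x) * (L * (E y' * extM _ w * E (-y')) * L') * E x) := by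
              rw [hz]
              simp only [mul_smul_comm, smul_mul_assoc, mul_assoc]
          _ = (E (-x) * E x) * extM _ w * (E (-x) * E x) := by
              rw [← extM_mul, ← extM_mul, exp_mul_mul_exp_neg_of_commute hyn
                (H.commute_of_weight_neg_one hy𝔤 hw hy hμw), hconj w hw hμw, mul_smul_comm,
                smul_mul_assoc, smul_smul, hT1, one_smul, extM_mul, extM_mul]
              simp only [E, mul_assoc]
          _ = _ := by rw [hEx', one_mul, mul_one]
      calc c * extM _ w = c * extM _ w * (c' * c) := by rw [hcc', mul_one]
        _ = (c * extM _ w * c') * c := by simp only [mul_assoc]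
        _ = _ := by rw [this]
  have hz0 : ∀ s : (LaurentSeries ℂ)ˣ, Zi.map (laurentEval s) = zPow d μ s⁻¹ := fun s => by
    rw [hZidef, map_zPow, map_inv, map_laurentEval_TUnit]
  have hcG : IsPoint G c := by
    -- The equations of `G` are checked after the injective expansion at 0, where `L` is a product
    -- of points of `G`.
    refine IsPoint.of_map expandZeroAlg expandZero_injective ?_
    have e : c.map expandZeroAlg = extM _ (IsNilpotent.exp (-x)) * (A.1.map (ofPowerAlg d) *
        zPow d μ tUnit * B.1.map (ofPowerAlg d)) * extM _ (IsNilpotent.exp y') * zPow d μ tUnit⁻¹ := by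
      rw [coe_ofPowerAlg, ← hL0, hc, Matrix.map_mul, Matrix.map_mul, Matrix.map_mul, extM_map, extM_map]
      rw [show Zi.map expandZeroAlg = zPow d μ tUnit⁻¹ from hz0 tUnit]
      rfl
    rw [e]
    have hzp : ∀ s : (LaurentSeries ℂ)ˣ, IsPoint G (zPow d μ s) :=
      fun s => isPoint_zPow H.isLieAlgebra (NeZero.ne d) H.mem H.frac s
    exact (((H.isPoint_extM_exp (𝔤.neg_mem hx𝔤) hxn.neg).mul
      ((IsPoint.mul (IsPoint.map hA _) (hzp _)).mul (IsPoint.map hB _))).mul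
      (H.isPoint_extM_exp hy𝔤 hyn)).mul (hzp _)
  obtain ⟨c0, hc0⟩ := exists_eq_extM_of_commute H.isAlgebraic H.isLieAlgebra H.center hcG hcc hcomm
  have hLc : L = extM _ (IsNilpotent.exp x * c0) * Z * extM _ (IsNilpotent.exp (-y')) := by
    calc L = (E x * E (-x)) * L * (E y' * (Zi * Z) * E (-y')) := by
          rw [hZZ', mul_one, hEy, mul_one, hEx, one_mul]
      _ = E x * c * Z * E (-y') := by rw [hc]; simp only [mul_assoc]
      _ = _ := by rw [hc0, extM_mul]
  have hc0μ : c0 * μ = μ * c0 := by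
    have := congrArg (fun M => M.map (laurentEval (1 : ℂˣ))) (hcomm μ H.mem)
    simp only [hc0, Matrix.map_mul, extM_map] at this
    exact this
  have hc01 : c0 = 1 := by
    refine H.eq_one_of_coset (y := -y') hx (by rw [lie_neg, hy]) hc0μ hCC' hC1' hD1 ?_
    rw [coe_ofPowerAlg, ← hLi, hLc, ← coe_expandInftyAlg, Matrix.map_mul, Matrix.map_mul, extM_map,
      extM_map]
    have : Z.map expandInftyAlg = zPow d μ tUnit⁻¹ := by
      rw [hZdef, map_zPow, expandInftyAlg, map_laurentEval_TUnit]
    rw [this]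
  refine ⟨x, hx𝔤, -y', 𝔤.neg_mem hy𝔤, hx, by rw [lie_neg, hy], ?_⟩
  rw [hLc, hc01, mul_one, expForm]

end CoweightData

/-! ### Intertwining and injectivity properties of the nilpotent exponential. -/

section Exponential

variable {A : Type*} [Ring A] [Module ℚ A]

theorem exp_mul_eq_mul_exp {a b z : A} (ha : IsNilpotent a) (hb : IsNilpotent b)
    [SMulCommClass ℚ A A] [IsScalarTower ℚ A A] (h : a * z = z * b) :
    IsNilpotent.exp a * z = z * IsNilpotent.exp b := by
  obtain ⟨k, hk⟩ := ha
  obtain ⟨l, hl⟩ := hb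
  rw [IsNilpotent.exp_eq_sum (pow_eq_zero_of_le (le_max_left k l) hk),
    IsNilpotent.exp_eq_sum (pow_eq_zero_of_le (le_max_right k l) hl), Finset.sum_mul, Finset.mul_sum]
  refine Finset.sum_congr rfl fun i _ => ?_
  rw [smul_mul_assoc, mul_smul_comm, ((show SemiconjBy z b a from h.symm).pow_right i).eq]

/-- `e^u - 1 = u (1 + u s)` with `s` a polynomial in `u`, and the second factor is a unit because `u
s` is nilpotent. -/
theorem eq_zero_of_exp_eq_one [SMulCommClass ℚ A A] [IsScalarTower ℚ A A] {u : A}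
    (hu : IsNilpotent u) (h : IsNilpotent.exp u = 1) : u = 0 := by
  obtain ⟨k, hk⟩ := hu
  let s : A := ∑ i ∈ Finset.range k, (((i + 2).factorial : ℚ)⁻¹) • u ^ i
  have hs : Commute u s := Commute.sum_right _ _ _ fun i _ =>
    ((Commute.refl u).pow_right i).smul_right _
  rw [IsNilpotent.exp_eq_sum (pow_eq_zero_of_le (Nat.le_add_right k 2) hk), Finset.sum_range_succ',
    Finset.sum_range_succ'] at h
  have h1 : u * (1 + u * s) = 0 := by
    simp only [s, Finset.mul_sum, mul_add, mul_one, mul_smul_comm, ← pow_succ']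
    simp only [zero_add, Nat.factorial_zero, Nat.factorial_one, pow_zero, pow_one, Nat.cast_one,
      inv_one, one_smul, add_eq_right] at h
    rw [add_comm]
    exact h
  have h2 : IsUnit (1 + u * s) :=
    IsNilpotent.isUnit_one_add (hs.isNilpotent_mul_right ⟨k, hk⟩)
  exact (h2.mul_left_eq_zero).1 h1

end Exponential

section ExpForm

variable {N : ℕ} {d : ℕ} {μ : Matrix (Fin N) (Fin N) ℂ} {R : Type*} [CommRing R] [Algebra ℂ R]

theorem extM_exp [Module ℚ (Matrix (Fin N) (Fin N) R)] (x : Matrix (Fin N) (Fin N) ℂ) (hx : IsNilpotent x) :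
    extM R (IsNilpotent.exp x) = IsNilpotent.exp (extM R x) :=
  IsNilpotent.map_exp hx (RingHom.mapMatrix (algebraMap ℂ R))

theorem expForm_map {S : Type*} [CommRing S] [Algebra ℂ S] (φ : R →ₐ[ℂ] S) (t : Rˣ)
    (x y : Matrix (Fin N) (Fin N) ℂ) :
    (expForm d μ t x y).map φ = expForm d μ (Units.map (φ : R →* S) t) x y := by
  rw [expForm, Matrix.map_mul, Matrix.map_mul, extM_map, extM_map, map_zPow, expForm]

theorem expForm_expandZero (x y : Matrix (Fin N) (Fin N) ℂ) :
    (expForm d μ TUnit x y).map expandZero = expForm d μ tUnit x y := by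
  rw [← coe_expandZeroAlg, expForm_map, expandZeroAlg, map_laurentEval_TUnit]

theorem expForm_expandInfty (x y : Matrix (Fin N) (Fin N) ℂ) :
    (expForm d μ TUnit x y).map expandInfty = expForm d μ tUnit⁻¹ x y := by
  rw [← coe_expandInftyAlg, expForm_map, expandInftyAlg, map_laurentEval_TUnit]

/-- An invertible point as an element of `G(R)`. -/
theorem exists_points {G : Subgroup (GL (Fin N) ℂ)} {M M' : Matrix (Fin N) (Fin N) R}
    (hM : IsPoint G M) (h : M * M' = 1) : ∃ g ∈ Points G R, (g : Matrix (Fin N) (Fin N) R) = M :=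
  ⟨⟨M, M', h, mul_eq_one_comm.1 h⟩, hM, rfl⟩

end ExpForm

namespace CoweightData

variable {N : ℕ} {G : Subgroup (GL (Fin N) ℂ)} {𝔤 : LieSubalgebra ℂ (Matrix (Fin N) (Fin N) ℂ)}
  {d : ℕ} [NeZero d] {μ : Matrix (Fin N) (Fin N) ℂ} (H : CoweightData G 𝔤 d μ)
  {R : Type*} [CommRing R] [Algebra ℂ R] [Module ℚ (Matrix (Fin N) (Fin N) R)]
  [SMulCommClass ℚ (Matrix (Fin N) (Fin N) R) (Matrix (Fin N) (Fin N) R)]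
  [IsScalarTower ℚ (Matrix (Fin N) (Fin N) R) (Matrix (Fin N) (Fin N) R)]
include H

variable {x y : Matrix (Fin N) (Fin N) ℂ} {t : Rˣ} {r : R}

theorem exp_mul_zPow (hx : ⁅μ, x⁆ = x) (hr : r * ((t ^ d : Rˣ) : R) = 1) :
    extM R (IsNilpotent.exp x) * zPow d μ t = zPow d μ t * IsNilpotent.exp (r • extM R x) := by
  have hn := H.isNilpotent_plus hx
  rw [extM_exp x hn]
  refine exp_mul_eq_mul_exp (hn.map (RingHom.mapMatrix (algebraMap ℂ R))) (isNilpotent_ext_smul hn r) ?_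
  rw [mul_smul_comm, H.zPow_mul_plus hx, smul_smul, hr, one_smul]

theorem zPow_mul_exp (hy : ⁅μ, y⁆ = -y) (hr : r * ((t ^ d : Rˣ) : R) = 1) :
    IsNilpotent.exp (r • extM R y) * zPow d μ t = zPow d μ t * extM R (IsNilpotent.exp y) := by
  have hn := H.isNilpotent_minus hy
  rw [extM_exp y hn]
  refine exp_mul_eq_mul_exp (isNilpotent_ext_smul hn r) (hn.map (RingHom.mapMatrix (algebraMap ℂ R))) ?_
  rw [smul_mul_assoc, ← H.zPow_mul_minus hy t, smul_smul, hr, one_smul]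

/-- With `r = z⁻¹`, moving `e^y` to the left of `z^μ` and `e^x` to the right scales both exponents
by `r`. Inserting `e^{-x} e^x` makes the left factor conjugate to `e^{ry}`, so that both outer
factors become 1 at infinity. -/
theorem expForm_eq (hx : ⁅μ, x⁆ = x) (hy : ⁅μ, y⁆ = -y) (hr : r * ((t ^ d : Rˣ) : R) = 1) :
    expForm d μ t x y = (extM R (IsNilpotent.exp x) * IsNilpotent.exp (r • extM R y) *
      extM R (IsNilpotent.exp (-x))) * zPow d μ t * IsNilpotent.exp (r • extM R x) := by
  have e : extM R (IsNilpotent.exp (-x)) * extM R (IsNilpotent.exp x) = 1 := by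
    rw [← extM_mul, IsNilpotent.exp_neg_mul_exp_self (H.isNilpotent_plus hx), extM_one]
  rw [expForm, mul_assoc, ← H.zPow_mul_exp hy hr, mul_assoc _ (zPow d μ t), ← H.exp_mul_zPow hx hr]
  calc _ = extM R (IsNilpotent.exp x) * IsNilpotent.exp (r • extM R y) * 1 * zPow d μ t := by
        rw [mul_one, mul_assoc]
    _ = _ := by rw [← e]; simp only [mul_assoc]

end CoweightData

/-- The constant coefficient as an algebra homomorphism. -/
def constantCoeffAlg : PowerSeries ℂ →ₐ[ℂ] ℂ :=
  { PowerSeries.constantCoeff (R := ℂ) with commutes' := fun c => PowerSeries.constantCoeff_C c }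

/-- The substitution `w ↦ t ^ (-d)`. -/
def polyInvToLaurent (d : ℕ) : ℂ[X] →ₐ[ℂ] ℂ[T;T⁻¹] :=
  Polynomial.aeval (LaurentPolynomial.T (-(d : ℤ)))

theorem ofPolyInvAlg_eq (d : ℕ) :
    ofPolyInvAlg d = expandZeroAlg.comp (polyInvToLaurent d) := by
  refine Polynomial.algHom_ext ?_
  rw [AlgHom.comp_apply, polyInvToLaurent, Polynomial.aeval_X, expandZeroAlg, laurentEval_T,
    ofPolyInvAlg, Polynomial.aeval_X]

/-- `ℂ[w] → ℂ[[w]]`. -/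
def polyToPower : ℂ[X] →ₐ[ℂ] PowerSeries ℂ := Polynomial.aeval PowerSeries.X

theorem constantCoeff_polyToPower (p : ℂ[X]) :
    PowerSeries.constantCoeff (polyToPower p) = p.eval 0 := by
  have : constantCoeffAlg.comp polyToPower = Polynomial.aeval (0 : ℂ) := by
    refine Polynomial.algHom_ext ?_
    rw [AlgHom.comp_apply, polyToPower, Polynomial.aeval_X, Polynomial.aeval_X]
    exact PowerSeries.constantCoeff_X
  rw [← Polynomial.coe_aeval_eq_eval, ← this]
  rfl

theorem expandInfty_polyInvToLaurent (d : ℕ) [NeZero d] :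
    expandInftyAlg.comp (polyInvToLaurent d) = (ofPowerAlg d).comp polyToPower := by
  refine Polynomial.algHom_ext ?_
  rw [AlgHom.comp_apply, polyInvToLaurent, Polynomial.aeval_X, expandInftyAlg, laurentEval_T,
    AlgHom.comp_apply, polyToPower, Polynomial.aeval_X, ofPowerAlg_X_tUnit, inv_zpow', neg_neg,
    zpow_natCast, Units.val_pow_eq_pow_val]

namespace CoweightData

variable {N : ℕ} {G : Subgroup (GL (Fin N) ℂ)} {𝔤 : LieSubalgebra ℂ (Matrix (Fin N) (Fin N) ℂ)}
  {d : ℕ} [NeZero d] {μ : Matrix (Fin N) (Fin N) ℂ} (H : CoweightData G 𝔤 d μ)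
include H

variable {x y : Matrix (Fin N) (Fin N) ℂ}

theorem exists_points_exp {R : Type*} [CommRing R] [Algebra ℂ R] (hx𝔤 : x ∈ 𝔤)
    (hn : IsNilpotent x) :
    ∃ g ∈ Points G R, (g : Matrix (Fin N) (Fin N) R) = extM R (IsNilpotent.exp x) :=
  exists_points (H.isPoint_extM_exp hx𝔤 hn)
    (by rw [← extM_mul, IsNilpotent.exp_mul_exp_neg_self hn, extM_one])

theorem expForm_mem_cosetZero (hx𝔤 : x ∈ 𝔤) (hy𝔤 : y ∈ 𝔤) (hx : ⁅μ, x⁆ = x) (hy : ⁅μ, y⁆ = -y) :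
    expForm d μ tUnit x y ∈ cosetZero G d μ := by
  obtain ⟨A, hA, hAe⟩ := H.exists_points_exp (R := PowerSeries ℂ) hx𝔤 (H.isNilpotent_plus hx)
  obtain ⟨B, hB, hBe⟩ := H.exists_points_exp (R := PowerSeries ℂ) hy𝔤 (H.isNilpotent_minus hy)
  refine ⟨A, hA, B, hB, ?_⟩
  rw [hAe, hBe, ← coe_ofPowerAlg, extM_map, extM_map, expForm]

/-- The form of the elements of the phase space near infinity. -/
theorem exists_expForm_eq {R S : Type} [CommRing R] [Algebra ℂ R] [CommRing S] [Algebra ℂ S]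
    (φ : S →ₐ[ℂ] R) (ev : S →ₐ[ℂ] ℂ) {w : S} (hw : ev w = 0) {t : Rˣ}
    (hr : φ w * ((t ^ d : Rˣ) : R) = 1)
    (hx𝔤 : x ∈ 𝔤) (hy𝔤 : y ∈ 𝔤) (hx : ⁅μ, x⁆ = x) (hy : ⁅μ, y⁆ = -y) :
    ∃ C ∈ Points G S, ∃ D ∈ Points G S, C.1.map ev = 1 ∧ D.1.map ev = 1 ∧
      expForm d μ t x y = C.1.map φ * zPow d μ t * D.1.map φ := by
  -- The nilpotent exponential needs rational scalars, which are obtained from `ℂ`.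
  let _ : Algebra ℚ S := ((algebraMap ℂ S).comp (algebraMap ℚ ℂ)).toAlgebra
  let _ : Algebra ℚ R := ((algebraMap ℂ R).comp (algebraMap ℚ ℂ)).toAlgebra
  have hxn := H.isNilpotent_plus hx
  have hyn := H.isNilpotent_minus hy
  have h1 : ∀ z : Matrix (Fin N) (Fin N) ℂ, IsNilpotent z →
      IsNilpotent.exp (w • extM S z) * IsNilpotent.exp (-(w • extM S z)) = 1 := fun z hz =>
    IsNilpotent.exp_mul_exp_neg_self (isNilpotent_ext_smul hz w)
  have h2 : extM S (IsNilpotent.exp x) * extM S (IsNilpotent.exp (-x)) = 1 := by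
    rw [← extM_mul, IsNilpotent.exp_mul_exp_neg_self hxn, extM_one]
  have h3 : extM S (IsNilpotent.exp (-x)) * extM S (IsNilpotent.exp x) = 1 := by
    rw [← extM_mul, IsNilpotent.exp_neg_mul_exp_self hxn, extM_one]
  -- `C = e^x e^{wy} e^{-x}`. The explicit `M'` is its inverse.
  obtain ⟨C, hC, hCe⟩ := exists_points
    (((H.isPoint_extM_exp (R := S) hx𝔤 hxn).mul (isPoint_exp_smul H.isLieAlgebra hy𝔤 hyn w)).mul
      (H.isPoint_extM_exp (𝔤.neg_mem hx𝔤) hxn.neg))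
    (M' := extM S (IsNilpotent.exp x) * IsNilpotent.exp (-(w • extM S y)) *
      extM S (IsNilpotent.exp (-x))) (by
      calc _ = extM S (IsNilpotent.exp x) * (IsNilpotent.exp (w • extM S y) *
            (extM S (IsNilpotent.exp (-x)) * extM S (IsNilpotent.exp x)) *
            IsNilpotent.exp (-(w • extM S y))) * extM S (IsNilpotent.exp (-x)) := by
            simp only [mul_assoc]
        _ = 1 := by rw [h3, mul_one, h1 y hyn, mul_one, h2])
  obtain ⟨D, hD, hDe⟩ := exists_points (isPoint_exp_smul H.isLieAlgebra hx𝔤 hxn w) (h1 x hxn)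
  refine ⟨C, hC, D, hD, ?_, ?_, ?_⟩
  · rw [hCe, Matrix.map_mul, Matrix.map_mul, map_exp_smul hyn, hw, zero_smul, IsNilpotent.exp_zero,
      mul_one, ← Matrix.map_mul, h2, Matrix.map_one _ (map_zero _) (map_one _)]
  · rw [hDe, map_exp_smul hxn, hw, zero_smul, IsNilpotent.exp_zero]
  · rw [hCe, hDe, Matrix.map_mul, Matrix.map_mul, map_exp_smul hyn, map_exp_smul hxn, extM_map,
      extM_map, H.expForm_eq hx hy hr]

theorem expForm_mem_cosetInftyFormal (hx𝔤 : x ∈ 𝔤) (hy𝔤 : y ∈ 𝔤) (hx : ⁅μ, x⁆ = x)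
    (hy : ⁅μ, y⁆ = -y) : expForm d μ tUnit⁻¹ x y ∈ cosetInftyFormal G d (-μ) := by
  obtain ⟨C, hC, D, hD, hC1, hD1, h⟩ := H.exists_expForm_eq (ofPowerAlg d) constantCoeffAlg
    (w := PowerSeries.X) PowerSeries.constantCoeff_X (t := tUnit⁻¹)
    (by rw [ofPowerAlg_X_tUnit, ← Units.val_pow_eq_pow_val, ← Units.val_mul, inv_pow,
      mul_inv_cancel, Units.val_one]) hx𝔤 hy𝔤 hx hy
  refine ⟨C, hC, D, hD, hC1, hD1, ?_⟩
  rw [neg_neg, h]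
  rfl

theorem expForm_mem_cosetInfty (hx𝔤 : x ∈ 𝔤) (hy𝔤 : y ∈ 𝔤) (hx : ⁅μ, x⁆ = x)
    (hy : ⁅μ, y⁆ = -y) : expForm d μ tUnit x y ∈ cosetInfty G d (-μ) := by
  obtain ⟨C, hC, D, hD, hC1, hD1, h⟩ := H.exists_expForm_eq (ofPolyInvAlg d)
    (Polynomial.aeval (0 : ℂ)) (w := Polynomial.X) (Polynomial.aeval_X _) (t := tUnit)
    (by rw [ofPolyInvAlg, Polynomial.aeval_X, ← Units.val_mul, zpow_neg, zpow_natCast,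
      inv_mul_cancel, Units.val_one]) hx𝔤 hy𝔤 hx hy
  refine ⟨C, hC, D, hD, ?_, ?_, ?_⟩
  · rw [← hC1]; rfl
  · rw [← hD1]; rfl
  · rw [neg_neg, h]
    rfl

/-- Every element of the phase space comes from a matrix of Laurent polynomials. -/
theorem exists_laurent {L : Matrix (Fin N) (Fin N) (LaurentSeries ℂ)}
    (hL : L ∈ phaseSpace G d μ (-μ)) :
    ∃ L' ∈ phaseSpaceFormal G d μ (-μ), L'.map expandZero = L := by
  obtain ⟨h0, C, hC, D, hD, hC1, hD1, hL⟩ := hL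
  rw [neg_neg] at hL
  obtain ⟨C', hCC⟩ := exists_inverse_of_mem_points H.isLieAlgebra hC
  obtain ⟨D', hDD⟩ := exists_inverse_of_mem_points H.isLieAlgebra hD
  have hinv : ∀ {M M' : Matrix (Fin N) (Fin N) ℂ[X]}, M * M' = 1 →
      M.map polyToPower * M'.map polyToPower = 1 := fun h => by
    rw [← Matrix.map_mul, h, Matrix.map_one _ (map_zero _) (map_one _)]
  have hmap : ∀ M : Matrix (Fin N) (Fin N) ℂ[X], (M.map (polyInvToLaurent d)).map expandZeroAlg =
      M.map (ofPolyInv d) := by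
    intro M
    rw [← coe_ofPolyInvAlg, ofPolyInvAlg_eq]
    rfl
  have hmap' : ∀ M : Matrix (Fin N) (Fin N) ℂ[X], (M.map (polyInvToLaurent d)).map expandInftyAlg =
      (M.map polyToPower).map (ofPower d) := by
    intro M
    rw [Matrix.map_map, ← AlgHom.coe_comp, expandInfty_polyInvToLaurent]
    rfl
  have hcc : ∀ M : Matrix (Fin N) (Fin N) ℂ[X], M.map (Polynomial.eval 0) = 1 →
      (M.map polyToPower).map (PowerSeries.constantCoeff (R := ℂ)) = 1 := by
    intro M hM
    rw [← hM]
    ext i j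
    exact constantCoeff_polyToPower _
  -- The factors at infinity are polynomials in `z⁻¹`, so substituting `t ^ (-d)` in them already
  -- gives a matrix of Laurent polynomials.
  have e : (C.1.map (polyInvToLaurent d) * zPow d μ TUnit * D.1.map (polyInvToLaurent d)).map
      expandZero = L := by
    rw [hL, ← coe_expandZeroAlg, Matrix.map_mul, Matrix.map_mul, hmap, hmap, map_zPow, expandZeroAlg,
      map_laurentEval_TUnit]
  refine ⟨_, ⟨?_, ?_⟩, e⟩
  · rw [e]; exact h0
  · obtain ⟨Cp, hCp, hCe⟩ := exists_points (IsPoint.map hC polyToPower) (hinv hCC.1)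
    obtain ⟨Dp, hDp, hDe⟩ := exists_points (IsPoint.map hD polyToPower) (hinv hDD.1)
    refine ⟨Cp, hCp, Dp, hDp, ?_, ?_, ?_⟩
    · rw [hCe, hcc _ hC1]
    · rw [hDe, hcc _ hD1]
    · rw [neg_neg, hCe, hDe, ← coe_expandInftyAlg, Matrix.map_mul, Matrix.map_mul, hmap', hmap',
        map_zPow, expandInftyAlg, map_laurentEval_TUnit]

/-- Equality gives `e^{x - x'} z^μ = z^μ e^{y' - y} = e^{w (y' - y)} z^μ`, since `y' - y` has weight
-1. A constant loop thus equals one with value 1 at infinity, so `e^{x - x'} = 1`, and then `e^{y' -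
y} = 1`. -/
theorem expForm_injective {x' y' : Matrix (Fin N) (Fin N) ℂ} (hx𝔤 : x ∈ 𝔤) (hy𝔤 : y ∈ 𝔤)
    (hx𝔤' : x' ∈ 𝔤) (hy𝔤' : y' ∈ 𝔤) (hx : ⁅μ, x⁆ = x) (hy : ⁅μ, y⁆ = -y)
    (hx' : ⁅μ, x'⁆ = x') (hy' : ⁅μ, y'⁆ = -y')
    (h : expForm d μ TUnit x y = expForm d μ TUnit x' y') : x = x' ∧ y = y' := by
  have h1 := congrArg (fun M => M.map expandInfty) h
  simp only [expForm_expandInfty] at h1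
  simp only [expForm] at h1
  have hxn := H.isNilpotent_plus hx
  have hyn := H.isNilpotent_minus hy
  have hxn' := H.isNilpotent_plus hx'
  have hyn' := H.isNilpotent_minus hy'
  have hu : ⁅μ, x - x'⁆ = x - x' := by rw [lie_sub, hx, hx']
  have hv : ⁅μ, y' - y⁆ = -(y' - y) := by rw [lie_sub, hy, hy']; abel
  have e1 : IsNilpotent.exp (x - x') = IsNilpotent.exp (-x') * IsNilpotent.exp x := by
    rw [← IsNilpotent.exp_add_of_commute _ hxn'.neg hxn, neg_add_eq_sub]
    exact (show Commute x' x from H.commute_of_weight_one hx𝔤' hx𝔤 hx' hx).neg_left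
  have e2 : IsNilpotent.exp (y' - y) = IsNilpotent.exp y' * IsNilpotent.exp (-y) := by
    rw [← IsNilpotent.exp_add_of_commute _ hyn' hyn.neg, sub_eq_add_neg]
    exact (show Commute y' y from H.commute_of_weight_neg_one hy𝔤' hy𝔤 hy' hy).neg_right
  have h2 : extM _ (IsNilpotent.exp (x - x')) * zPow d μ tUnit⁻¹ =
      zPow d μ tUnit⁻¹ * extM _ (IsNilpotent.exp (y' - y)) := by
    rw [e1, e2, extM_mul, extM_mul]
    calc _ = extM _ (IsNilpotent.exp (-x')) * (extM _ (IsNilpotent.exp x) * zPow d μ tUnit⁻¹ *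
          extM _ (IsNilpotent.exp y)) * extM _ (IsNilpotent.exp (-y)) := by
          simp only [mul_assoc]
          rw [← extM_mul, IsNilpotent.exp_mul_exp_neg_self hyn, extM_one, mul_one]
      _ = (extM _ (IsNilpotent.exp (-x')) * extM _ (IsNilpotent.exp x')) * zPow d μ tUnit⁻¹ *
          extM _ (IsNilpotent.exp y') * extM _ (IsNilpotent.exp (-y)) := by
          rw [h1]; simp only [mul_assoc]
      _ = _ := by
          rw [← extM_mul, IsNilpotent.exp_neg_mul_exp_self hxn', extM_one, one_mul, mul_assoc]
  have hv1 := H.isNilpotent_minus hv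
  have hu1 := H.isNilpotent_plus hu
  have hcancel : ∀ {M M' : Matrix (Fin N) (Fin N) (LaurentSeries ℂ)},
      M * zPow d μ tUnit⁻¹ = M' * zPow d μ tUnit⁻¹ → M = M' := by
    intro M M' h
    have := congrArg (· * zPow d μ tUnit) h
    simpa only [mul_assoc, zPow_inv_mul_zPow H.frac, mul_one] using this
  have hr : (ofPowerAlg d PowerSeries.X) * ((tUnit⁻¹ ^ d : (LaurentSeries ℂ)ˣ) : LaurentSeries ℂ) = 1 := by
    rw [ofPowerAlg_X_tUnit, ← Units.val_pow_eq_pow_val, ← Units.val_mul, inv_pow,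
      mul_inv_cancel, Units.val_one]
  rw [← H.zPow_mul_exp hv hr] at h2
  have h3 : extM (PowerSeries ℂ) (IsNilpotent.exp (x - x')) =
      IsNilpotent.exp ((PowerSeries.X : PowerSeries ℂ) • extM _ (y' - y)) := by
    refine Matrix.map_injective (ofPower_injective (d := d)) ?_
    have := hcancel h2
    rw [← map_exp_smul hv1 (ofPowerAlg d), ← extM_map (ofPowerAlg d)] at this
    exact this
  have h4 : IsNilpotent.exp (x - x') = 1 := by
    have := congrArg (fun M => M.map constantCoeffAlg) h3
    simp only [extM_map, map_exp_smul hv1] at this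
    rw [show constantCoeffAlg PowerSeries.X = 0 from PowerSeries.constantCoeff_X, zero_smul,
      IsNilpotent.exp_zero] at this
    exact this
  have hx0 := eq_zero_of_exp_eq_one hu1 h4
  have h5 : IsNilpotent.exp (y' - y) = 1 := by
    have h6 := hcancel h2
    rw [h4, extM_one] at h6
    have h7 := H.zPow_mul_exp hv hr
    rw [← h6, one_mul] at h7
    have h8 := congrArg (zPow d μ tUnit * ·) h7
    simp only [← mul_assoc, zPow_mul_zPow_inv H.frac, one_mul] at h8
    rw [← extM_one] at h8
    exact Matrix.map_injective (algebraMap ℂ (LaurentSeries ℂ)).injective h8.symm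
  have hy0 := eq_zero_of_exp_eq_one hv1 h5
  exact ⟨sub_eq_zero.1 hx0, (sub_eq_zero.1 hy0).symm⟩

/-- The set of pairs of elements of charge `1` and `-1`. -/
def pairs (𝔤 : LieSubalgebra ℂ (Matrix (Fin N) (Fin N) ℂ)) (μ : Matrix (Fin N) (Fin N) ℂ) :
    Set (Matrix (Fin N) (Fin N) ℂ × Matrix (Fin N) (Fin N) ℂ) :=
  {p | (p.1 ∈ 𝔤 ∧ ⁅μ, p.1⁆ = p.1) ∧ p.2 ∈ 𝔤 ∧ ⁅μ, p.2⁆ = -p.2}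

theorem bijOn_phaseSpaceFormal : Set.BijOn (fun p => expForm d μ TUnit p.1 p.2) (pairs 𝔤 μ)
    (phaseSpaceFormal G d μ (-μ)) := by
  refine ⟨?_, ?_, ?_⟩
  · rintro ⟨x, y⟩ ⟨⟨hx𝔤, hx⟩, hy𝔤, hy⟩
    constructor
    · rw [expForm_expandZero]
      exact H.expForm_mem_cosetZero hx𝔤 hy𝔤 hx hy
    · rw [expForm_expandInfty]
      exact H.expForm_mem_cosetInftyFormal hx𝔤 hy𝔤 hx hy
  · rintro ⟨x, y⟩ ⟨⟨hx𝔤, hx⟩, hy𝔤, hy⟩ ⟨x', y'⟩ ⟨⟨hx𝔤', hx'⟩, hy𝔤', hy'⟩ h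
    obtain ⟨h1, h2⟩ := H.expForm_injective hx𝔤 hy𝔤 hx𝔤' hy𝔤' hx hy hx' hy' h
    exact Prod.ext h1 h2
  · intro L hL
    obtain ⟨x, hx𝔤, y, hy𝔤, hx, hy, rfl⟩ := H.exists_eq_expForm hL
    exact ⟨(x, y), ⟨⟨hx𝔤, hx⟩, hy𝔤, hy⟩, rfl⟩

theorem bijOn_phaseSpace : Set.BijOn (fun p => expForm d μ tUnit p.1 p.2) (pairs 𝔤 μ)
    (phaseSpace G d μ (-μ)) := by
  refine ⟨?_, ?_, ?_⟩
  · rintro ⟨x, y⟩ ⟨⟨hx𝔤, hx⟩, hy𝔤, hy⟩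
    exact ⟨H.expForm_mem_cosetZero hx𝔤 hy𝔤 hx hy, H.expForm_mem_cosetInfty hx𝔤 hy𝔤 hx hy⟩
  · intro p hp q hq h
    refine H.bijOn_phaseSpaceFormal.injOn hp hq (Matrix.map_injective expandZero_injective ?_)
    simpa only [expForm_expandZero] using h
  · intro L hL
    obtain ⟨L', hL', rfl⟩ := H.exists_laurent hL
    obtain ⟨p, hp, rfl⟩ := H.bijOn_phaseSpaceFormal.surjOn hL'
    exact ⟨p, hp, (expForm_expandZero _ _).symm⟩

end CoweightData

/-! ### Simple Lie algebras -/

section Simple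

variable {𝔤 : Type*} [LieRing 𝔤] [LieAlgebra ℂ 𝔤] [LieAlgebra.IsSimple ℂ 𝔤] {μ : 𝔤}

theorem center_eq_bot_of_isSimple : LieAlgebra.center ℂ 𝔤 = ⊥ := by
  refine (LieAlgebra.IsSimple.eq_bot_or_eq_top (LieAlgebra.center ℂ 𝔤)).resolve_right fun h => ?_
  exact LieAlgebra.IsSimple.non_abelian (R := ℂ) (L := 𝔤)
    ((LieAlgebra.isLieAbelian_iff_center_eq_top ℂ 𝔤).2 h)

theorem eq_zero_of_central {x : 𝔤} (h : ∀ y : 𝔤, ⁅x, y⁆ = 0) : x = 0 := by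
  have : x ∈ LieAlgebra.center ℂ 𝔤 := by
    rw [LieModule.mem_maxTrivSubmodule]
    intro y
    rw [← lie_skew, h, neg_zero]
  rw [center_eq_bot_of_isSimple] at this
  simpa using this

/-- A simple Lie algebra with a minuscule coweight is generated by its parts of charge `±1`. -/
theorem IsMinuscule.lieSpan_eq_top (hμ : IsMinuscule μ) :
    LieSubalgebra.lieSpan ℂ 𝔤 ((nPlus μ : Set 𝔤) ∪ nMinus μ) = ⊤ := by
  set S := LieSubalgebra.lieSpan ℂ 𝔤 ((nPlus μ : Set 𝔤) ∪ nMinus μ) with hS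
  have hplus : ∀ x ∈ nPlus μ, x ∈ S := fun x hx => LieSubalgebra.subset_lieSpan (Or.inl hx)
  have hminus : ∀ x ∈ nMinus μ, x ∈ S := fun x hx => LieSubalgebra.subset_lieSpan (Or.inr hx)
  have hzero : ∀ z ∈ adEigenspace μ 0, ∀ w ∈ S, ⁅z, w⁆ ∈ S := by
    intro z hz w hw
    induction hw using LieSubalgebra.lieSpan_induction with
    | mem w hw =>
      rcases hw with hw | hw
      · exact hplus _ (by simpa using lie_mem_adEigenspace hz hw)
      · exact hminus _ (by simpa using lie_mem_adEigenspace hz hw)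
    | zero => rw [lie_zero]; exact S.zero_mem
    | add u v _ _ hu hv => rw [lie_add]; exact S.add_mem hu hv
    | smul a u _ hu => rw [lie_smul]; exact S.smul_mem a hu
    | lie u v hu' hv' hu hv =>
      rw [leibniz_lie]
      exact S.add_mem (S.lie_mem hu hv') (S.lie_mem hu' hv)
  -- The subalgebra `S` is an ideal: its generators `𝔫⁺` and `𝔫⁻` lie in it, and the weight 0 part
  -- preserves both.
  let I : LieIdeal ℂ 𝔤 :=
    { S.toSubmodule with
      lie_mem := by
        intro x w hw
        obtain ⟨x₁, h₁, x₂, h₂, x₃, h₃, rfl⟩ := hμ.exists_decomposition x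
        change ⁅x₁ + x₂ + x₃, w⁆ ∈ S
        rw [add_lie, add_lie]
        exact S.add_mem (S.add_mem (S.lie_mem (hminus _ h₁) hw) (hzero _ h₂ _ hw))
          (S.lie_mem (hplus _ h₃) hw) }
  have hI : ∀ x, x ∈ I ↔ x ∈ S := fun _ => Iff.rfl
  rcases LieAlgebra.IsSimple.eq_bot_or_eq_top I with h | h
  -- If `S` were zero, so would be `𝔫⁺` and `𝔫⁻`. Then `μ` would be central, hence zero.
  · refine absurd (eq_zero_of_central fun x => ?_) hμ.1
    have hz : ∀ x ∈ S, x = 0 := fun x hx => by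
      rw [← hI, h] at hx
      simpa using hx
    obtain ⟨x₁, h₁, x₂, h₂, x₃, h₃, rfl⟩ := hμ.exists_decomposition x
    rw [hz _ (hminus _ h₁), hz _ (hplus _ h₃), zero_add, add_zero]
    simpa using mem_adEigenspace.1 h₂
  · rw [eq_top_iff]
    intro x _
    rw [← hI, h]
    trivial

end Simple

section SimpleMatrix

variable {N : ℕ} {G : Subgroup (GL (Fin N) ℂ)} {𝔤 : LieSubalgebra ℂ (Matrix (Fin N) (Fin N) ℂ)}
  {d : ℕ} [NeZero d] {μ : 𝔤}

theorem CoweightData.of_isSimple (hG : IsAlgebraicGroup G) (h𝔤 : IsLieAlgebraOf 𝔤 G)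
    [LieAlgebra.IsSimple ℂ 𝔤] (hμ : IsMinuscule μ)
    (hd : IsFractional d (μ : Matrix (Fin N) (Fin N) ℂ)) :
    CoweightData G 𝔤 d (μ : Matrix (Fin N) (Fin N) ℂ) where
  isAlgebraic := hG
  isLieAlgebra := h𝔤
  mem := μ.2
  cube x hx := congrArg Subtype.val (hμ.lie_cube ⟨x, hx⟩)
  generated K hp hm := by
    have h : LieSubalgebra.lieSpan ℂ 𝔤 ((nPlus μ : Set 𝔤) ∪ nMinus μ) ≤ K.comap 𝔤.incl := by
      rw [LieSubalgebra.lieSpan_le]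
      rintro x (hx | hx)
      · exact hp x x.2 (congrArg Subtype.val (nPlus_lie ⟨x, hx⟩))
      · exact hm x x.2 (congrArg Subtype.val (nMinus_lie ⟨x, hx⟩))
    rw [hμ.lieSpan_eq_top] at h
    exact fun x hx => h (x := ⟨x, hx⟩) trivial
  center x hx h := congrArg Subtype.val
    (eq_zero_of_central (x := (⟨x, hx⟩ : 𝔤)) fun y => Subtype.ext (h y y.2))
  frac := hd

theorem bijOn_pairs : Set.BijOn
    (fun p : nPlus μ × nMinus μ => (((p.1 : 𝔤) : Matrix (Fin N) (Fin N) ℂ),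
      ((p.2 : 𝔤) : Matrix (Fin N) (Fin N) ℂ)))
    Set.univ (CoweightData.pairs 𝔤 (μ : Matrix (Fin N) (Fin N) ℂ)) := by
  refine ⟨?_, ?_, ?_⟩
  · rintro ⟨x, y⟩ -
    exact ⟨⟨x.1.2, congrArg Subtype.val (nPlus_lie x)⟩, y.1.2, congrArg Subtype.val (nMinus_lie y)⟩
  · rintro ⟨x, y⟩ - ⟨x', y'⟩ - h
    have h1 := congrArg Prod.fst h
    have h2 := congrArg Prod.snd h
    exact Prod.ext (Subtype.ext (Subtype.ext h1)) (Subtype.ext (Subtype.ext h2))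
  · rintro ⟨x, y⟩ ⟨⟨hx𝔤, hx⟩, hy𝔤, hy⟩
    refine ⟨(⟨⟨x, hx𝔤⟩, ?_⟩, ⟨⟨y, hy𝔤⟩, ?_⟩), trivial, rfl⟩
    · exact mem_adEigenspace.2 (by rw [one_smul]; exact Subtype.ext hx)
    · exact mem_adEigenspace.2 (by rw [neg_one_smul]; exact Subtype.ext hy)

end SimpleMatrix

/-! ### The special linear group -/

section SpecialLinear

variable {n : ℕ}

theorem mem_SLGroup {g : GL (Fin n) ℂ} : g ∈ SLGroup n ↔ (g : Matrix (Fin n) (Fin n) ℂ).det = 1 := by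
  rw [SLGroup, MonoidHom.mem_ker, Units.ext_iff]
  rfl

/-- The determinant as a polynomial in the matrix entries. -/
def detPoly (n : ℕ) : MvPolynomial (Fin n × Fin n) ℂ := (genericM n).det

theorem evalAt_detPoly {R : Type*} [CommRing R] [Algebra ℂ R] (M : Matrix (Fin n) (Fin n) R) :
    evalAt M (detPoly n) = M.det := by
  rw [detPoly, AlgHom.map_det, AlgHom.mapMatrix_apply, genericM_map_evalAt]

theorem isAlgebraicGroup_SLGroup : IsAlgebraicGroup (SLGroup n) := by
  intro g hg
  have h := hg (detPoly n - 1) (fun g' hg' => by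
    change evalAt (g' : Matrix (Fin n) (Fin n) ℂ) _ = 0
    rw [map_sub, evalAt_detPoly, mem_SLGroup.1 hg', map_one, sub_self])
  change evalAt (g : Matrix (Fin n) (Fin n) ℂ) _ = 0 at h
  rw [map_sub, evalAt_detPoly, map_one, sub_eq_zero] at h
  exact mem_SLGroup.2 h

/-- Over the dual numbers `det (A (1 + ε α)) = det A (1 + ε tr α)`, and the `ε`-component is the
derivative of the determinant along `A α`. -/
theorem hasDerivAt_det_exp (α : Matrix (Fin n) (Fin n) ℂ) (s : ℂ) :
    HasDerivAt (fun u : ℂ => (NormedSpace.exp (u • α)).det)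
      ((NormedSpace.exp (s • α)).det * α.trace) s := by
  have h := hasDerivAt_evalAt_exp α (detPoly n) s
  simp only [evalAt_detPoly] at h
  convert h using 1
  set A := NormedSpace.exp (s • α)
  have h1 := evalAt_dualMatrix A α (detPoly n)
  have h2 : dualMatrix A (A * α) = extM _ A * (1 + (DualNumber.eps : DualNumber ℂ) • extM _ α) := by
    rw [mul_add, mul_one, mul_smul_comm, ← extM_mul]
    set C := A * α
    ext i j
    · simp [fst_dualMatrix, TrivSqZeroExt.algebraMap_eq_inl]
    · simp [snd_dualMatrix, TrivSqZeroExt.algebraMap_eq_inl]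
  have h3 : (DualNumber.eps : DualNumber ℂ) ^ 2 = 0 := by
    rw [sq, DualNumber.eps_mul_eps]
  have h4 : (extM (DualNumber ℂ) α).trace = algebraMap ℂ _ α.trace :=
    (AddMonoidHom.map_trace (algebraMap ℂ (DualNumber ℂ)) α).symm
  have h5 : (extM (DualNumber ℂ) A).det = algebraMap ℂ _ A.det :=
    (RingHom.map_det (algebraMap ℂ (DualNumber ℂ)) A).symm
  rw [evalAt_detPoly, evalAt_detPoly, h2, Matrix.det_mul, Matrix.det_one_add_smul, h3, mul_zero,
    add_zero, h4, h5] at h1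
  have := congrArg TrivSqZeroExt.snd h1
  simpa [TrivSqZeroExt.algebraMap_eq_inl] using this

/-- `𝔰𝔩_n`. -/
abbrev slAlgebra (n : ℕ) : LieSubalgebra ℂ (Matrix (Fin n) (Fin n) ℂ) :=
  LieAlgebra.SpecialLinear.sl (Fin n) ℂ

theorem mem_slAlgebra {x : Matrix (Fin n) (Fin n) ℂ} : x ∈ slAlgebra n ↔ x.trace = 0 := Iff.rfl

theorem isLieAlgebraOf_slAlgebra : IsLieAlgebraOf (slAlgebra n) (SLGroup n) := by
  intro x
  rw [mem_slAlgebra]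
  constructor
  · intro hx s
    refine ⟨(Matrix.isUnit_exp (s • x)).unit, ?_, rfl⟩
    rw [mem_SLGroup]
    have h := is_const_of_deriv_eq_zero (f := fun u : ℂ => (NormedSpace.exp (u • x)).det)
      (fun u => (hasDerivAt_det_exp x u).differentiableAt)
      (fun u => by rw [(hasDerivAt_det_exp x u).deriv, hx, mul_zero]) s 0
    simpa using h
  · intro h
    have h1 : (fun u : ℂ => (NormedSpace.exp (u • x)).det) = fun _ => 1 := by
      funext u
      obtain ⟨g, hg, he⟩ := h u
      rw [← he]
      exact mem_SLGroup.1 hg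
    have h2 := hasDerivAt_det_exp x 0
    rw [h1] at h2
    simpa using h2.unique (hasDerivAt_const (0 : ℂ) (1 : ℂ))

end SpecialLinear

/-! ### The first fundamental coweight of the special linear group. -/

section TypeA

variable {m : ℕ}

theorem lie_muA (x : Matrix (Fin (m + 1)) (Fin (m + 1)) ℂ) :
    ⁅muA m, x⁆ = Matrix.single 0 0 1 * x - x * Matrix.single 0 0 1 := by
  rw [Ring.lie_def, muA, sub_mul, mul_sub, smul_mul_assoc, mul_smul_comm, one_mul, mul_one]
  abel

/-- The scalar part of `muA` is central and `E₀₀` is idempotent. For any idempotent `E`, `(ad E)³ =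
ad E` on all matrices. -/
theorem lie_muA_cube (x : Matrix (Fin (m + 1)) (Fin (m + 1)) ℂ) :
    ⁅muA m, ⁅muA m, ⁅muA m, x⁆⁆⁆ = ⁅muA m, x⁆ := by
  simp only [lie_muA]
  set E : Matrix (Fin (m + 1)) (Fin (m + 1)) ℂ := Matrix.single 0 0 1
  have hE : E * E = E := by simp [E]
  have h1 : ∀ M, E * (E * M) = E * M := fun M => by rw [← mul_assoc, hE]
  simp only [mul_sub, sub_mul, mul_assoc, h1, hE]
  abel

theorem muA_mem : muA m ∈ slAlgebra (m + 1) := by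
  rw [mem_slAlgebra, muA, Matrix.trace_sub, Matrix.trace_smul, Matrix.trace_one,
    Matrix.trace_single_eq_same, Fintype.card_fin, smul_eq_mul]
  have : (m + 1 : ℂ) ≠ 0 := by exact_mod_cast Nat.succ_ne_zero m
  push_cast
  rw [inv_mul_cancel₀ this, sub_self]

theorem single_zero_mulVec (v : Fin (m + 1) → ℂ) :
    (Matrix.single 0 0 1 : Matrix (Fin (m + 1)) (Fin (m + 1)) ℂ).mulVec v = Pi.single 0 (v 0) := by
  rw [Matrix.single_mulVec, one_mul]
  rfl

theorem isFractional_muA : IsFractional (m + 1) (muA m) := by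
  rw [IsFractional, eq_top_iff]
  intro v _
  have hm : (m + 1 : ℂ) ≠ 0 := by exact_mod_cast Nat.succ_ne_zero m
  have h0 : v = Pi.single 0 (v 0) + (v - Pi.single 0 (v 0)) := by abel
  rw [h0]
  -- `muA` has eigenvalue `m / (m + 1)` on the first basis vector and `-1 / (m + 1)` on the others.
  refine Submodule.add_mem _ (Submodule.mem_iSup_of_mem (m : ℤ) ?_)
    (Submodule.mem_iSup_of_mem (-1 : ℤ) ?_)
  all_goals
    rw [Module.End.mem_eigenspace_iff, Matrix.toLin'_apply, muA, Matrix.sub_mulVec, Matrix.smul_mulVec,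
      Matrix.one_mulVec, single_zero_mulVec]
    ext i
    refine Fin.cases ?_ (fun i => ?_) i
  · simp
    field_simp
    ring
  · simp
  · simp
  · simp
    field_simp

theorem single_succ_mem (i : Fin m) (a : ℂ) : (Matrix.single 0 i.succ a) ∈ slAlgebra (m + 1) := by
  rw [mem_slAlgebra]
  exact Matrix.trace_single_eq_of_ne _ _ _ (Fin.succ_ne_zero i).symm

theorem single_succ_mem' (i : Fin m) (a : ℂ) : (Matrix.single i.succ 0 a) ∈ slAlgebra (m + 1) := by
  rw [mem_slAlgebra]
  exact Matrix.trace_single_eq_of_ne _ _ _ (Fin.succ_ne_zero i)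

theorem lie_muA_single (i : Fin m) (a : ℂ) :
    ⁅muA m, (Matrix.single 0 i.succ a : Matrix (Fin (m + 1)) (Fin (m + 1)) ℂ)⁆ =
      Matrix.single 0 i.succ a := by
  rw [lie_muA, Matrix.single_mul_single_same, one_mul,
    Matrix.single_mul_single_of_ne _ _ _ _ (Fin.succ_ne_zero i), sub_zero]

theorem lie_muA_single' (i : Fin m) (a : ℂ) :
    ⁅muA m, (Matrix.single i.succ 0 a : Matrix (Fin (m + 1)) (Fin (m + 1)) ℂ)⁆ =
      -Matrix.single i.succ 0 a := by
  rw [lie_muA, Matrix.single_mul_single_same, mul_one,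
    Matrix.single_mul_single_of_ne _ _ _ _ (Fin.succ_ne_zero i).symm, zero_sub]

/-- `[E_{i0}, E_{0j}] = E_{ij} - δ_{ij} E_{00}`. The first row, the first column and the lower block
fit term by term, and the trace condition accounts for the entry at `(0, 0)`. -/
theorem eq_sum_of_trace_eq_zero {x : Matrix (Fin (m + 1)) (Fin (m + 1)) ℂ} (hx : x.trace = 0) :
    x = ∑ i : Fin m, Matrix.single 0 i.succ (x 0 i.succ) +
      ∑ i : Fin m, Matrix.single i.succ 0 (x i.succ 0) +
      ∑ i : Fin m, ∑ j : Fin m, x i.succ j.succ • ⁅(Matrix.single i.succ 0 1 :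
        Matrix (Fin (m + 1)) (Fin (m + 1)) ℂ),
        (Matrix.single 0 j.succ 1 : Matrix (Fin (m + 1)) (Fin (m + 1)) ℂ)⁆ := by
  rw [Matrix.trace, Fin.sum_univ_succ] at hx
  simp only [Matrix.diag_apply] at hx
  have h : ∀ i j : Fin m, ⁅(Matrix.single i.succ 0 1 :
      Matrix (Fin (m + 1)) (Fin (m + 1)) ℂ),
        (Matrix.single 0 j.succ 1 : Matrix (Fin (m + 1)) (Fin (m + 1)) ℂ)⁆ =
      (Matrix.single i.succ j.succ 1 : Matrix (Fin (m + 1)) (Fin (m + 1)) ℂ) - if i = j then Matrix.single 0 0 1 else 0 := by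
    intro i j
    rw [Ring.lie_def, Matrix.single_mul_single_same]
    split_ifs with hij
    · rw [hij, Matrix.single_mul_single_same, one_mul]
    · rw [Matrix.single_mul_single_of_ne _ _ _ _ (fun h => hij (Fin.succ_injective _ h).symm), one_mul]
  simp only [h, smul_sub, smul_ite, smul_zero, Finset.sum_sub_distrib, Finset.sum_ite_eq,
    Finset.mem_univ, if_true]
  ext i j
  refine Fin.cases ?_ (fun i => ?_) i <;> refine Fin.cases ?_ (fun j => ?_) j
  · simp [Matrix.sum_apply]
    linear_combination hx
  · simp [Matrix.sum_apply, Matrix.single_apply, (Fin.succ_ne_zero j).symm]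
  · simp [Matrix.sum_apply, Matrix.single_apply, (Fin.succ_ne_zero i).symm]
  · simp [Matrix.sum_apply, Matrix.single_apply, (Fin.succ_ne_zero i).symm,
      (Fin.succ_ne_zero j).symm, ite_and]

/-- The conditions are verified directly instead of through simplicity, which also covers `m = 0`,
where `𝔰𝔩₁ = 0` is not simple. -/
theorem coweightData_muA : CoweightData (SLGroup (m + 1)) (slAlgebra (m + 1)) (m + 1) (muA m) where
  isAlgebraic := isAlgebraicGroup_SLGroup
  isLieAlgebra := isLieAlgebraOf_slAlgebra
  mem := muA_mem
  cube x _ := lie_muA_cube x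
  generated K hp hm x hx := by
    have h1 : ∀ (i : Fin m) a, Matrix.single 0 i.succ a ∈ K := fun i a =>
      hp _ (single_succ_mem i a) (lie_muA_single i a)
    have h2 : ∀ (i : Fin m) a, Matrix.single i.succ 0 a ∈ K := fun i a =>
      hm _ (single_succ_mem' i a) (lie_muA_single' i a)
    rw [eq_sum_of_trace_eq_zero hx]
    exact K.add_mem (K.add_mem (sum_mem fun i _ => h1 i _) (sum_mem fun i _ => h2 i _))
      (sum_mem fun i _ => sum_mem fun j _ => K.smul_mem _ (K.lie_mem (h2 i 1) (h1 j 1)))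
  center x hx h := by
    obtain ⟨c, rfl⟩ := Matrix.mem_range_scalar_of_commute_single (M := x) fun i j hij => by
      have := h (Matrix.single i j 1) (Matrix.trace_single_eq_of_ne _ _ _ hij)
      rw [Ring.lie_def, sub_eq_zero] at this
      exact this.symm
    rw [mem_slAlgebra, Matrix.scalar_apply, Matrix.trace_diagonal, Finset.sum_const,
      Finset.card_univ, Fintype.card_fin, nsmul_eq_mul] at hx
    have : c = 0 := (mul_eq_zero.1 hx).resolve_left (by exact_mod_cast Nat.succ_ne_zero m)
    rw [this, map_zero]
  frac := isFractional_muA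

end TypeA

section Exp

theorem exp_eq_one_add {A : Type*} [Ring A] [Module ℚ A] {x : A} (hx : x * x = 0) :
    IsNilpotent.exp x = 1 + x := by
  rw [IsNilpotent.exp_eq_sum (k := 2) (by rw [sq, hx]), Finset.sum_range_succ, Finset.sum_range_one]
  simp

end Exp

/-! ### The oscillator matrix as a Gauss decomposition. -/

section Oscillator

variable {m : ℕ} {R : Type*} [CommRing R]

/-- The matrix `∑ i, b i E_{0,i+1}`. -/
def rowM (b : Fin m → R) : Matrix (Fin (m + 1)) (Fin (m + 1)) R :=
  ∑ i, Matrix.single 0 i.succ (b i)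

/-- The matrix `∑ i, c i E_{i+1,0}`. -/
def colM (c : Fin m → R) : Matrix (Fin (m + 1)) (Fin (m + 1)) R :=
  ∑ i, Matrix.single i.succ 0 (c i)

theorem rowM_mul_self (b : Fin m → R) : rowM b * rowM b = 0 := by
  rw [rowM, Finset.sum_mul_sum]
  refine Finset.sum_eq_zero fun i _ => Finset.sum_eq_zero fun j _ => ?_
  rw [Matrix.single_mul_single_of_ne _ _ _ _ (Fin.succ_ne_zero i)]

theorem colM_mul_self (c : Fin m → R) : colM c * colM c = 0 := by
  rw [colM, Finset.sum_mul_sum]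
  refine Finset.sum_eq_zero fun i _ => Finset.sum_eq_zero fun j _ => ?_
  rw [Matrix.single_mul_single_of_ne _ _ _ _ (Fin.succ_ne_zero j).symm]

theorem rowM_mul_colM (b c : Fin m → R) :
    rowM b * colM c = Matrix.single 0 0 (∑ i, b i * c i) := by
  rw [rowM, colM, Finset.sum_mul_sum, ← Matrix.singleAddMonoidHom_apply, map_sum]
  refine Finset.sum_congr rfl fun i _ => ?_
  rw [Finset.sum_eq_single i, Matrix.single_mul_single_same]
  · rfl
  · intro j _ hj
    rw [Matrix.single_mul_single_of_ne _ _ _ _ (fun h => hj (Fin.succ_injective _ h).symm)]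
  · simp

theorem single_mul_colM (a : R) (c : Fin m → R) : Matrix.single 0 0 a * colM c = 0 := by
  rw [colM, Finset.mul_sum]
  refine Finset.sum_eq_zero fun i _ => ?_
  rw [Matrix.single_mul_single_of_ne _ _ _ _ (Fin.succ_ne_zero i).symm]

theorem rowM_mul_single (a : R) (b : Fin m → R) : rowM b * Matrix.single 0 0 a = 0 := by
  rw [rowM, Finset.sum_mul]
  refine Finset.sum_eq_zero fun i _ => ?_
  rw [Matrix.single_mul_single_of_ne _ _ _ _ (Fin.succ_ne_zero i)]

theorem mul_diag_mul_eq_oscL (b c : Fin m → R) (w : R) :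
    (1 + rowM b) * (1 + Matrix.single 0 0 (w - 1)) * (1 + colM c) = oscL b c w := by
  have h : (1 + rowM b) * (1 + Matrix.single 0 0 (w - 1)) * (1 + colM c) =
      1 + Matrix.single 0 0 (w - 1) + rowM b + colM c + Matrix.single 0 0 (∑ i, b i * c i) := by
    rw [mul_add, mul_one, add_mul (1 : Matrix _ _ R), one_mul, mul_add, mul_one, rowM_mul_single,
      add_zero, add_mul, add_mul, one_mul, single_mul_colM, rowM_mul_colM]
    abel
  rw [h]
  ext i j
  refine Fin.cases ?_ (fun i => ?_) i <;> refine Fin.cases ?_ (fun j => ?_) j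
  · simp [rowM, colM, oscL, Matrix.sum_apply]
  · simp [rowM, colM, oscL, Matrix.sum_apply, Matrix.single_apply, (Fin.succ_ne_zero j).symm]
  · simp [rowM, colM, oscL, Matrix.sum_apply, Matrix.single_apply, (Fin.succ_ne_zero i).symm]
  · simp [rowM, colM, oscL, Matrix.sum_apply, (Fin.succ_ne_zero i).symm, (Fin.succ_ne_zero j).symm,
      Matrix.one_apply]

variable [Algebra ℂ R]

theorem extM_rowM (b : Fin m → ℂ) : extM R (rowM b) = rowM (fun i => algebraMap ℂ R (b i)) := by
  rw [rowM, extM_sum, rowM]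
  exact Finset.sum_congr rfl fun i _ => Matrix.map_single _ _ _ (algebraMap ℂ R)

theorem extM_colM (c : Fin m → ℂ) : extM R (colM c) = colM (fun i => algebraMap ℂ R (c i)) := by
  rw [colM, extM_sum, colM]
  exact Finset.sum_congr rfl fun i _ => Matrix.map_single _ _ _ (algebraMap ℂ R)

theorem single_zero_mul_self : (Matrix.single 0 0 1 : Matrix (Fin (m + 1)) (Fin (m + 1)) ℂ) *
    Matrix.single 0 0 1 = Matrix.single 0 0 1 := by
  rw [Matrix.single_mul_single_same, one_mul]

theorem extM_single_zero : extM R (Matrix.single 0 0 1 : Matrix (Fin (m + 1)) (Fin (m + 1)) ℂ) =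
    Matrix.single 0 0 1 :=
  (Matrix.map_single _ _ _ (algebraMap ℂ R)).trans (by rw [map_one])

/-- `T` acts by scalars on the images of the complementary idempotents `E₀₀` and `1 - E₀₀`, so `z^T`
is `u ^ k` on the first and `u ^ l` on the second. -/
theorem zPow_of_mul_single {d : ℕ} (hd : d ≠ 0) {T : Matrix (Fin (m + 1)) (Fin (m + 1)) ℂ} {k l : ℤ}
    (h1 : T * Matrix.single 0 0 1 = ((k : ℂ) / d) • Matrix.single 0 0 1)
    (h2 : T * (1 - Matrix.single 0 0 1) = ((l : ℂ) / d) • (1 - Matrix.single 0 0 1)) (u : Rˣ) :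
    zPow d T u = ((u ^ l : Rˣ) : R) • (1 + Matrix.single 0 0 (((u ^ (k - l) : Rˣ) : R) - 1)) := by
  have h0 (a b : R) : Matrix.single (0 : Fin (m + 1)) (0 : Fin (m + 1)) (a - b) =
      Matrix.single 0 0 a - Matrix.single 0 0 b := map_sub (Matrix.singleAddMonoidHom 0 0) a b
  have h3 := zPow_mul_of_mul_eq (R := R) hd h1 u
  have h4 := zPow_mul_of_mul_eq (R := R) hd h2 u
  rw [extM_sub, extM_one, mul_sub, mul_one, h3, sub_eq_iff_eq_add, extM_single_zero] at h4
  rw [h4, smul_sub, smul_add, Matrix.smul_single, Matrix.smul_single, Matrix.smul_single, smul_eq_mul,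
    smul_eq_mul, smul_eq_mul, mul_sub, mul_one, mul_one, h0, ← Units.val_mul, ← zpow_add,
    add_sub_cancel, sub_eq_add_neg, sub_eq_add_neg]
  abel

theorem zPow_muA (u : Rˣ) : zPow (m + 1) (muA m) u =
    ((u⁻¹ : Rˣ) : R) • (1 + Matrix.single 0 0 ((u : R) ^ (m + 1) - 1)) := by
  have hm : (m + 1 : ℂ) ≠ 0 := by exact_mod_cast Nat.succ_ne_zero m
  have := zPow_of_mul_single (R := R) (T := muA m) (k := m) (l := -1) m.succ_ne_zero (by
      rw [muA, sub_mul, single_zero_mul_self, smul_mul_assoc, one_mul]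
      nth_rw 1 [← one_smul ℂ (Matrix.single 0 0 1 : Matrix (Fin (m + 1)) (Fin (m + 1)) ℂ)]
      rw [← sub_smul]
      congr 1
      push_cast
      field_simp
      ring) (by
      rw [muA, sub_mul, mul_sub, mul_one, single_zero_mul_self, sub_self, zero_sub, smul_mul_assoc,
        one_mul, ← neg_smul]
      congr 1
      push_cast
      field_simp) u
  rw [this, zpow_neg_one, show ((m : ℤ) - -1) = ((m + 1 : ℕ) : ℤ) by push_cast; ring, zpow_natCast,
    Units.val_pow_eq_pow_val]

theorem zPow_single_zero (u : Rˣ) :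
    zPow 1 (Matrix.single 0 0 1 : Matrix (Fin (m + 1)) (Fin (m + 1)) ℂ) u =
      1 + Matrix.single 0 0 ((u : R) - 1) := by
  have := zPow_of_mul_single (R := R) (m := m) (T := Matrix.single 0 0 1) (k := 1) (l := 0) one_ne_zero
    (by rw [single_zero_mul_self]; simp)
    (by rw [mul_sub, mul_one, single_zero_mul_self]; simp) u
  simpa using this

theorem expForm_muA (u : Rˣ) (b c : Fin m → ℂ) :
    expForm (m + 1) (muA m) u (rowM b) (colM c) = ((u⁻¹ : Rˣ) : R) •
      oscL (fun i => algebraMap ℂ R (b i)) (fun i => algebraMap ℂ R (c i)) ((u : R) ^ (m + 1)) := by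
  rw [expForm, exp_eq_one_add (rowM_mul_self b), exp_eq_one_add (colM_mul_self c)]
  change extM R (1 + rowM b) * _ * extM R (1 + colM c) = _
  rw [extM_add, extM_add, extM_one, extM_rowM, extM_colM, zPow_muA, mul_smul_comm, smul_mul_assoc,
    mul_diag_mul_eq_oscL]

theorem sum_bVar_smul : ∑ i : Fin m, bVar i • (Matrix.single 0 i.succ 1 :
    Matrix (Fin (m + 1)) (Fin (m + 1)) ℂ).map (algebraMap ℂ (Coord m)) = rowM bVar := by
  refine Finset.sum_congr rfl fun i _ => ?_
  rw [Matrix.map_single, map_one, Matrix.smul_single, smul_eq_mul, mul_one]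

theorem sum_cVar_smul : ∑ i : Fin m, cVar i • (Matrix.single i.succ 0 1 :
    Matrix (Fin (m + 1)) (Fin (m + 1)) ℂ).map (algebraMap ℂ (Coord m)) = colM cVar := by
  refine Finset.sum_congr rfl fun i _ => ?_
  rw [Matrix.map_single, map_one, Matrix.smul_single, smul_eq_mul, mul_one]

theorem LOp_muA (t : ℂˣ) :
    LOp (m + 1) (muA m) (fun i : Fin m => Matrix.single 0 i.succ 1)
      (fun i : Fin m => Matrix.single i.succ 0 1) t =
    ((t : ℂ)⁻¹) • oscL bVar cVar (algebraMap ℂ (Coord m) ((t : ℂ) ^ (m + 1))) := by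
  rw [LOp, sum_bVar_smul, sum_cVar_smul, exp_eq_one_add (rowM_mul_self _),
    exp_eq_one_add (colM_mul_self _), zPow_muA, mul_smul_comm, smul_mul_assoc, mul_diag_mul_eq_oscL,
    ← map_inv]
  refine Matrix.ext fun i j => ?_
  rw [Matrix.smul_apply, Matrix.smul_apply, Algebra.smul_def (t : ℂ)⁻¹, smul_eq_mul, map_pow,
    ← Units.val_inv_eq_inv_val]
  rfl

theorem LOp_single_zero (t : ℂˣ) :
    LOp 1 (Matrix.single 0 0 1) (fun i : Fin m => Matrix.single 0 i.succ 1)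
      (fun i : Fin m => Matrix.single i.succ 0 1) t =
    oscL bVar cVar (algebraMap ℂ (Coord m) (t : ℂ)) := by
  rw [LOp, sum_bVar_smul, sum_cVar_smul, exp_eq_one_add (rowM_mul_self _),
    exp_eq_one_add (colM_mul_self _), zPow_single_zero, mul_diag_mul_eq_oscL]
  rfl

end Oscillator

/-! ### The phase space of type A. -/

section PhaseSpace

variable {m : ℕ}

theorem lie_muA_apply (x : Matrix (Fin (m + 1)) (Fin (m + 1)) ℂ) (i j : Fin (m + 1)) :
    ⁅muA m, x⁆ i j = (if i = 0 then x i j else 0) - if j = 0 then x i j else 0 := by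
  rw [lie_muA, Matrix.sub_apply]
  congr 1
  · split_ifs with h
    · simp [h]
    · exact Matrix.single_mul_apply_of_ne _ _ _ _ _ h _
  · split_ifs with h
    · simp [h]
    · exact Matrix.mul_single_apply_of_ne _ _ _ _ _ h _

theorem bijOn_rowM_colM : Set.BijOn
    (fun p : (Fin m → ℂ) × (Fin m → ℂ) => (rowM p.1, colM p.2)) Set.univ
    (CoweightData.pairs (slAlgebra (m + 1)) (muA m)) := by
  have hrow : ∀ (b : Fin m → ℂ) i, rowM b 0 (Fin.succ i) = b i := fun b i => by
    simp [rowM, Matrix.sum_apply, Matrix.single_apply]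
  have hcol : ∀ (c : Fin m → ℂ) i, colM c (Fin.succ i) 0 = c i := fun c i => by
    simp [colM, Matrix.sum_apply, Matrix.single_apply]
  refine ⟨fun p _ => ⟨⟨?_, ?_⟩, ?_, ?_⟩, fun p _ q _ h => ?_, fun q hq => ?_⟩
  · change rowM p.1 ∈ _
    exact (slAlgebra (m + 1)).toSubmodule.sum_mem fun i _ => single_succ_mem i (p.1 i)
  · change ⁅muA m, rowM p.1⁆ = rowM p.1
    rw [rowM, lie_sum]
    exact Finset.sum_congr rfl fun i _ => lie_muA_single i _
  · change colM p.2 ∈ _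
    exact (slAlgebra (m + 1)).toSubmodule.sum_mem fun i _ => single_succ_mem' i (p.2 i)
  · change ⁅muA m, colM p.2⁆ = -colM p.2
    rw [colM, lie_sum, ← Finset.sum_neg_distrib]
    exact Finset.sum_congr rfl fun i _ => lie_muA_single' i _
  · rw [Prod.mk.injEq] at h
    refine Prod.ext (funext fun i => ?_) (funext fun i => ?_)
    · rw [← hrow p.1, h.1, hrow]
    · rw [← hcol p.2, h.2, hcol]
  · obtain ⟨x, y⟩ := q
    obtain ⟨⟨-, hx⟩, -, hy⟩ := hq
    refine ⟨(fun i => x 0 i.succ, fun i => y i.succ 0), Set.mem_univ _, ?_⟩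
    replace hx i j := congrFun (congrFun hx i) j
    replace hy i j := congrFun (congrFun hy i) j
    simp only [lie_muA_apply, Matrix.neg_apply] at hx hy
    refine Prod.ext ?_ ?_
    · ext i j
      have h1 := hx i j
      revert h1
      refine Fin.cases ?_ (fun i => ?_) i <;> refine Fin.cases ?_ (fun j => ?_) j
      all_goals
        simp [rowM, Matrix.sum_apply, Matrix.single_apply, (Fin.succ_ne_zero _).symm]
        try grind
    · ext i j
      have h1 := hy i j
      revert h1
      refine Fin.cases ?_ (fun i => ?_) i <;> refine Fin.cases ?_ (fun j => ?_) j
      all_goals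
        simp [colM, Matrix.sum_apply, Matrix.single_apply, (Fin.succ_ne_zero _).symm]
        try grind

theorem bijOn_oscL : Set.BijOn
    (fun p : (Fin m → ℂ) × (Fin m → ℂ) =>
      ((tUnit⁻¹ : (LaurentSeries ℂ)ˣ) : LaurentSeries ℂ) •
        oscL (fun i => algebraMap ℂ (LaurentSeries ℂ) (p.1 i))
          (fun i => algebraMap ℂ (LaurentSeries ℂ) (p.2 i))
          ((tUnit : LaurentSeries ℂ) ^ (m + 1)))
    Set.univ (phaseSpace (SLGroup (m + 1)) (m + 1) (muA m) (-muA m)) := by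
  refine (coweightData_muA.bijOn_phaseSpace.comp bijOn_rowM_colM).congr fun p _ => ?_
  exact expForm_muA tUnit p.1 p.2

end PhaseSpace

/-! ### The permutation matrix as a Casimir. -/

section Swap

variable {n : Type*} [Fintype n] [DecidableEq n]

theorem swapMatrix_mul_apply (M : Matrix (n × n) (n × n) ℂ) (p q : n × n) :
    (swapMatrix n * M) p q = M p.swap q := by
  rw [Matrix.mul_apply, Finset.sum_eq_single p.swap]
  · simp [swapMatrix]
  · intro x _ hx
    rw [swapMatrix, Matrix.of_apply, if_neg, zero_mul]
    rintro ⟨h1, h2⟩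
    exact hx (Prod.ext h2.symm h1.symm)
  · simp

theorem mul_swapMatrix_apply (M : Matrix (n × n) (n × n) ℂ) (p q : n × n) :
    (M * swapMatrix n) p q = M p q.swap := by
  rw [Matrix.mul_apply, Finset.sum_eq_single q.swap]
  · simp [swapMatrix]
  · intro x _ hx
    rw [swapMatrix, Matrix.of_apply, if_neg, mul_zero]
    rintro ⟨h1, h2⟩
    exact hx (Prod.ext h1 h2)
  · simp

theorem swapMatrix_mul_kron (A B : Matrix n n ℂ) :
    swapMatrix n * (A ⊗ₖ B) = (B ⊗ₖ A) * swapMatrix n := by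
  ext p q
  rw [swapMatrix_mul_apply, mul_swapMatrix_apply, Matrix.kronecker_apply, Matrix.kronecker_apply,
    mul_comm]
  rfl

theorem commute_swapMatrix (A : Matrix n n ℂ) : Commute (swapMatrix n) (A ⊗ₖ 1 + 1 ⊗ₖ A) := by
  rw [Commute, SemiconjBy, mul_add, add_mul, swapMatrix_mul_kron, swapMatrix_mul_kron, add_comm]

variable {m : ℕ}

/-- The permutation matrix is `∑ E_{ij} ⊗ E_{ji}`. The left factor multiplies such a term by `δ_{j0}
- δ_{i0}`, so exactly the terms with one index equal to 0 survive. -/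
theorem kron_mul_swapMatrix :
    ((1 : Matrix (Fin (m + 1)) (Fin (m + 1)) ℂ) ⊗ₖ Matrix.single 0 0 1 - Matrix.single 0 0 1 ⊗ₖ 1) *
      swapMatrix (Fin (m + 1)) =
    ∑ i : Fin m, ((Matrix.single i.succ 0 1 ⊗ₖ Matrix.single 0 i.succ 1 :
        Matrix (Fin (m + 1) × Fin (m + 1)) (Fin (m + 1) × Fin (m + 1)) ℂ) -
      Matrix.single 0 i.succ 1 ⊗ₖ Matrix.single i.succ 0 1) := by
  ext ⟨i, j⟩ ⟨k, l⟩
  rw [mul_swapMatrix_apply, Matrix.sum_apply]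
  refine Fin.cases ?_ (fun i => ?_) i <;> refine Fin.cases ?_ (fun j => ?_) j <;>
    refine Fin.cases ?_ (fun k => ?_) k <;> refine Fin.cases ?_ (fun l => ?_) l
  all_goals
    simp [Matrix.single_apply, Matrix.one_apply, (Fin.succ_ne_zero _).symm, eq_comm]

/-- `E₀₀` replaces `muA`, from which it differs by a scalar matrix. This keeps the weights, gives
integral eigenvalues so that `d = 1`, and removes the prefactor `z^{-1/n}` from the `L`-operator. -/
theorem rllData_swapMatrix : RLLData 1 m (Matrix.single 0 0 1)
    (fun i : Fin m => Matrix.single 0 i.succ 1) (fun i : Fin m => Matrix.single i.succ 0 1)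
    (swapMatrix (Fin (m + 1))) := by
  have hX (i : Fin m) : (Matrix.single 0 0 1 : Matrix (Fin (m + 1)) (Fin (m + 1)) ℂ) *
      Matrix.single 0 i.succ 1 - Matrix.single 0 i.succ 1 * Matrix.single 0 0 1 =
      Matrix.single 0 i.succ 1 := by
    rw [← lie_muA, lie_muA_single]
  have hY (i : Fin m) : (Matrix.single 0 0 1 : Matrix (Fin (m + 1)) (Fin (m + 1)) ℂ) *
      Matrix.single i.succ 0 1 - Matrix.single i.succ 0 1 * Matrix.single 0 0 1 =
      -Matrix.single i.succ 0 1 := by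
    rw [← lie_muA, lie_muA_single']
  have hleft : Commute (swapMatrix (Fin (m + 1)) - ∑ i : Fin m,
      ((Matrix.single 0 i.succ 1 : Matrix (Fin (m + 1)) (Fin (m + 1)) ℂ) ⊗ₖ
        (Matrix.single i.succ 0 1 : Matrix (Fin (m + 1)) (Fin (m + 1)) ℂ) +
        Matrix.single i.succ 0 1 ⊗ₖ Matrix.single 0 i.succ 1))
      ((Matrix.single 0 0 1 : Matrix (Fin (m + 1)) (Fin (m + 1)) ℂ) ⊗ₖ
        (1 : Matrix (Fin (m + 1)) (Fin (m + 1)) ℂ)) := by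
    rw [Commute, SemiconjBy, ← sub_eq_zero, sub_mul, mul_sub, swapMatrix_mul_kron, sub_sub_sub_comm,
      ← sub_mul, kron_mul_swapMatrix, Finset.sum_mul, Finset.mul_sum, ← Finset.sum_sub_distrib,
      ← Finset.sum_sub_distrib]
    refine Finset.sum_eq_zero fun i _ => ?_
    rw [add_mul, mul_add, ← Matrix.mul_kronecker_mul, ← Matrix.mul_kronecker_mul,
      ← Matrix.mul_kronecker_mul, ← Matrix.mul_kronecker_mul]
    simp [Matrix.single_mul_single_of_ne _ _ _ _ (Fin.succ_ne_zero i).symm]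
  refine ⟨?_, hX, hY, fun i j => ?_, fun i j => ?_, fun i => commute_swapMatrix _,
    fun i => commute_swapMatrix _, hleft, ?_, ?_⟩
  · rw [IsFractional, eq_top_iff]
    intro v _
    have h0 : v = Pi.single 0 (v 0) + (v - Pi.single 0 (v 0)) := by abel
    rw [h0]
    refine Submodule.add_mem _ (Submodule.mem_iSup_of_mem 1 ?_) (Submodule.mem_iSup_of_mem 0 ?_)
    all_goals
      rw [Module.End.mem_eigenspace_iff, Matrix.toLin'_apply, single_zero_mulVec]
      simp
  · rw [Commute, SemiconjBy, Matrix.single_mul_single_of_ne _ _ _ _ (Fin.succ_ne_zero i),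
      Matrix.single_mul_single_of_ne _ _ _ _ (Fin.succ_ne_zero j)]
  · rw [Commute, SemiconjBy, Matrix.single_mul_single_of_ne _ _ _ _ (Fin.succ_ne_zero j).symm,
      Matrix.single_mul_single_of_ne _ _ _ _ (Fin.succ_ne_zero i).symm]
  · rw [Commute, SemiconjBy, ← sub_eq_zero, sub_mul, mul_sub, swapMatrix_mul_kron, sub_sub_sub_comm,
      ← sub_mul, ← neg_sub (1 ⊗ₖ Matrix.single 0 0 1 : Matrix (Fin (m + 1) × Fin (m + 1)) _ ℂ), neg_mul,
      kron_mul_swapMatrix, Finset.sum_mul, Finset.mul_sum,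
      ← Finset.sum_neg_distrib, ← Finset.sum_sub_distrib, ← Finset.sum_sub_distrib]
    refine Finset.sum_eq_zero fun i _ => ?_
    rw [add_mul, mul_add, ← Matrix.mul_kronecker_mul, ← Matrix.mul_kronecker_mul,
      ← Matrix.mul_kronecker_mul, ← Matrix.mul_kronecker_mul]
    simp [Matrix.single_mul_single_of_ne _ _ _ _ (Fin.succ_ne_zero i).symm]
  · rw [Fintype.linearIndependent_iff]
    intro g hg
    rw [Fintype.sum_sum_type] at hg
    rintro (i | i)
    · have := congrFun (congrFun hg 0) i.succ
      simpa [Matrix.sum_apply, Matrix.single_apply] using this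
    · have := congrFun (congrFun hg i.succ) 0
      simpa [Matrix.sum_apply, Matrix.single_apply] using this

end Swap

/-! ### Specialization to simple Lie algebras and the adjoint representation. -/

section Simple

variable {N : ℕ} {G : Subgroup (GL (Fin N) ℂ)} {𝔤 : LieSubalgebra ℂ (Matrix (Fin N) (Fin N) ℂ)}
  {μ : 𝔤} {d : ℕ} [NeZero d] [LieAlgebra.IsSimple ℂ 𝔤]

theorem bijOn_phaseSpace_of_isSimple (hG : IsAlgebraicGroup G) (h𝔤 : IsLieAlgebraOf 𝔤 G)
    (hμ : IsMinuscule μ) (hd : IsFractional d (μ : Matrix (Fin N) (Fin N) ℂ)) : Set.BijOn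
      (fun p : nPlus μ × nMinus μ => expForm d (μ : Matrix (Fin N) (Fin N) ℂ) tUnit
        ((p.1 : 𝔤) : Matrix (Fin N) (Fin N) ℂ) ((p.2 : 𝔤) : Matrix (Fin N) (Fin N) ℂ))
      Set.univ (phaseSpace G d (μ : Matrix (Fin N) (Fin N) ℂ) (-(μ : Matrix (Fin N) (Fin N) ℂ))) :=
  ((CoweightData.of_isSimple hG h𝔤 hμ hd).bijOn_phaseSpace.comp bijOn_pairs).congr fun _ _ => rfl

theorem bijOn_phaseSpaceFormal_of_isSimple (hG : IsAlgebraicGroup G) (h𝔤 : IsLieAlgebraOf 𝔤 G)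
    (hμ : IsMinuscule μ) (hd : IsFractional d (μ : Matrix (Fin N) (Fin N) ℂ)) : Set.BijOn
      (fun p : nPlus μ × nMinus μ => expForm d (μ : Matrix (Fin N) (Fin N) ℂ) TUnit
        ((p.1 : 𝔤) : Matrix (Fin N) (Fin N) ℂ) ((p.2 : 𝔤) : Matrix (Fin N) (Fin N) ℂ))
      Set.univ
      (phaseSpaceFormal G d (μ : Matrix (Fin N) (Fin N) ℂ) (-(μ : Matrix (Fin N) (Fin N) ℂ))) :=
  ((CoweightData.of_isSimple hG h𝔤 hμ hd).bijOn_phaseSpaceFormal.comp bijOn_pairs).congr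
    fun _ _ => rfl

end Simple

section Adjoint

variable {𝔤 : Type*} [LieRing 𝔤] [LieAlgebra ℂ 𝔤] [Module.Finite ℂ 𝔤] {μ : 𝔤}
  {B : LinearMap.BilinForm ℂ 𝔤}

theorem rllData_adMatrix [LieAlgebra.IsSimple ℂ 𝔤] (hB : B.Nondegenerate) (hsymm : B.IsSymm)
    (hinv : ∀ x y w : 𝔤, B ⁅x, y⁆ w = B x ⁅y, w⁆)
    (hμ : IsMinuscule μ) {r : ℕ} (X : Module.Basis (Fin r) ℂ (nPlus μ))
    (Y : Module.Basis (Fin r) ℂ (nMinus μ))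
    (hXY : ∀ m n, B (X m : 𝔤) (Y n : 𝔤) = if m = n then 1 else 0) :
    RLLData 1 r (adMatrix μ) (fun m => adMatrix (X m : 𝔤)) (fun m => adMatrix (Y m : 𝔤))
      (casimir B hB adMatrix) :=
  rllData_of_rep hB hsymm hinv hμ X Y hXY adRep_ne_zero (isFractional_adRep hμ)

end Adjoint

end HooftLine

end

theorem mainTheorem5 :
    -- a simple algebraic group `G` in `GL_N`, with Lie algebra `𝔤` and invariant form `B`, and a
    -- minuscule coweight `μ` such that `z ^ μ` is defined over `z ^ (1/d)`
    (∀ (N : ℕ) (G : Subgroup (GL (Fin N) ℂ)) (𝔤 : LieSubalgebra ℂ (Matrix (Fin N) (Fin N) ℂ))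
      (B : LinearMap.BilinForm ℂ 𝔤) (hB : B.Nondegenerate) (μ : 𝔤) (d : ℕ) [NeZero d],
      HooftLine.IsAlgebraicGroup G →
      HooftLine.IsLieAlgebraOf 𝔤 G →
      LieAlgebra.IsSimple ℂ 𝔤 →
      B.IsSymm →
      (∀ x y w : 𝔤, B ⁅x, y⁆ w = B x ⁅y, w⁆) →
      HooftLine.IsMinuscule μ →
      HooftLine.IsFractional d (μ : Matrix (Fin N) (Fin N) ℂ) →
      -- `(X⁺, X⁻) ↦ e ^ {X⁺} z ^ μ e ^ {X⁻}` is a bijection from `𝔫⁺ ⊕ 𝔫⁻` to the phase space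
      Set.BijOn
        (fun p : HooftLine.nPlus μ × HooftLine.nMinus μ =>
          HooftLine.expForm d (μ : Matrix (Fin N) (Fin N) ℂ) HooftLine.tUnit
            ((p.1 : 𝔤) : Matrix (Fin N) (Fin N) ℂ) ((p.2 : 𝔤) : Matrix (Fin N) (Fin N) ℂ))
        Set.univ (HooftLine.phaseSpace G d (μ : Matrix (Fin N) (Fin N) ℂ)
          (-(μ : Matrix (Fin N) (Fin N) ℂ))) ∧
      Set.BijOn
        (fun p : HooftLine.nPlus μ × HooftLine.nMinus μ =>
          HooftLine.expForm d (μ : Matrix (Fin N) (Fin N) ℂ) HooftLine.TUnit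
            ((p.1 : 𝔤) : Matrix (Fin N) (Fin N) ℂ) ((p.2 : 𝔤) : Matrix (Fin N) (Fin N) ℂ))
        Set.univ (HooftLine.phaseSpaceFormal G d (μ : Matrix (Fin N) (Fin N) ℂ)
          (-(μ : Matrix (Fin N) (Fin N) ℂ))) ∧
      -- `𝔫⁺ ⊕ 𝔫⁻` is a symplectic vector space
      (HooftLine.symplecticForm B μ).IsAlt ∧
      (HooftLine.symplecticForm B μ).Nondegenerate ∧
      -- the Poisson bracket in linear coordinates attached to dual bases of `𝔫⁺` and `𝔫⁻`
      ∀ (r : ℕ) (X : Module.Basis (Fin r) ℂ (HooftLine.nPlus μ))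
        (Y : Module.Basis (Fin r) ℂ (HooftLine.nMinus μ)),
        (∀ m n, B (X m : 𝔤) (Y n : 𝔤) = if m = n then 1 else 0) →
        (∃! P : HooftLine.PoissonBracket (HooftLine.Coord r), HooftLine.IsCanonical P) ∧
        -- the RLL relation in the adjoint representation
        (∀ P : HooftLine.PoissonBracket (HooftLine.Coord r),
          HooftLine.RLL 1 (HooftLine.casimir B hB HooftLine.adMatrix)
            (HooftLine.LOp 1 (HooftLine.adMatrix μ) (fun m => HooftLine.adMatrix (X m : 𝔤))
              (fun m => HooftLine.adMatrix (Y m : 𝔤))) P ↔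
          HooftLine.IsCanonical P) ∧
        -- the RLL relation in an arbitrary nontrivial representation
        (∀ (k : ℕ) (ρ : 𝔤 →ₗ⁅ℂ⁆ Matrix (Fin k) (Fin k) ℂ) (e : ℕ) [NeZero e], ρ ≠ 0 →
          HooftLine.IsFractional e (ρ μ) →
          ∀ P : HooftLine.PoissonBracket (HooftLine.Coord r),
            HooftLine.RLL e (HooftLine.casimir B hB ρ)
              (HooftLine.LOp e (ρ μ) (fun m => ρ (X m : 𝔤)) (fun m => ρ (Y m : 𝔤))) P ↔
            HooftLine.IsCanonical P)) ∧
    -- type A: `SL_n` with `n = m + 1`, and `z = t ^ n`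
    (∀ m : ℕ,
      Set.BijOn
        (fun p : (Fin m → ℂ) × (Fin m → ℂ) =>
          ((HooftLine.tUnit⁻¹ : (LaurentSeries ℂ)ˣ) : LaurentSeries ℂ) •
            HooftLine.oscL (fun i => algebraMap ℂ (LaurentSeries ℂ) (p.1 i))
              (fun i => algebraMap ℂ (LaurentSeries ℂ) (p.2 i))
              ((HooftLine.tUnit : LaurentSeries ℂ) ^ (m + 1)))
        Set.univ (HooftLine.phaseSpace (HooftLine.SLGroup (m + 1)) (m + 1) (HooftLine.muA m)
          (-HooftLine.muA m)) ∧
      (∀ t : ℂˣ,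
        HooftLine.LOp (m + 1) (HooftLine.muA m)
          (fun i : Fin m => Matrix.single 0 i.succ 1) (fun i : Fin m => Matrix.single i.succ 0 1) t =
        ((t : ℂ)⁻¹) • HooftLine.oscL HooftLine.bVar HooftLine.cVar
          (algebraMap ℂ (HooftLine.Coord m) ((t : ℂ) ^ (m + 1)))) ∧
      (∀ P : HooftLine.PoissonBracket (HooftLine.Coord m),
        HooftLine.RLL 1 (HooftLine.swapMatrix (Fin (m + 1)))
          (fun t : ℂˣ => HooftLine.oscL HooftLine.bVar HooftLine.cVar
            (algebraMap ℂ (HooftLine.Coord m) (t : ℂ))) P ↔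
        HooftLine.IsCanonical P)) := by
  refine ⟨?_, fun m => ⟨HooftLine.bijOn_oscL, HooftLine.LOp_muA, fun P => ?_⟩⟩
  · intro N G 𝔤 B hB μ d _ hG h𝔤 _ hsymm hinv hμ hd
    refine ⟨HooftLine.bijOn_phaseSpace_of_isSimple hG h𝔤 hμ hd,
      HooftLine.bijOn_phaseSpaceFormal_of_isSimple hG h𝔤 hμ hd, HooftLine.symplecticForm_isAlt,
      HooftLine.symplecticForm_nondegenerate hB hinv hμ, fun r X Y hXY =>
      ⟨HooftLine.existsUnique_isCanonical r,
        (HooftLine.rllData_adMatrix hB hsymm hinv hμ X Y hXY).rll_iff, ?_⟩⟩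
    intro k ρ e _ hρ he
    exact (HooftLine.rllData_of_rep hB hsymm hinv hμ X Y hXY hρ he).rll_iff
  · have h := HooftLine.rllData_swapMatrix.rll_iff P
    rwa [show HooftLine.LOp 1 (Matrix.single 0 0 1)
      (fun i : Fin m => Matrix.single 0 i.succ 1) (fun i : Fin m => Matrix.single i.succ 0 1) =
      fun t : ℂˣ => HooftLine.oscL HooftLine.bVar HooftLine.cVar
        (algebraMap ℂ (HooftLine.Coord m) (t : ℂ)) from funext HooftLine.LOp_single_zero] at h
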